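/- Let $D=(V,A)$ be a simple digraph (no loops, at most one arc $uv$ for each ordered pair $(u,v)$) with $n=|V|\ge 1$ vertices and real arc weights $c:A\to\mathbb R$. The weight (length) of a walk is the sum of the weights of its arcs; paths and cycles are directed and have no repeated vertices. We call $c$ \emph{nearly conservative} on $D$ if every cycle of negative weight consists of at most two arcs. The \emph{APSP problem} for $(D,c)$ is: decide whether $c$ is nearly conservative on $D$ and, if it is, determine for all ordered pairs $(s,t)$ of vertices whether $t$ is reachable from $s$ and, if so, the length of a shortest path from $s$ to $t$. Let $F$ be the undirected graph on $V$ whose edges are the pairs $u\neq v$ such that $uv$ and $vu$ are both arcs and $c(uv)+c(vu)<0$. If $F$ is a forest, the \emph{negative trees} are the components of $F$ that have at least one edge; the negative trees in a subdigraph induced by $B\subseteq V$ are the components, with at least one edge, of the subgraph of $F$ induced by $B$. A \emph{weak block} of a digraph is a block of its underlying undirected graph, i.e. a maximal connected subgraph without a cut vertex of its own. Corollary. For every constant $\gamma\in\mathbb N$ there is an algorithm (a program for a random access machine on which reading and writing array cells, addition, subtraction and comparison of natural numbers and of real numbers each take one step) with the following property. On every input $(D,c)$ such that either $F$ is not a forest,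 or $F$ is a forest and every weak block of every strongly connected component of $D$ contains at most $\gamma$ negative trees, the algorithm solves the APSP problem in time $O_\gamma(n^4)$, that is, in at most $C_\gamma\, n^4$ steps, where $C_\gamma$ depends only on $\gamma$. -/

import Mathlib

noncomputable section

namespace NearlyConservative

/-! ## Weighted digraphs, distances, nearly conservative weights

A digraph `D` has at most one arc `uv` for every ordered pair of vertices, so a walk is given by
the list of its vertices. Only the values of `c` on arcs matter. -/

section Digraphs

variable {V : Type*}

/-- `l = [v₀, v₁, …, v_ℓ]` is the vertex sequence of a walk of `D` from `s` to `t`. -/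
def IsWalk (D : Digraph V) (s t : V) (l : List V) : Prop :=
  l.head? = some s ∧ l.getLast? = some t ∧ l.IsChain D.Adj

/-- A path is a walk whose vertices are all distinct; `[s]` is the empty path at `s`. -/
def IsPath (D : Digraph V) (s t : V) (l : List V) : Prop :=
  IsWalk D s t l ∧ l.Nodup

/-- The length (weight) of a walk: the sum of the weights of its arcs. -/
def walkWeight (c : V → V → ℝ) : List V → ℝ
  | u :: v :: l => c u v + walkWeight c (v :: l)
  | _ => 0

/-- The vertices `v₀, l₁, …, l_k` are distinct and `v₀, l₁, …, l_k, v₀` is a closed walk of `D`.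
This cycle has `k + 1` arcs. -/
def IsCycle (D : Digraph V) (v₀ : V) (l : List V) : Prop :=
  (v₀ :: l).Nodup ∧ IsWalk D v₀ v₀ (v₀ :: (l ++ [v₀]))

/-- Every directed cycle of negative weight consists of at most two arcs. -/
def IsNearlyConservative (D : Digraph V) (c : V → V → ℝ) : Prop :=
  ∀ (v₀ : V) (l : List V), IsCycle D v₀ l → walkWeight c (v₀ :: (l ++ [v₀])) < 0 →
    l.length + 1 ≤ 2

/-- There is a directed path (equivalently a directed walk) from `s` to `t`. -/
def Reachable (D : Digraph V) (s t : V) : Prop := ∃ l, IsPath D s t l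

/-- `d` is the length of a shortest path from `s` to `t`. -/
def IsDist (D : Digraph V) (c : V → V → ℝ) (s t : V) (d : ℝ) : Prop :=
  IsLeast {x : ℝ | ∃ l, IsPath D s t l ∧ x = walkWeight c l} d

/-! ## Negative trees, strongly connected components, weak blocks -/

/-- The undirected graph `F`: its edges are the pairs `u ≠ v` such that `uv` and `vu` are both
arcs and `c(uv) + c(vu) < 0`. -/
def negGraph (D : Digraph V) (c : V → V → ℝ) : SimpleGraph V where
  Adj u v := u ≠ v ∧ D.Adj u v ∧ D.Adj v u ∧ c u v + c v u < 0
  symm := ⟨fun u v h => ⟨h.1.symm, h.2.2.1, h.2.1, by rw [add_comm]; exact h.2.2.2⟩⟩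

/-- `K` is the vertex set of a strongly connected component of `D`: a class of the equivalence
relation of mutual reachability. -/
def IsStrongComponent (D : Digraph V) (K : Set V) : Prop :=
  ∃ v, K = {u | Reachable D u v ∧ Reachable D v u}

/-- The graph that `G` induces on `B` is connected and has no cut vertex. -/
def IsNonseparable (G : SimpleGraph V) (B : Set V) : Prop :=
  (G.induce B).Connected ∧ ∀ v ∈ B, (G.induce (B \ {v})).Preconnected

/-- `B` is the vertex set of a weak block of the subdigraph of `D` induced by `K`, that is, of a
2-connected block of the underlying undirected graph of that subdigraph: a maximal connected
subgraph without a cut vertex of its own. (As usual, a bridge with its two end vertices is a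
block, and so is an isolated vertex.) -/
def IsWeakBlock (D : Digraph V) (K B : Set V) : Prop :=
  Maximal (fun S : Set V => S ⊆ K ∧ IsNonseparable D.toSimpleGraphInclusive S) B

/-- The number of negative trees in the subdigraph of `D` induced by `B`: the number of
components, with at least one edge, of the graph that `F` induces on `B`. (Used when `F` is a
forest.) -/
def numNegTrees (D : Digraph V) (c : V → V → ℝ) (B : Set V) : ℕ :=
  {T : ((negGraph D c).induce B).ConnectedComponent | T.supp.Nontrivial}.ncard

/-- If `F` is a forest, so that negative trees are defined, then every weak block of every
strongly connected component of `D` contains at most `γ` negative trees. (If `F` is not a forest,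
there is no requirement.) -/
def HasFewNegTrees (D : Digraph V) (c : V → V → ℝ) (γ : ℕ) : Prop :=
  (negGraph D c).IsAcyclic →
    ∀ K B : Set V, IsStrongComponent D K → IsWeakBlock D K B → numNegTrees D c B ≤ γ

end Digraphs

/-! ## The machine model

A real random access machine, given by structured programs. Its memory consists of arrays of
natural numbers and arrays of real numbers; an array cell is addressed by the (constant) name of
the array and two natural numbers, and scalar variables are cells at constant addresses.
The unit-cost operations are: reading and writing a cell, addition and subtraction (truncated on
the natural numbers) and comparison. There is no multiplication, no rounding and no conversion
between real and natural numbers, and no real constant other than `0`. -/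

/-- The memory: `nat a i j` and `real a i j` are the cells with address `(i, j)` of the
natural-number array and of the real array with name `a`. -/
structure Memory where
  nat : ℕ → ℕ → ℕ → ℕ
  real : ℕ → ℕ → ℕ → ℝ

/-- Expressions for natural numbers. -/
inductive NatExpr where
  | const (k : ℕ)
  | read (a : ℕ) (i j : NatExpr)
  | add (e f : NatExpr)
  | sub (e f : NatExpr)

/-- Expressions for real numbers. -/
inductive RealExpr where
  | zero
  | read (a : ℕ) (i j : NatExpr)
  | add (e f : RealExpr)
  | sub (e f : RealExpr)

/-- Tests. -/
inductive Test where
  | natLt (e f : NatExpr)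
  | natEq (e f : NatExpr)
  | realLt (e f : RealExpr)
  | not (b : Test)
  | and (b b' : Test)

/-- Programs. -/
inductive Program where
  | skip
  | setNat (a : ℕ) (i j e : NatExpr)
  | setReal (a : ℕ) (i j : NatExpr) (e : RealExpr)
  | seq (P Q : Program)
  | cond (b : Test) (P Q : Program)
  | loop (b : Test) (P : Program)

/-- The value of an expression. -/
def NatExpr.val (m : Memory) : NatExpr → ℕ
  | .const k => k
  | .read a i j => m.nat a (i.val m) (j.val m)
  | .add e f => e.val m + f.val m
  | .sub e f => e.val m - f.val m

/-- The number of operations in the evaluation of an expression. -/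
def NatExpr.cost : NatExpr → ℕ
  | .const _ => 1
  | .read _ i j => i.cost + j.cost + 1
  | .add e f => e.cost + f.cost + 1
  | .sub e f => e.cost + f.cost + 1

/-- The value of an expression. -/
def RealExpr.val (m : Memory) : RealExpr → ℝ
  | .zero => 0
  | .read a i j => m.real a (i.val m) (j.val m)
  | .add e f => e.val m + f.val m
  | .sub e f => e.val m - f.val m

/-- The number of operations in the evaluation of an expression. -/
def RealExpr.cost : RealExpr → ℕ
  | .zero => 1
  | .read _ i j => i.cost + j.cost + 1
  | .add e f => e.cost + f.cost + 1
  | .sub e f => e.cost + f.cost + 1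

/-- The test `b` succeeds in the memory `m`. -/
def Test.holds (m : Memory) : Test → Prop
  | .natLt e f => e.val m < f.val m
  | .natEq e f => e.val m = f.val m
  | .realLt e f => e.val m < f.val m
  | .not b => ¬ b.holds m
  | .and b b' => b.holds m ∧ b'.holds m

/-- The number of operations in the evaluation of a test. -/
def Test.cost : Test → ℕ
  | .natLt e f => e.cost + f.cost + 1
  | .natEq e f => e.cost + f.cost + 1
  | .realLt e f => e.cost + f.cost + 1
  | .not b => b.cost + 1
  | .and b b' => b.cost + b'.cost + 1

/-- The memory after the value `x` has been written into a natural-number cell. -/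
def Memory.writeNat (m : Memory) (a i j x : ℕ) : Memory where
  nat a' i' j' := if a' = a ∧ i' = i ∧ j' = j then x else m.nat a' i' j'
  real := m.real

/-- The memory after the value `x` has been written into a real cell. -/
def Memory.writeReal (m : Memory) (a i j : ℕ) (x : ℝ) : Memory where
  nat := m.nat
  real a' i' j' := if a' = a ∧ i' = i ∧ j' = j then x else m.real a' i' j'

/-- `Runs P m m' τ`: the program `P`, started with the memory `m`, halts after exactly `τ` steps
with the memory `m'`. -/
inductive Runs : Program → Memory → Memory → ℕ → Prop where
  | skip (m : Memory) : Runs .skip m m 1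
  | setNat (m : Memory) (a : ℕ) (i j e : NatExpr) :
      Runs (.setNat a i j e) m (m.writeNat a (i.val m) (j.val m) (e.val m))
        (i.cost + j.cost + e.cost + 1)
  | setReal (m : Memory) (a : ℕ) (i j : NatExpr) (e : RealExpr) :
      Runs (.setReal a i j e) m (m.writeReal a (i.val m) (j.val m) (e.val m))
        (i.cost + j.cost + e.cost + 1)
  | seq {P Q : Program} {m m' m'' : Memory} {τ τ' : ℕ} :
      Runs P m m' τ → Runs Q m' m'' τ' → Runs (.seq P Q) m m'' (τ + τ')
  | cond_true {b : Test} {P Q : Program} {m m' : Memory} {τ : ℕ} :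
      b.holds m → Runs P m m' τ → Runs (.cond b P Q) m m' (b.cost + τ + 1)
  | cond_false {b : Test} {P Q : Program} {m m' : Memory} {τ : ℕ} :
      ¬ b.holds m → Runs Q m m' τ → Runs (.cond b P Q) m m' (b.cost + τ + 1)
  | loop_done {b : Test} {P : Program} {m : Memory} :
      ¬ b.holds m → Runs (.loop b P) m m (b.cost + 1)
  | loop_step {b : Test} {P : Program} {m m' m'' : Memory} {τ τ' : ℕ} :
      b.holds m → Runs P m m' τ → Runs (.loop b P) m' m'' τ' →
        Runs (.loop b P) m m'' (b.cost + τ + τ' + 1)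

/-! ## The All Pairs Shortest Path problem -/

open Classical in
/-- The initial memory: cell `(0, 0)` of the natural-number array `0` holds the number `n` of
vertices, the natural-number array `1` holds the adjacency matrix of `D`, and the real array `0`
holds the weights of the arcs. All other cells hold `0`. -/
def inputMemory {n : ℕ} (D : Digraph (Fin n)) (c : Fin n → Fin n → ℝ) : Memory where
  nat a i j :=
    if a = 0 ∧ i = 0 ∧ j = 0 then n
    else if a = 1 ∧ ∃ u v : Fin n, D.Adj u v ∧ (u : ℕ) = i ∧ (v : ℕ) = j then 1
    else 0
  real a i j :=
    if h : i < n ∧ j < n then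
      if a = 0 ∧ D.Adj ⟨i, h.1⟩ ⟨j, h.2⟩ then c ⟨i, h.1⟩ ⟨j, h.2⟩ else 0
    else 0

/-- The final memory `m` holds a solution of the APSP problem for `(D, c)`. Cell `(0, 0)` of the
natural-number array `2` tells whether `c` is nearly conservative on `D` (`1` for yes, `0` for
no). If it is, then for all `s` and `t` the cell `(s, t)` of the natural-number array `3` tells
whether `t` can be reached from `s`, and if it can, the cell `(s, t)` of the real array `1` holds
the length of a shortest path from `s` to `t`. -/
def IsAPSPSolution {n : ℕ} (D : Digraph (Fin n)) (c : Fin n → Fin n → ℝ) (m : Memory) : Prop :=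
  (IsNearlyConservative D c ∧ m.nat 2 0 0 = 1 ∧
    ∀ s t : Fin n,
      (Reachable D s t ∧ m.nat 3 s t = 1 ∧ IsDist D c s t (m.real 1 s t)) ∨
      (¬ Reachable D s t ∧ m.nat 3 s t = 0)) ∨
  (¬ IsNearlyConservative D c ∧ m.nat 2 0 0 = 0)

end NearlyConservative

end

noncomputable section

namespace NearlyConservative

/-! ## Commands with bounded loops

A small imperative language whose only loops are `for v < n`. It compiles to programs, has a
denotational semantics, and its running time is bounded by a polynomial in `n`. -/

/-! The algorithm is a sequence of min-plus matrix operations. The difficulty is that such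
operations concatenate walks, and a walk that runs back and forth along an edge of `F` can be
shorter than every path. So only walks that never use an edge of `F` in both directions may be
formed. If `c` is nearly conservative, such a walk contains a path of no larger weight
(`Realized.exists_path`): each cycle cut out has at least three arcs or is a nonnegative 2-cycle.

Near-conservativity forces `F` to be a forest, since a cycle of `F` taken in both directions has
negative total weight (`negForest_of_nonnegLongCycles`). Without negative cycles of three or more
arcs, a path of `F` is shortest among all paths with its ends (`walkWeight_le_of_negative_path`).
Hence a path in a block can be changed so that it uses each negative tree in one piece: take its
last arc in `F`, say in the tree `T`, and the first vertex of the path on `T`; replace the part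
between them by the tree path and recurse on the initial part, which avoids `T`. So the path is
bounded below by an entry of a product d₀ τ_{T₁} d₀ ⋯ τ_{Tₖ} d₀ with distinct `Tᵢ`, where d₀ belongs
to the arcs outside `F` and τ_T holds the lengths of the paths in `T`
(`BlockData.exists_evalSeq_le`). The trees of each block get labels below `γ`, reused from block to
block, so one matrix per label serves all blocks and the number of products depends only on `γ`.

The same products decide near-conservativity (`MatrixSpec.tests_iff`): `F` must be a forest, d₀(x,y)
+ d₀(y,x) must be nonnegative, and so must the (x,y) entry of a product plus τ_T(y,x) for every
label `T` that the product does not use. These sums are weights of closed walks that use no edge of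
`F` twice, so the tests are necessary. For sufficiency, a cycle lies in one block
(`nonnegLongCycles_of_blocks`), and there the labels are added one by one, each tree leaf by leaf. A
cycle of at least three arcs that becomes available uses exactly one direction of the new leaf edge,
and it is bounded below by a tree path through that edge plus an entry of a product of earlier trees
(`BlockData.nonneg_insert_leaf`).

Two vertices of a strong component in different blocks are separated by a vertex z. Every path
between them passes through z, and two paths joined at z have no other common vertex; so distances
add up at separators, and n rounds of relaxation suffice (`componentCmd_spec`). Paths through
several components are cut at their last arc between components (`crossCmd_spec`).

All programs come from commands whose only loops are `for v < n`; nesting depth d costs at most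
`size * n ^ d` steps (`Cmd.runs`). The search over label sequences is unrolled into the program
text, so it affects only the size, and every stage has depth at most four (`fast_apspCmd`). -/

/-- Commands built with loops of the form `for v < n`, where `n` is the cell `(0, 0)` of the
natural-number array `0`. -/
inductive Cmd where
  | skip
  | setNat (a : ℕ) (i j e : NatExpr)
  | setReal (a : ℕ) (i j : NatExpr) (e : RealExpr)
  | seq (P Q : Cmd)
  | ite (b : Test) (P Q : Cmd)
  | for_ (v : ℕ) (P : Cmd)

/-- The scalar variable `v`. -/
abbrev NatExpr.var (v : ℕ) : NatExpr := .read v (.const 0) (.const 0)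

@[simp] theorem NatExpr.val_var (m : Memory) (v : ℕ) : (NatExpr.var v).val m = m.nat v 0 0 := rfl

namespace Cmd

/-- The program that a command stands for. -/
def prog : Cmd → Program
  | skip => .skip
  | setNat a i j e => .setNat a i j e
  | setReal a i j e => .setReal a i j e
  | seq P Q => .seq P.prog Q.prog
  | ite b P Q => .cond b P.prog Q.prog
  | for_ v P => .seq (.setNat v (.const 0) (.const 0) (.const 0))
      (.loop (.natLt (.var v) (.var 0))
        (.seq P.prog (.setNat v (.const 0) (.const 0) (.add (.var v) (.const 1)))))

/-- The memory after `i` iterations of a loop with counter `v` and body `f`. -/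
def forIter (f : Memory → Memory) (v : ℕ) (m : Memory) : ℕ → Memory
  | 0 => m.writeNat v 0 0 0
  | i + 1 => (f (forIter f v m i)).writeNat v 0 0 (i + 1)

open Classical in
/-- The effect of a command on the memory. -/
def exec : Cmd → Memory → Memory
  | skip, m => m
  | setNat a i j e, m => m.writeNat a (i.val m) (j.val m) (e.val m)
  | setReal a i j e, m => m.writeReal a (i.val m) (j.val m) (e.val m)
  | seq P Q, m => Q.exec (P.exec m)
  | ite b P Q, m => if b.holds m then P.exec m else Q.exec m
  -- The bound is read once here, whereas the compiled loop rereads it in every test. The two agree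
  -- when the body leaves array `0` alone, which is why `runs` assumes this.
  | for_ v P, m => forIter P.exec v m (m.nat 0 0 0)

/-- The command may write into the natural-number array `a`. -/
def WritesNat : Cmd → ℕ → Prop
  | skip, _ => False
  | setNat b _ _ _, a => a = b
  | setReal _ _ _ _, _ => False
  | seq P Q, a => P.WritesNat a ∨ Q.WritesNat a
  | ite _ P Q, a => P.WritesNat a ∨ Q.WritesNat a
  | for_ v P, a => a = v ∨ P.WritesNat a

/-- The command may write into the real array `a`. -/
def WritesReal : Cmd → ℕ → Prop
  | skip, _ => False
  | setNat _ _ _ _, _ => False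
  | setReal b _ _ _, a => a = b
  | seq P Q, a => P.WritesReal a ∨ Q.WritesReal a
  | ite _ P Q, a => P.WritesReal a ∨ Q.WritesReal a
  | for_ _ P, a => P.WritesReal a

/-- No loop body writes into the counter of the loop. -/
def Wf : Cmd → Prop
  | skip => True
  | setNat _ _ _ _ => True
  | setReal _ _ _ _ => True
  | seq P Q => P.Wf ∧ Q.Wf
  | ite _ P Q => P.Wf ∧ Q.Wf
  | for_ v P => ¬ P.WritesNat v ∧ P.Wf

/-- The nesting depth of the loops. -/
def depth : Cmd → ℕ
  | skip => 0
  | setNat _ _ _ _ => 0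
  | setReal _ _ _ _ => 0
  | seq P Q => max P.depth Q.depth
  | ite _ P Q => max P.depth Q.depth
  | for_ _ P => P.depth + 1

/-- The constant in the bound for the running time. -/
def size : Cmd → ℕ
  | skip => 1
  | setNat _ i j e => i.cost + j.cost + e.cost + 1
  | setReal _ i j e => i.cost + j.cost + e.cost + 1
  | seq P Q => P.size + Q.size
  | ite b P Q => b.cost + P.size + Q.size + 1
  -- 16 for the overhead of one iteration, plus 8 for the final test and 4 for the initialisation,
  -- both absorbed because `0 < n`.
  | for_ _ P => P.size + 28

/-! ### Frame rules -/

theorem exec_nat_of_not_writes {P : Cmd} {a : ℕ} (h : ¬ P.WritesNat a) (m : Memory) :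
    (P.exec m).nat a = m.nat a := by
  induction P generalizing m with
  | skip => rfl
  | setNat b i j e =>
    funext x y
    simp only [WritesNat] at h
    simp [exec, Memory.writeNat, h]
  | setReal b i j e => rfl
  | seq P Q hP hQ =>
    simp only [WritesNat, not_or] at h
    simp only [exec]
    rw [hQ h.2, hP h.1]
  | ite b P Q hP hQ =>
    simp only [WritesNat, not_or] at h
    simp only [exec]
    split_ifs
    · exact hP h.1 m
    · exact hQ h.2 m
  | for_ v P hP =>
    simp only [WritesNat, not_or] at h
    have key : ∀ k, (forIter P.exec v m k).nat a = m.nat a := by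
      intro k
      induction k with
      | zero => funext x y; simp [forIter, Memory.writeNat, h.1]
      | succ k ih =>
        rw [← ih, ← hP h.2 (forIter P.exec v m k)]
        funext x y
        simp [forIter, Memory.writeNat, h.1]
    exact key _

theorem exec_real_of_not_writes {P : Cmd} {a : ℕ} (h : ¬ P.WritesReal a) (m : Memory) :
    (P.exec m).real a = m.real a := by
  induction P generalizing m with
  | skip => rfl
  | setNat b i j e => rfl
  | setReal b i j e =>
    funext x y
    simp only [WritesReal] at h
    simp [exec, Memory.writeReal, h]
  | seq P Q hP hQ =>
    simp only [WritesReal, not_or] at h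
    simp only [exec]
    rw [hQ h.2, hP h.1]
  | ite b P Q hP hQ =>
    simp only [WritesReal, not_or] at h
    simp only [exec]
    split_ifs
    · exact hP h.1 m
    · exact hQ h.2 m
  | for_ v P hP =>
    simp only [WritesReal] at h
    have key : ∀ k, (forIter P.exec v m k).real a = m.real a := by
      intro k
      induction k with
      | zero => rfl
      | succ k ih =>
        rw [← ih, ← hP h (forIter P.exec v m k)]
        rfl
    exact key _

/-! ### Running time of a command -/

theorem forIter_counter (f : Memory → Memory) (v : ℕ) (m : Memory) (k : ℕ) :
    (forIter f v m k).nat v 0 0 = k := by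
  cases k <;> simp [forIter, Memory.writeNat]

/-- Induction on the number `k` of iterations that remain. The failing test at the end costs 8
steps; test, increment and loop overhead cost 16 steps per iteration. -/
theorem loop_runs {P : Cmd} {v n C : ℕ} (hv : ¬ P.WritesNat v) (h0 : ¬ P.WritesNat 0)
    (hv0 : v ≠ 0) (hP : ∀ m, m.nat 0 0 0 = n → ∃ τ ≤ C, Runs P.prog m (P.exec m) τ)
    (m : Memory) (hm : m.nat 0 0 0 = n) (k : ℕ) (hk : k ≤ n) :
    ∃ τ ≤ k * (C + 16) + 8, Runs (.loop (.natLt (.var v) (.var 0))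
        (.seq P.prog (.setNat v (.const 0) (.const 0) (.add (.var v) (.const 1)))))
      (forIter P.exec v m (n - k)) (forIter P.exec v m n) τ := by
  have hn0 : ∀ k, (forIter P.exec v m k).nat 0 0 0 = n := by
    intro k
    induction k with
    | zero => simp [forIter, Memory.writeNat, hv0.symm, hm]
    | succ k ih =>
      simp [forIter, Memory.writeNat, hv0.symm, exec_nat_of_not_writes h0, ih]
  induction k with
  | zero =>
    refine ⟨_, ?_, Runs.loop_done ?_⟩
    · simp [Test.cost, NatExpr.cost]
    · simp [Test.holds, NatExpr.val, forIter_counter, hn0]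
  | succ k ih =>
    obtain ⟨τ, hτ, hr⟩ := ih (by omega)
    obtain ⟨τ', hτ', hr'⟩ := hP (forIter P.exec v m (n - (k + 1))) (hn0 _)
    have e : n - k = n - (k + 1) + 1 := by omega
    refine ⟨_, ?_, Runs.loop_step ?_ (Runs.seq hr' (Runs.setNat _ _ _ _ _)) ?_ (τ' := τ)⟩
    · simp [Test.cost, NatExpr.cost]
      nlinarith
    · simp only [Test.holds, NatExpr.val_var, forIter_counter, hn0]
      omega
    · rw [e] at hr
      convert hr using 1
      simp [forIter, NatExpr.val, exec_nat_of_not_writes hv, forIter_counter]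

/-- A command halts, computes its denotation and needs at most `size * n ^ depth` steps. -/
theorem runs {P : Cmd} (hP : P.Wf) (h0 : ¬ P.WritesNat 0) {n : ℕ} (hn : 0 < n) (m : Memory)
    (hm : m.nat 0 0 0 = n) :
    ∃ τ ≤ P.size * n ^ P.depth, Runs P.prog m (P.exec m) τ := by
  have hpow : ∀ a b : ℕ, a ≤ b → n ^ a ≤ n ^ b := fun a b h => Nat.pow_le_pow_right hn h
  induction P generalizing m with
  | skip => exact ⟨_, by simp [size, depth], Runs.skip m⟩
  | setNat a i j e => exact ⟨_, by simp [size, depth], Runs.setNat m a i j e⟩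
  | setReal a i j e => exact ⟨_, by simp [size, depth], Runs.setReal m a i j e⟩
  | seq P Q ihP ihQ =>
    simp only [WritesNat, not_or] at h0
    obtain ⟨τ, hτ, hr⟩ := ihP hP.1 h0.1 m hm
    obtain ⟨τ', hτ', hr'⟩ := ihQ hP.2 h0.2 (P.exec m)
      (by rw [exec_nat_of_not_writes h0.1, hm])
    refine ⟨_, ?_, Runs.seq hr hr'⟩
    have h1 := Nat.mul_le_mul_left P.size (hpow _ _ (le_max_left P.depth Q.depth))
    have h2 := Nat.mul_le_mul_left Q.size (hpow _ _ (le_max_right P.depth Q.depth))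
    simp only [size, depth, add_mul]
    omega
  | ite b P Q ihP ihQ =>
    simp only [WritesNat, not_or] at h0
    have h1 := Nat.mul_le_mul_left P.size (hpow _ _ (le_max_left P.depth Q.depth))
    have h2 := Nat.mul_le_mul_left Q.size (hpow _ _ (le_max_right P.depth Q.depth))
    have h3 : b.cost + 1 ≤ (b.cost + 1) * n ^ (max P.depth Q.depth) :=
      Nat.le_mul_of_pos_right _ (by positivity)
    have h4 : (P.ite b Q).size * n ^ (P.ite b Q).depth =
        P.size * n ^ (max P.depth Q.depth) + Q.size * n ^ (max P.depth Q.depth)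
          + (b.cost + 1) * n ^ (max P.depth Q.depth) := by
      simp only [size, depth]
      ring
    by_cases hb : b.holds m
    · obtain ⟨τ, hτ, hr⟩ := ihP hP.1 h0.1 m hm
      refine ⟨_, ?_, by simpa [exec, hb, prog] using Runs.cond_true hb hr⟩
      omega
    · obtain ⟨τ, hτ, hr⟩ := ihQ hP.2 h0.2 m hm
      refine ⟨_, ?_, by simpa [exec, hb, prog] using Runs.cond_false hb hr⟩
      omega
  | for_ v P ih =>
    simp only [WritesNat, not_or] at h0
    obtain ⟨τ, hτ, hr⟩ := loop_runs hP.1 h0.2 (Ne.symm h0.1) (fun m hm => ih hP.2 h0.2 m hm) m hm n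
      le_rfl
    refine ⟨_, ?_, Runs.seq (Runs.setNat _ _ _ _ _) ?_ (τ' := τ)⟩
    · have h3 : 1 ≤ n ^ P.depth := Nat.one_le_pow _ _ hn
      have h4 : n ≤ n ^ P.depth * n := Nat.le_mul_of_pos_left _ h3
      simp only [size, depth, NatExpr.cost, pow_succ]
      nlinarith
    · rw [Nat.sub_self] at hr
      have e : (for_ v P).exec m = forIter P.exec v m n := by simp [exec, hm]
      rw [e]
      exact hr

/-! ### Invariants of loops -/

/-- The memories `m` and `m'` agree on all cells into which `P` does not write. -/
def SameOff (P : Cmd) (m m' : Memory) : Prop :=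
  (∀ a, ¬ P.WritesNat a → m'.nat a = m.nat a) ∧ ∀ a, ¬ P.WritesReal a → m'.real a = m.real a

theorem sameOff_exec (P : Cmd) (m : Memory) : P.SameOff m (P.exec m) :=
  ⟨fun _ h => exec_nat_of_not_writes h m, fun _ h => exec_real_of_not_writes h m⟩

/-- The invariant rule for loops. -/
theorem for_inv {v : ℕ} {P : Cmd} {m : Memory} (I : ℕ → Memory → Prop)
    (h0 : I 0 (m.writeNat v 0 0 0))
    (hstep : ∀ i m', i < m.nat 0 0 0 → m'.nat v 0 0 = i → (for_ v P).SameOff m m' → I i m' →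
      I (i + 1) ((P.exec m').writeNat v 0 0 (i + 1))) :
    I (m.nat 0 0 0) ((for_ v P).exec m) := by
  have key : ∀ k ≤ m.nat 0 0 0, I k (forIter P.exec v m k) ∧
      (for_ v P).SameOff m (forIter P.exec v m k) := by
    intro k
    induction k with
    | zero =>
      refine fun _ => ⟨h0, fun a ha => ?_, fun a _ => rfl⟩
      simp only [WritesNat, not_or] at ha
      funext x y
      simp [forIter, Memory.writeNat, ha.1]
    | succ k ih =>
      intro hk
      obtain ⟨h1, h2⟩ := ih (by omega)
      refine ⟨hstep k _ (by omega) (forIter_counter _ _ _ _) h2 h1, fun a ha => ?_, fun a ha => ?_⟩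
      · rw [← h2.1 a ha]
        simp only [WritesNat, not_or] at ha
        rw [← exec_nat_of_not_writes ha.2 (forIter P.exec v m k)]
        funext x y
        simp [forIter, Memory.writeNat, ha.1]
      · rw [← h2.2 a ha]
        simp only [WritesReal] at ha
        rw [← exec_real_of_not_writes ha (forIter P.exec v m k)]
        rfl
  exact (key _ le_rfl).1

end Cmd

/-! ## Matrices in the memory -/

/-- The weight in the cell `(i, j)` of the matrix `a`: the real array `a` holds its finite values,
and the natural-number array `2 * a + 1` tells which entries are finite. -/
def Memory.wt (m : Memory) (a i j : ℕ) : WithTop ℝ :=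
  if m.nat (2 * a + 1) i j = 0 then ⊤ else (m.real a i j : WithTop ℝ)

/-- The matrix `a` of size `n`. -/
def Memory.mat (m : Memory) (n a : ℕ) (i j : Fin n) : WithTop ℝ := m.wt a i j

theorem Memory.wt_congr {m m' : Memory} {a : ℕ} (h : m'.nat (2 * a + 1) = m.nat (2 * a + 1))
    (h' : m'.real a = m.real a) : m'.wt a = m.wt a := by
  funext i j
  simp [Memory.wt, h, h']

/-- Odd natural-number arrays hold finiteness flags, even ones hold counters and tables, so the two
never interfere. In this numbering the adjacency matrix (array `1`) makes the input the matrix `0`,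
and the reachability output (array `3`) belongs to the matrix `1`. -/
theorem Memory.wt_writeNat (m : Memory) {v : ℕ} (hv : v % 2 = 0) (i j x a : ℕ) :
    (m.writeNat v i j x).wt a = m.wt a := by
  apply Memory.wt_congr
  · funext x y
    have : 2 * a + 1 ≠ v := by omega
    simp [Memory.writeNat, this]
  · rfl

theorem Memory.wt_ne_top {m : Memory} {a i j : ℕ} :
    m.wt a i j ≠ ⊤ ↔ m.nat (2 * a + 1) i j ≠ 0 := by
  unfold Memory.wt
  split_ifs with h <;> simp [h]

theorem Memory.wt_of_ne {m : Memory} {a i j : ℕ} (h : m.nat (2 * a + 1) i j ≠ 0) :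
    m.wt a i j = (m.real a i j : WithTop ℝ) := by
  simp [Memory.wt, h]

namespace Cmd

theorem SameOff.refl (P : Cmd) (m : Memory) : P.SameOff m m := ⟨fun _ _ => rfl, fun _ _ => rfl⟩

theorem SameOff.trans {P Q : Cmd} {m m' m'' : Memory} (h : P.SameOff m m') (h' : Q.SameOff m' m'')
    (hN : ∀ a, Q.WritesNat a → P.WritesNat a) (hR : ∀ a, Q.WritesReal a → P.WritesReal a) :
    P.SameOff m m'' :=
  ⟨fun a ha => by rw [h'.1 a (fun hq => ha (hN a hq)), h.1 a ha],
    fun a ha => by rw [h'.2 a (fun hq => ha (hR a hq)), h.2 a ha]⟩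

theorem SameOff.wt {P : Cmd} {m m' : Memory} (h : P.SameOff m m') {a : ℕ}
    (hN : ¬ P.WritesNat (2 * a + 1)) (hR : ¬ P.WritesReal a) : m'.wt a = m.wt a :=
  Memory.wt_congr (h.1 _ hN) (h.2 _ hR)

theorem wt_exec {P : Cmd} (m : Memory) {a : ℕ}
    (hN : ¬ P.WritesNat (2 * a + 1)) (hR : ¬ P.WritesReal a) : (P.exec m).wt a = m.wt a :=
  (P.sameOff_exec m).wt hN hR

theorem mat_exec {P : Cmd} (m : Memory) (n : ℕ) {a : ℕ}
    (hN : ¬ P.WritesNat (2 * a + 1)) (hR : ¬ P.WritesReal a) : (P.exec m).mat n a = m.mat n a := by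
  funext i j
  simp only [Memory.mat, wt_exec m hN hR]

/-- Two nested loops. -/
abbrev for2 (v w : ℕ) (P : Cmd) : Cmd := for_ v (for_ w P)

/-- The invariant rule for two nested loops. -/
theorem for2_inv {v w : ℕ} {P : Cmd} {m : Memory} {n : ℕ} (hm : m.nat 0 0 0 = n)
    (hP : ¬ P.WritesNat v) (hP0 : ¬ P.WritesNat 0)
    (hvw : v ≠ w) (hv0 : v ≠ 0) (hw0 : w ≠ 0) (J : ℕ → ℕ → Memory → Prop)
    -- `J` has to ignore both counters, because they are rewritten between the iterations.
    (hc : ∀ i j m' a x, a = v ∨ a = w → J i j m' → J i j (m'.writeNat a 0 0 x))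
    (h0 : J 0 0 m) (hrow : ∀ i m', i < n → J i n m' → J (i + 1) 0 m')
    (hstep : ∀ i j m', i < n → j < n → m'.nat v 0 0 = i → m'.nat w 0 0 = j →
      (for2 v w P).SameOff m m' → J i j m' → J i (j + 1) (P.exec m')) :
    J n 0 ((for2 v w P).exec m) := by
  subst hm
  refine for_inv (fun i m' => J i 0 m') (hc _ _ _ _ _ (Or.inl rfl) h0) ?_
  intro i m1 hi hv1 hs1 hJ1
  refine hc _ _ _ _ _ (Or.inl rfl) (hrow _ _ hi ?_)
  have hn1 : m1.nat 0 0 0 = m.nat 0 0 0 := by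
    rw [hs1.1 0 (by simp [WritesNat, hv0.symm, hw0.symm, hP0])]
  rw [← hn1]
  refine for_inv (fun j m' => J i j m') (hc _ _ _ _ _ (Or.inr rfl) hJ1) ?_
  intro j m2 hj hw2 hs2 hJ2
  rw [hn1] at hj
  refine hc _ _ _ _ _ (Or.inr rfl) (hstep i j m2 hi hj ?_ hw2 ?_ hJ2)
  · rw [hs2.1 v (by simp [WritesNat, hP, hvw]), hv1]
  · refine hs1.trans hs2 (fun a ha => Or.inr ha) (fun a ha => ha)

/-! ## Filling a matrix -/

/-- The row index in the loops over a matrix. -/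
abbrev rowIdx : NatExpr := .var 4
/-- The column index in the loops over a matrix. -/
abbrev colIdx : NatExpr := .var 6
/-- The middle index in the loops over a product of matrices. -/
abbrev midIdx : NatExpr := .var 8

/-- Set all entries of the matrix `dst`: the entry is `e` if `b` holds, and infinite otherwise. -/
def fill (dst : ℕ) (b : Test) (e : RealExpr) : Cmd :=
  for2 4 6 (ite b
    (seq (setReal dst rowIdx colIdx e) (setNat (2 * dst + 1) rowIdx colIdx (.const 1)))
    (setNat (2 * dst + 1) rowIdx colIdx (.const 0)))

open Classical in
theorem wt_fill {dst : ℕ} {b : Test} {e : RealExpr} {m : Memory} {n : ℕ} (hm : m.nat 0 0 0 = n)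
    {β : ℕ → ℕ → Prop} {ε : ℕ → ℕ → ℝ}
    (h : ∀ m' i j, (fill dst b e).SameOff m m' → i < n → j < n → m'.nat 4 0 0 = i →
      m'.nat 6 0 0 = j → (b.holds m' ↔ β i j) ∧ (β i j → e.val m' = ε i j)) {i j : ℕ}
    (hi : i < n) (hj : j < n) :
    ((fill dst b e).exec m).wt dst i j = if β i j then (ε i j : WithTop ℝ) else ⊤ := by
  have key := for2_inv (v := 4) (w := 6) (P := (ite b
    (seq (setReal dst rowIdx colIdx e) (setNat (2 * dst + 1) rowIdx colIdx (.const 1)))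
    (setNat (2 * dst + 1) rowIdx colIdx (.const 0)))) hm
    (by simp [WritesNat]; try omega) (by simp [WritesNat])
    (by decide) (by decide) (by decide)
    (fun i j m' => ∀ x y, x < n → y < n → x < i ∨ (x = i ∧ y < j) →
      m'.wt dst x y = if β x y then (ε x y : WithTop ℝ) else ⊤)
    (by
      intro i j m' a x ha hJ x' y'
      rw [Memory.wt_writeNat _ (by omega)]
      exact hJ x' y')
    (by intro x y _ _ h; omega)
    (by intro i m' hi hJ x y hx hy h; exact hJ x y hx hy (by omega))
    (by
      intro i j m' hi hj h4 h6 hs hJ x y hx hy hxy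
      obtain ⟨hb, he⟩ := h m' i j hs hi hj h4 h6
      by_cases hxy' : x = i ∧ y = j
      · obtain ⟨rfl, rfl⟩ := hxy'
        by_cases hβ : β x y
        · simp [exec, hb.2 hβ, hβ, Memory.wt, Memory.writeNat, Memory.writeReal, NatExpr.val, h4, h6,
            he hβ]
        · simp [exec, mt hb.1 hβ, hβ, Memory.wt, Memory.writeNat, NatExpr.val, h4, h6]
      · have hJ' := hJ x y hx hy (by omega)
        rw [← hJ']
        simp only [exec]
        split_ifs <;>
        simp [Memory.wt, Memory.writeNat, Memory.writeReal, NatExpr.val, h4, h6, hxy'])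
  exact key i j hi hj (Or.inl hi)

theorem fill_writesNat {dst : ℕ} {b : Test} {e : RealExpr} {a : ℕ} :
    (fill dst b e).WritesNat a ↔ a = 4 ∨ a = 6 ∨ a = 2 * dst + 1 := by
  simp [fill, WritesNat]

theorem fill_writesReal {dst : ℕ} {b : Test} {e : RealExpr} {a : ℕ} :
    (fill dst b e).WritesReal a ↔ a = dst := by
  simp [fill, WritesReal]

/-! ## Relaxation passes -/

/-- The test that the entry `(i, j)` of the matrix `a` is finite. -/
def finiteTest (a : ℕ) (i j : NatExpr) : Test := .not (.natEq (.read (2 * a + 1) i j) (.const 0))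

theorem finiteTest_holds {a : ℕ} {i j : NatExpr} {m : Memory} :
    (finiteTest a i j).holds m ↔ m.wt a (i.val m) (j.val m) ≠ ⊤ := by
  rw [Memory.wt_ne_top]
  simp [finiteTest, Test.holds, NatExpr.val]

/-- The body of a relaxation pass. -/
def relaxBody (b : Test) (dst A B : ℕ) : Cmd :=
  ite (.and b (.and (finiteTest A rowIdx midIdx) (.and (finiteTest B midIdx colIdx)
      (.not (.and (finiteTest dst rowIdx colIdx) (.not (.realLt
        (.add (.read A rowIdx midIdx) (.read B midIdx colIdx)) (.read dst rowIdx colIdx))))))))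
    (seq (setReal dst rowIdx colIdx (.add (.read A rowIdx midIdx) (.read B midIdx colIdx)))
      (setNat (2 * dst + 1) rowIdx colIdx (.const 1)))
    skip

-- The assignment is skipped exactly if `b` fails, a summand is infinite, or the old entry is finite
-- and not larger than the sum. So the effect is a minimum in `WithTop ℝ`, also when `dst` coincides
-- with `A` or `B`.
open Classical in
theorem wt_relaxBody (b : Test) (dst A B : ℕ) (m : Memory) (a x y : ℕ) :
    ((relaxBody b dst A B).exec m).wt a x y =
      if a = dst ∧ x = m.nat 4 0 0 ∧ y = m.nat 6 0 0 ∧ b.holds m then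
        min (m.wt dst (m.nat 4 0 0) (m.nat 6 0 0))
          (m.wt A (m.nat 4 0 0) (m.nat 8 0 0) + m.wt B (m.nat 8 0 0) (m.nat 6 0 0))
      else m.wt a x y := by
  set i := m.nat 4 0 0 with hi
  set k := m.nat 6 0 0 with hk
  set j := m.nat 8 0 0 with hj
  have hset : ∀ z : ℝ, ((m.writeReal dst i k z).writeNat (2 * dst + 1) i k 1).wt a x y =
      if a = dst ∧ x = i ∧ y = k then (z : WithTop ℝ) else m.wt a x y := by
    intro z
    by_cases h : a = dst ∧ x = i ∧ y = k
    · obtain ⟨rfl, rfl, rfl⟩ := h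
      simp [Memory.wt, Memory.writeNat, Memory.writeReal]
    · have h2 : ¬ (2 * a + 1 = 2 * dst + 1 ∧ x = i ∧ y = k) := fun h' => h ⟨by omega, h'.2⟩
      simp [Memory.wt, Memory.writeNat, Memory.writeReal, h]
  have hex : (relaxBody b dst A B).exec m = if b.holds m ∧ m.wt A i j ≠ ⊤ ∧ m.wt B j k ≠ ⊤ ∧
      ¬ (m.wt dst i k ≠ ⊤ ∧ ¬ m.real A i j + m.real B j k < m.real dst i k) then
        (m.writeReal dst i k (m.real A i j + m.real B j k)).writeNat (2 * dst + 1) i k 1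
      else m := by
    simp only [relaxBody, exec, Test.holds, finiteTest_holds]
    rfl
  rw [hex]
  by_cases hb : b.holds m; swap
  · simp [hb]
  by_cases hA : m.wt A i j = ⊤
  · rw [if_neg (fun h => h.2.1 hA), hA, WithTop.top_add, min_eq_left le_top]
    split_ifs with h
    · rw [h.1, h.2.1, h.2.2.1]
    · rfl
  by_cases hB : m.wt B j k = ⊤
  · rw [if_neg (fun h => h.2.2.1 hB), hB, WithTop.add_top, min_eq_left le_top]
    split_ifs with h
    · rw [h.1, h.2.1, h.2.2.1]
    · rfl
  have eA := Memory.wt_of_ne (Memory.wt_ne_top.1 hA)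
  have eB := Memory.wt_of_ne (Memory.wt_ne_top.1 hB)
  by_cases hD : m.wt dst i k = ⊤
  · rw [if_pos ⟨hb, hA, hB, fun h => h.1 hD⟩, hset, hD, min_eq_right le_top, eA, eB,
      ← WithTop.coe_add]
    simp only [hb, and_true]
  · have eD := Memory.wt_of_ne (Memory.wt_ne_top.1 hD)
    by_cases hlt : m.real A i j + m.real B j k < m.real dst i k
    · rw [if_pos ⟨hb, hA, hB, fun h => h.2 hlt⟩, hset, eA, eB, eD, ← WithTop.coe_add,
        ← WithTop.coe_min, min_eq_right hlt.le]
      simp only [hb, and_true]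
    · rw [if_neg (fun h => h.2.2.2 ⟨hD, hlt⟩), eA, eB, ← WithTop.coe_add]
      split_ifs with h
      · rw [eD, ← WithTop.coe_min, min_eq_left (not_lt.1 hlt), ← eD, h.1, h.2.1, h.2.2.1]
      · rfl

/-- `m` arises from `m₀` by relaxations of entries of `dst` by sums of entries of `A` and of `B`,
among them those for the triples in `Dn`. -/
structure Relaxed (n : ℕ) (β : ℕ → ℕ → ℕ → Prop) (dst A B : ℕ) (Dn : ℕ → ℕ → ℕ → Prop)
    (m₀ m : Memory) : Prop where
  le : ∀ a i k, m.wt a i k ≤ m₀.wt a i k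
  -- The bound refers to the initial values. Since entries only decrease, it survives any order of
  -- the relaxations and any coincidence of `dst`, `A` and `B`.
  done : ∀ i j k, Dn i j k → β i j k → m.wt dst i k ≤ m₀.wt A i j + m₀.wt B j k
  -- Any property of entries that is closed under the permitted sums is inherited. Lower bounds come
  -- from this: `S` says that the value belongs to a walk or a path.
  sound : ∀ S : ℕ → ℕ → ℕ → WithTop ℝ → Prop,
    (∀ i j k, i < n → j < n → k < n → β i j k → ∀ x y, S A i j x → S B j k y →
      S dst i k (x + y)) →
    (∀ a i k, i < n → k < n → S a i k (m₀.wt a i k)) →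
    ∀ a i k, i < n → k < n → S a i k (m.wt a i k)

theorem Relaxed.trans {n : ℕ} {β : ℕ → ℕ → ℕ → Prop} {dst A B : ℕ} {D D' D'' : ℕ → ℕ → ℕ → Prop}
    {m₀ m₁ m₂ : Memory} (h : Relaxed n β dst A B D m₀ m₁) (h' : Relaxed n β dst A B D' m₁ m₂)
    (hD : ∀ i j k, D'' i j k → D i j k ∨ D' i j k) : Relaxed n β dst A B D'' m₀ m₂ where
  le a i k := (h'.le a i k).trans (h.le a i k)
  done i j k hd hβ := by
    rcases hD i j k hd with hd | hd
    · exact (h'.le _ _ _).trans (h.done i j k hd hβ)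
    · exact (h'.done i j k hd hβ).trans (add_le_add (h.le _ _ _) (h.le _ _ _))
  sound S hS h0 := h'.sound S hS (h.sound S hS h0)

theorem Relaxed.of_wt_eq {n : ℕ} {β : ℕ → ℕ → ℕ → Prop} {dst A B : ℕ} {D : ℕ → ℕ → ℕ → Prop}
    {m₀ m m' : Memory} (h : Relaxed n β dst A B D m₀ m) (e : m'.wt = m.wt) :
    Relaxed n β dst A B D m₀ m' where
  le := by rw [e]; exact h.le
  done := by rw [e]; exact h.done
  sound := by rw [e]; exact h.sound

theorem Relaxed.refl {n : ℕ} {β : ℕ → ℕ → ℕ → Prop} {dst A B : ℕ} {m₀ : Memory} :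
    Relaxed n β dst A B (fun _ _ _ => False) m₀ m₀ where
  le _ _ _ := le_rfl
  done _ _ _ h := h.elim
  sound _ _ h := h

theorem relaxed_relaxBody {n : ℕ} {β : ℕ → ℕ → ℕ → Prop} {dst A B : ℕ} {b : Test} {m : Memory}
    {i j k : ℕ} (hi : i < n) (hj : j < n) (hk : k < n) (h4 : m.nat 4 0 0 = i)
    (h8 : m.nat 8 0 0 = j) (h6 : m.nat 6 0 0 = k) (hb : b.holds m ↔ β i j k) :
    Relaxed n β dst A B (fun i' j' k' => i' = i ∧ j' = j ∧ k' = k) m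
      ((relaxBody b dst A B).exec m) where
  le a x y := by
    rw [wt_relaxBody]
    split_ifs with h
    · obtain ⟨rfl, rfl, rfl, -⟩ := h
      exact min_le_left _ _
    · exact le_rfl
  done := by
    rintro i' j' k' ⟨rfl, rfl, rfl⟩ hβ
    rw [wt_relaxBody, if_pos ⟨rfl, h4.symm, h6.symm, hb.2 hβ⟩, h4, h6, h8]
    exact min_le_right _ _
  sound S hS h0 a x y hx hy := by
    rw [wt_relaxBody]
    split_ifs with h
    · obtain ⟨rfl, rfl, rfl, hb'⟩ := h
      rw [h4, h6, h8]
      rcases min_choice (m.wt a i k) (m.wt A i j + m.wt B j k) with e | e <;> rw [e]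
      · exact h0 _ _ _ hi hk
      · exact hS _ _ _ hi hj hk (hb.1 hb') _ _ (h0 _ _ _ hi hj) (h0 _ _ _ hj hk)
    · exact h0 _ _ _ hx hy

/-- Relax all entries of `dst` by the sums for one middle index. -/
def relaxRow (b : Test) (dst A B : ℕ) : Cmd := for2 4 6 (relaxBody b dst A B)

/-- Relax all entries of `dst` by the min-plus product of `A` and `B`, as far as `b` permits. -/
def relax (b : Test) (dst A B : ℕ) : Cmd := for_ 8 (relaxRow b dst A B)

theorem relaxRow_writesNat {dst A B : ℕ} {b : Test} {a : ℕ} :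
    (relaxRow b dst A B).WritesNat a ↔ a = 4 ∨ a = 6 ∨ a = 2 * dst + 1 := by
  simp [relaxRow, relaxBody, WritesNat]

theorem relaxRow_writesReal {dst A B : ℕ} {b : Test} {a : ℕ} :
    (relaxRow b dst A B).WritesReal a ↔ a = dst := by
  simp [relaxRow, relaxBody, WritesReal]

theorem relax_writesNat {dst A B : ℕ} {b : Test} {a : ℕ} :
    (relax b dst A B).WritesNat a ↔ a = 8 ∨ a = 4 ∨ a = 6 ∨ a = 2 * dst + 1 := by
  simp [relax, WritesNat, relaxRow_writesNat]

theorem relax_writesReal {dst A B : ℕ} {b : Test} {a : ℕ} :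
    (relax b dst A B).WritesReal a ↔ a = dst := by
  simp [relax, WritesReal, relaxRow_writesReal]

theorem relaxed_relaxRow {n : ℕ} {β : ℕ → ℕ → ℕ → Prop} {dst A B : ℕ} {b : Test} {m : Memory}
    (hm : m.nat 0 0 0 = n) {j : ℕ} (hj : j < n) (h8 : m.nat 8 0 0 = j)
    (hb : ∀ m' i k, (relaxRow b dst A B).SameOff m m' → i < n → k < n → m'.nat 4 0 0 = i →
      m'.nat 6 0 0 = k → (b.holds m' ↔ β i j k)) :
    Relaxed n β dst A B (fun i' j' k' => i' < n ∧ j' = j ∧ k' < n) m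
      ((relaxRow b dst A B).exec m) := by
  have key := for2_inv (v := 4) (w := 6) (P := relaxBody b dst A B) hm
    (by simp [WritesNat, relaxBody]; try omega) (by simp [WritesNat, relaxBody])
    (by decide) (by decide) (by decide)
    (fun x y m' => Relaxed n β dst A B
      (fun i' j' k' => k' < n ∧ j' = j ∧ (i' < x ∨ (i' = x ∧ k' < y))) m m')
    (by
      intro i j m' a x ha hJ
      refine hJ.of_wt_eq ?_
      funext a'
      rw [Memory.wt_writeNat _ (by omega)])
    (Relaxed.refl.trans Relaxed.refl (by intro i j k h; omega))
    (by intro i m' hi hJ; exact hJ.trans Relaxed.refl (by intro i j k h; left; omega))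
    (by
      intro i k m' hi hk h4 h6 hs hJ
      have h8' : m'.nat 8 0 0 = j := by
        rw [hs.1 8 (by simp [WritesNat, relaxBody]; try omega), h8]
      refine hJ.trans (relaxed_relaxBody hi hj hk h4 h8' h6 (hb m' i k hs hi hk h4 h6)) ?_
      intro i' j' k' h
      omega)
  exact key.trans Relaxed.refl (by intro i j k h; left; omega)

theorem relaxed_relax {n : ℕ} {β : ℕ → ℕ → ℕ → Prop} {dst A B : ℕ} {b : Test} {m : Memory}
    (hm : m.nat 0 0 0 = n)
    (hb : ∀ m' i j k, (relax b dst A B).SameOff m m' → i < n → j < n → k < n → m'.nat 4 0 0 = i →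
      m'.nat 8 0 0 = j → m'.nat 6 0 0 = k → (b.holds m' ↔ β i j k)) :
    Relaxed n β dst A B (fun i' j' k' => i' < n ∧ j' < n ∧ k' < n) m
      ((relax b dst A B).exec m) := by
  subst hm
  have key := for_inv (v := 8) (P := relaxRow b dst A B) (m := m)
    (fun j m' => Relaxed (m.nat 0 0 0) β dst A B
      (fun i' j' k' => i' < m.nat 0 0 0 ∧ j' < j ∧ k' < m.nat 0 0 0) m m')
    ((Relaxed.refl.trans Relaxed.refl (by intro i j k h; omega)).of_wt_eq (by
      funext a; rw [Memory.wt_writeNat _ (by omega)]))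
    (by
      intro j m' hj h8 hs hJ
      have hm' : m'.nat 0 0 0 = m.nat 0 0 0 := by
        rw [hs.1 0 (by simp only [WritesNat, relaxRow_writesNat]; omega)]
      refine (hJ.trans (relaxed_relaxRow hm' hj h8 ?_) ?_).of_wt_eq (by
        funext a; rw [Memory.wt_writeNat _ (by omega)])
      · intro m'' i k hs' hi hk h4 h6
        refine hb m'' i j k (hs.trans hs' (fun a ha => Or.inr ha) (fun a ha => ha)) hi hj hk h4 ?_ h6
        rw [hs'.1 8 (by simp only [relaxRow_writesNat]; omega), h8]
      · intro i j k h
        omega)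
  exact key

end Cmd

/-! ## Min-plus products and the algorithm of Floyd and Warshall -/

/-- The min-plus product of two matrices. -/
def minPlus {n : ℕ} (M N : Fin n → Fin n → WithTop ℝ) (i k : Fin n) : WithTop ℝ :=
  Finset.univ.inf fun j => M i j + N j k

theorem minPlus_le {n : ℕ} (M N : Fin n → Fin n → WithTop ℝ) (i j k : Fin n) :
    minPlus M N i k ≤ M i j + N j k :=
  Finset.inf_le (Finset.mem_univ j)

theorem exists_minPlus_eq {n : ℕ} (M N : Fin n → Fin n → WithTop ℝ) (i k : Fin n) :
    ∃ j, minPlus M N i k = M i j + N j k := by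
  obtain ⟨j, -, hj⟩ := Finset.exists_mem_eq_inf (Finset.univ : Finset (Fin n)) ⟨i, Finset.mem_univ i⟩
    (fun j => M i j + N j k)
  exact ⟨j, hj⟩

/-- The sum of the entries of a matrix along a sequence. -/
def pathSum {V : Type*} (M : V → V → WithTop ℝ) : List V → WithTop ℝ
  | u :: v :: l => M u v + pathSum M (v :: l)
  | _ => 0

theorem pathSum_split {V : Type*} (M : V → V → WithTop ℝ) (l₁ : List V) (z : V) (l₂ : List V) :
    pathSum M (l₁ ++ z :: l₂) = pathSum M (l₁ ++ [z]) + pathSum M (z :: l₂) := by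
  induction l₁ with
  | nil => simp [pathSum]
  | cons a l₁ ih =>
    cases l₁ with
    | nil => simp [pathSum]
    | cons b l₁ => simp only [List.cons_append, pathSum] at ih ⊢; rw [ih, add_assoc]

namespace Cmd

/-- The test that always succeeds. -/
def trueTest : Test := .natEq (.const 0) (.const 0)

theorem trueTest_holds (m : Memory) : trueTest.holds m := rfl

theorem relaxed_true {n : ℕ} {dst A B : ℕ} {m : Memory} (hm : m.nat 0 0 0 = n) :
    Relaxed n (fun _ _ _ => True) dst A B (fun i' j' k' => i' < n ∧ j' < n ∧ k' < n) m
      ((relax trueTest dst A B).exec m) :=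
  relaxed_relax hm fun m' _ _ _ _ _ _ _ _ _ _ => iff_true_intro (trueTest_holds m')

theorem mat_relax {n : ℕ} {dst A B : ℕ} {m : Memory} (hm : m.nat 0 0 0 = n) (hA : dst ≠ A)
    (hB : dst ≠ B) (i k : Fin n) :
    ((relax trueTest dst A B).exec m).mat n dst i k =
      min (m.mat n dst i k) (minPlus (m.mat n A) (m.mat n B) i k) := by
  have h := relaxed_true (dst := dst) (A := A) (B := B) hm
  apply le_antisymm
  · refine le_min (h.le _ _ _) ?_
    obtain ⟨j, hj⟩ := exists_minPlus_eq (m.mat n A) (m.mat n B) i k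
    rw [hj]
    exact h.done i j k ⟨i.2, j.2, k.2⟩ trivial
  -- The chosen property states the lower bound for `dst` and that every other matrix is unchanged.
  · refine (h.sound (fun a x y w => (a = dst → ∀ (hx : x < n) (hy : y < n),
      min (m.mat n dst ⟨x, hx⟩ ⟨y, hy⟩) (minPlus (m.mat n A) (m.mat n B) ⟨x, hx⟩ ⟨y, hy⟩) ≤ w) ∧
      (a ≠ dst → w = m.wt a x y)) ?_ ?_ dst i k i.2 k.2).1 rfl i.2 k.2
    · intro i j k hi hj hk _ x y hx hy
      refine ⟨fun _ hi hk => ?_, fun h => absurd rfl h⟩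
      rw [hx.2 hA.symm, hy.2 hB.symm]
      exact (min_le_right _ _).trans (minPlus_le _ _ _ ⟨j, hj⟩ _)
    · intro a i k hi hk
      refine ⟨?_, fun _ => rfl⟩
      rintro rfl _ _
      exact min_le_left _ _

/-- The algorithm of Floyd and Warshall on the matrix `a`. -/
def floydWarshall (a : ℕ) : Cmd := relax trueTest a a a

theorem floydWarshall_sound {n : ℕ} {a : ℕ} {m : Memory} (hm : m.nat 0 0 0 = n)
    (S : Fin n → Fin n → WithTop ℝ → Prop)
    (hS : ∀ i j k x y, S i j x → S j k y → S i k (x + y)) (h0 : ∀ i k, S i k (m.mat n a i k))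
    (i k : Fin n) : S i k (((floydWarshall a).exec m).mat n a i k) := by
  have h := relaxed_true (dst := a) (A := a) (B := a) hm
  refine h.sound (fun b x y w => b = a → ∀ (hx : x < n) (hy : y < n), S ⟨x, hx⟩ ⟨y, hy⟩ w) ?_ ?_ a
    i k i.2 k.2 rfl i.2 k.2
  · intro i j k hi hj hk _ x y hx hy _ _ _
    exact hS _ ⟨j, hj⟩ _ _ _ (hx rfl _ _) (hy rfl _ _)
  · rintro b x y hx hy rfl _ _
    exact h0 ⟨x, hx⟩ ⟨y, hy⟩

/-- After the rounds for the middle indices below `j`, an entry is at most the sum along every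
duplicate-free sequence whose interior lies below `j`: such a sequence meets the next index at most
once and splits there. As only upper bounds for duplicate-free sequences are claimed, negative
cycles do no harm. -/
theorem floydWarshall_le {n : ℕ} {a : ℕ} {m : Memory} (hm : m.nat 0 0 0 = n)
    (hdiag : ∀ i : Fin n, m.mat n a i i ≤ 0) {s t : Fin n} {l : List (Fin n)}
    (hs : l.head? = some s) (ht : l.getLast? = some t) (hl : l.Nodup) :
    ((floydWarshall a).exec m).mat n a s t ≤ pathSum (m.mat n a) l := by
  have key := for_inv (v := 8) (P := relaxRow trueTest a a a) (m := m)
    (fun j m' => (∀ x y, m'.wt a x y ≤ m.wt a x y) ∧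
      ∀ (s t : Fin n) (q : List (Fin n)), (s :: (q ++ [t])).Nodup → (∀ z ∈ q, (z : ℕ) < j) →
        m'.mat n a s t ≤ pathSum (m.mat n a) (s :: (q ++ [t])))
    (by
      refine ⟨fun x y => by rw [Memory.wt_writeNat _ (by decide)], ?_⟩
      intro s t q _ hq
      cases q with
      | nil => simp [pathSum, Memory.mat, Memory.wt_writeNat]
      | cons z q => exact absurd (hq z (by simp)) (by omega))
    (by
      rintro j m' hj h8 hs ⟨hle, hI⟩
      rw [hm] at hj
      have hm' : m'.nat 0 0 0 = n := by
        rw [hs.1 0 (by simp [WritesNat, relaxRow_writesNat]), hm]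
      have hr := relaxed_relaxRow (dst := a) (A := a) (B := a) (b := trueTest)
        (β := fun _ _ _ => True) hm' hj h8
        fun m' _ _ _ _ _ _ _ => iff_true_intro (trueTest_holds m')
      have hw : ∀ m'' : Memory, ∀ x y, (m''.writeNat 8 0 0 (j + 1)).wt a x y = m''.wt a x y := by
        intro m'' x y
        rw [Memory.wt_writeNat _ (by decide)]
      refine ⟨fun x y => ?_, ?_⟩
      · rw [hw]
        exact (hr.le _ _ _).trans (hle _ _)
      · intro s t q hnd hq
        unfold Memory.mat
        rw [hw]
        by_cases hjq : (⟨j, hj⟩ : Fin n) ∈ q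
        · obtain ⟨q₁, q₂, rfl⟩ := List.append_of_mem hjq
          set z : Fin n := ⟨j, hj⟩ with hz
          have e : s :: (q₁ ++ z :: q₂ ++ [t]) = (s :: q₁) ++ z :: (q₂ ++ [t]) := by simp
          rw [e] at hnd ⊢
          rw [pathSum_split]
          have hlt : ∀ y ∈ q₁ ++ q₂, (y : ℕ) < j := by
            intro y hy
            have h1 : y ≠ z := by
              rintro rfl
              simp only [List.mem_append] at hy
              simp [List.nodup_append] at hnd
              grind
            have h2 := hq y (by simp only [List.mem_append, List.mem_cons] at hy ⊢; tauto)
            have h3 : (y : ℕ) ≠ j := fun h => h1 (Fin.ext h)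
            omega
          refine (hr.done s z t ⟨s.2, rfl, t.2⟩ trivial).trans (add_le_add ?_ ?_)
          · refine hI s z q₁ ?_ (fun y hy => hlt y (by simp [hy]))
            refine hnd.sublist ?_
            simp
          · refine hI z t q₂ ?_ (fun y hy => hlt y (by simp [hy]))
            exact hnd.sublist (List.sublist_append_right _ _)
        · refine (hr.le _ _ _).trans (hI s t q hnd ?_)
          intro z hz
          have h2 := hq z hz
          have h3 : (z : ℕ) ≠ j := fun h => hjq ((Fin.ext h : z = ⟨j, hj⟩) ▸ hz)
          omega)
  rw [hm] at key
  obtain ⟨hle, hI⟩ := key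
  cases l with
  | nil => simp at hs
  | cons x l =>
    obtain rfl : x = s := by simpa using hs
    rcases List.eq_nil_or_concat l with rfl | ⟨q, y, rfl⟩
    · obtain rfl : x = t := by simpa using ht
      exact (hle _ _).trans (hdiag x)
    · rw [List.concat_eq_append] at ht hl ⊢
      obtain rfl : y = t := by
        rw [← List.cons_append, List.getLast?_append] at ht
        simpa using ht
      exact hI x y q hl (fun z _ => z.2)

open Classical in
theorem mat_fill {dst : ℕ} {b : Test} {e : RealExpr} {m : Memory} {n : ℕ} (hm : m.nat 0 0 0 = n)
    {β : Fin n → Fin n → Prop} {ε : Fin n → Fin n → ℝ}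
    (h : ∀ m' (i j : Fin n), (fill dst b e).SameOff m m' → m'.nat 4 0 0 = i →
      m'.nat 6 0 0 = j → (b.holds m' ↔ β i j) ∧ (β i j → e.val m' = ε i j)) (i j : Fin n) :
    ((fill dst b e).exec m).mat n dst i j = if β i j then (ε i j : WithTop ℝ) else ⊤ := by
  have := wt_fill (dst := dst) (b := b) (e := e) hm
    (β := fun x y => ∃ (hx : x < n) (hy : y < n), β ⟨x, hx⟩ ⟨y, hy⟩)
    (ε := fun x y => if h : x < n ∧ y < n then ε ⟨x, h.1⟩ ⟨y, h.2⟩ else 0) (by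
      intro m' x y hs hx hy h4 h6
      obtain ⟨h1, h2⟩ := h m' ⟨x, hx⟩ ⟨y, hy⟩ hs h4 h6
      refine ⟨by simp [h1, hx, hy], ?_⟩
      rintro ⟨_, _, hβ⟩
      simp [h2 hβ, hx, hy]) i.2 j.2
  rw [Memory.mat, this]
  simp

end Cmd

section

/-! ## Walks in relations -/

section Walks

variable {V : Type*} {E E' : V → V → Prop} {c : V → V → ℝ}

/-- `l` is the vertex sequence of a walk from `s` to `t` with arcs in `E`. -/
def Wk (E : V → V → Prop) (s t : V) (l : List V) : Prop :=
  l.head? = some s ∧ l.getLast? = some t ∧ l.IsChain E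

theorem Wk.ne_nil {s t : V} {l : List V} (h : Wk E s t l) : l ≠ [] := by
  rintro rfl
  simp [Wk] at h

theorem Wk.single (s : V) : Wk E s s [s] := by simp [Wk]

theorem Wk.head_mem {s t : V} {l : List V} (h : Wk E s t l) : s ∈ l :=
  List.mem_of_head? h.1

theorem Wk.last_mem {s t : V} {l : List V} (h : Wk E s t l) : t ∈ l :=
  List.mem_of_getLast? h.2.1

theorem Wk.exists_cons {s t : V} {l : List V} (h : Wk E s t l) : ∃ l', l = s :: l' := by
  cases l with
  | nil => exact absurd rfl h.ne_nil
  | cons a l => exact ⟨l, by rw [show a = s by simpa using h.1]⟩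

theorem Wk.mono {s t : V} {l : List V} (h : Wk E s t l) (hE : ∀ u v, E u v → E' u v) :
    Wk E' s t l :=
  ⟨h.1, h.2.1, h.2.2.imp hE⟩

theorem wk_cons_cons {s t a b : V} {l : List V} :
    Wk E s t (a :: b :: l) ↔ a = s ∧ E a b ∧ Wk E b t (b :: l) := by
  simp [Wk]
  tauto

theorem wk_singleton {s t a : V} : Wk E s t [a] ↔ a = s ∧ a = t := by
  simp [Wk]

theorem wk_split {s t z : V} {l₁ l₂ : List V} :
    Wk E s t (l₁ ++ z :: l₂) ↔ Wk E s z (l₁ ++ [z]) ∧ Wk E z t (z :: l₂) := by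
  have e1 : (l₁ ++ z :: l₂).head? = (l₁ ++ [z]).head? := by cases l₁ <;> simp
  have e2 : (l₁ ++ z :: l₂).getLast? = (z :: l₂).getLast? := by
    rw [List.getLast?_append]
    cases h : (z :: l₂).getLast? with
    | none => simp at h
    | some x => simp
  simp only [Wk, e1, e2, List.isChain_split (l₁ := l₁) (c := z) (l₂ := l₂)]
  simp
  tauto

theorem walkWeight_split (c : V → V → ℝ) (l₁ : List V) (z : V) (l₂ : List V) :
    walkWeight c (l₁ ++ z :: l₂) = walkWeight c (l₁ ++ [z]) + walkWeight c (z :: l₂) := by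
  induction l₁ with
  | nil => simp [walkWeight]
  | cons a l₁ ih =>
    cases l₁ with
    | nil => simp [walkWeight]
    | cons b l₁ => simp only [List.cons_append, walkWeight] at ih ⊢; rw [ih, add_assoc]

/-- Concatenation of walks. -/
theorem Wk.append {s t u : V} {l l' : List V} (h : Wk E s u l) (h' : Wk E u t l') :
    Wk E s t (l ++ l'.tail) ∧ walkWeight c (l ++ l'.tail) = walkWeight c l + walkWeight c l' := by
  obtain ⟨l'', rfl⟩ := h'.exists_cons
  obtain ⟨l₀, x, rfl⟩ := List.eq_nil_or_concat'  l |>.resolve_left h.ne_nil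
  obtain rfl : x = u := by simpa using h.2.1
  have e : l₀ ++ [x] ++ (x :: l'').tail = l₀ ++ x :: l'' := by simp
  rw [e]
  exact ⟨wk_split.2 ⟨h, h'⟩, walkWeight_split _ _ _ _⟩

theorem Wk.snoc {s t u : V} {l : List V} (h : Wk E s u l) (hut : E u t) :
    Wk E s t (l ++ [t]) ∧ walkWeight c (l ++ [t]) = walkWeight c l + c u t := by
  have := h.append (c := c) (l' := [u, t]) (t := t) (by simp [Wk, hut])
  simpa [walkWeight] using this

theorem Wk.cons {s t u : V} {l : List V} (hsu : E s u) (h : Wk E u t l) :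
    Wk E s t (s :: l) ∧ walkWeight c (s :: l) = c s u + walkWeight c l := by
  obtain ⟨l', rfl⟩ := h.exists_cons
  exact ⟨wk_cons_cons.2 ⟨rfl, hsu, h⟩, rfl⟩

theorem isChain_reverse (hE : ∀ u v, E u v → E' v u) {l : List V} (h : l.IsChain E) :
    l.reverse.IsChain E' := by
  rw [List.isChain_reverse]
  exact h.imp hE

theorem Wk.reverse (hE : ∀ u v, E u v → E' v u) {s t : V} {l : List V} (h : Wk E s t l) :
    Wk E' t s l.reverse :=
  ⟨by simpa using h.2.1, by simpa using h.1, isChain_reverse hE h.2.2⟩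

theorem walkWeight_append_pair (c : V → V → ℝ) (l : List V) (a b : V) :
    walkWeight c (l ++ [a, b]) = walkWeight c (l ++ [a]) + c a b := by
  rw [walkWeight_split]
  simp [walkWeight]

theorem walkWeight_reverse (c : V → V → ℝ) (l : List V) :
    walkWeight c l.reverse = walkWeight (fun u v => c v u) l := by
  induction l with
  | nil => rfl
  | cons a l ih =>
    cases l with
    | nil => rfl
    | cons b l =>
      simp only [List.reverse_cons, List.append_assoc, List.cons_append, List.nil_append] at ih ⊢
      rw [walkWeight_append_pair, ih]
      simp only [walkWeight]
      ring

theorem walkWeight_neg (c : V → V → ℝ) (l : List V) :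
    walkWeight (fun u v => - c u v) l = - walkWeight c l := by
  induction l with
  | nil => simp [walkWeight]
  | cons a l ih =>
    cases l with
    | nil => simp [walkWeight]
    | cons b l => simp only [walkWeight] at ih ⊢; rw [ih]; ring

theorem walkWeight_add_reverse_nonpos (h2 : ∀ u v, E u v → c u v + c v u ≤ 0) {l : List V}
    (h : l.IsChain E) : walkWeight c l + walkWeight c l.reverse ≤ 0 := by
  rw [walkWeight_reverse]
  induction l with
  | nil => simp [walkWeight]
  | cons a l ih =>
    cases l with
    | nil => simp [walkWeight]
    | cons b l =>
      rw [List.isChain_cons_cons] at h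
      have := ih h.2
      have := h2 _ _ h.1
      simp only [walkWeight] at *
      linarith

theorem walkWeight_add_reverse_neg (h2 : ∀ u v, E u v → c u v + c v u < 0) {l : List V}
    (h : l.IsChain E) (hl : 2 ≤ l.length) : walkWeight c l + walkWeight c l.reverse < 0 := by
  match l, hl with
  | a :: b :: l, _ =>
    rw [List.isChain_cons_cons] at h
    have h3 := walkWeight_add_reverse_nonpos (c := c) (fun u v huv => (h2 u v huv).le) h.2
    have := h2 _ _ h.1
    rw [walkWeight_reverse] at *
    simp only [walkWeight] at *
    linarith

/-- Split a list at the first element with the property `p`. -/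
theorem exists_split_first (p : V → Prop) {l : List V} (h : ∃ z ∈ l, p z) :
    ∃ l₁ z l₂, l = l₁ ++ z :: l₂ ∧ p z ∧ ∀ x ∈ l₁, ¬ p x := by
  induction l with
  | nil => simp at h
  | cons a l ih =>
    by_cases ha : p a
    · exact ⟨[], a, l, rfl, ha, by simp⟩
    · obtain ⟨z, hz, hpz⟩ := h
      obtain ⟨l₁, z, l₂, rfl, h1, h2⟩ := ih ⟨z, by
        rcases List.mem_cons.1 hz with rfl | h
        · exact absurd hpz ha
        · exact h, hpz⟩
      refine ⟨a :: l₁, z, l₂, rfl, h1, ?_⟩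
      intro x hx
      rcases List.mem_cons.1 hx with rfl | h
      · exact ha
      · exact h2 x h

/-- Split a list at the last element with the property `p`. -/
theorem exists_split_last (p : V → Prop) {l : List V} (h : ∃ z ∈ l, p z) :
    ∃ l₁ z l₂, l = l₁ ++ z :: l₂ ∧ p z ∧ ∀ x ∈ l₂, ¬ p x := by
  obtain ⟨l₁, z, l₂, e, h1, h2⟩ := exists_split_first p (l := l.reverse) (by simpa using h)
  refine ⟨l₂.reverse, z, l₁.reverse, ?_, h1, by simpa using h2⟩
  rw [← List.reverse_reverse l, e]
  simp

/-! ### Loop erasure, and shortest paths inside the negative graph -/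

/-- Every cycle with arcs in `E` has nonnegative weight. -/
def NonnegCycles (E : V → V → Prop) (c : V → V → ℝ) : Prop :=
  ∀ v l, (v :: l).Nodup → (v :: (l ++ [v])).IsChain E → 0 ≤ walkWeight c (v :: (l ++ [v]))

/-- Every cycle of `E` with at least three arcs has nonnegative weight. -/
def NonnegLongCycles (E : V → V → Prop) (c : V → V → ℝ) : Prop :=
  ∀ v l, (v :: l).Nodup → (v :: (l ++ [v])).IsChain E → 2 ≤ l.length →
    0 ≤ walkWeight c (v :: (l ++ [v]))

theorem NonnegLongCycles.mono (h : NonnegLongCycles E c) (hE : ∀ u v, E' u v → E u v) :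
    NonnegLongCycles E' c :=
  fun v l hv hc hl => h v l hv (hc.imp hE) hl

/-- Loop erasure: if all cycles are nonnegative, then every walk contains a path with the same
ends that is not longer. -/
theorem exists_path_of_walk (h : NonnegCycles E c) {s t : V} {l : List V} (hl : Wk E s t l) :
    ∃ p, Wk E s t p ∧ p.Nodup ∧ walkWeight c p ≤ walkWeight c l := by
  induction l generalizing s with
  | nil => exact absurd rfl hl.ne_nil
  | cons a l ih =>
    cases l with
    | nil => exact ⟨[a], hl, by simp, le_rfl⟩
    | cons b l =>
      obtain ⟨rfl, hab, hl⟩ := wk_cons_cons.1 hl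
      obtain ⟨p, hp, hnd, hle⟩ := ih hl
      obtain ⟨h1, h2⟩ := hp.cons (c := c) hab
      -- If `a` occurs on the path `p`, then `a` followed by `p` up to `a` is a cycle, and dropping
      -- it does not increase the weight.
      by_cases hap : a ∈ p
      · obtain ⟨p₁, p₂, rfl⟩ := List.append_of_mem hap
        obtain ⟨h3, h4⟩ := wk_split.1 hp
        refine ⟨a :: p₂, h4, hnd.sublist (List.sublist_append_right _ _), ?_⟩
        have h5 := h a p₁ (by
          rw [List.nodup_append] at hnd
          refine List.nodup_cons.2 ⟨fun h => hnd.2.2 a h a (by simp) rfl, hnd.1⟩) (h3.cons hab (c := c)).1.2.2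
        rw [(h3.cons hab (c := c)).2] at h5
        rw [walkWeight_split] at hle
        simp only [walkWeight] at hle ⊢
        linarith
      · refine ⟨a :: p, h1, List.nodup_cons.2 ⟨hap, hnd⟩, ?_⟩
        rw [h2]
        simp only [walkWeight] at hle ⊢
        linarith

/-- With zero weights, loop erasure applies whenever only the existence of a path matters. -/
theorem nonnegCycles_zero : NonnegCycles E (fun _ _ => (0 : ℝ)) := by
  intro v l _ _
  have : ∀ l : List V, walkWeight (fun _ _ => (0 : ℝ)) l = 0 := by
    intro l
    induction l with
    | nil => rfl
    | cons a l ih => cases l with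
      | nil => rfl
      | cons b l => simp only [walkWeight] at ih ⊢; simp [ih]
  rw [this]

/-- Every walk contains a path with the same ends. -/
theorem exists_path {s t : V} {l : List V} (hl : Wk E s t l) : ∃ p, Wk E s t p ∧ p.Nodup := by
  obtain ⟨p, h1, h2, -⟩ := exists_path_of_walk nonnegCycles_zero hl
  exact ⟨p, h1, h2⟩

theorem reflTransGen_of_wk {s t : V} {l : List V} (h : Wk E s t l) :
    Relation.ReflTransGen E s t := by
  induction l generalizing s with
  | nil => exact absurd rfl h.ne_nil
  | cons a l ih =>
    cases l with
    | nil => obtain ⟨rfl, rfl⟩ := wk_singleton.1 h; exact .refl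
    | cons b l =>
      obtain ⟨rfl, h1, h2⟩ := wk_cons_cons.1 h
      exact .head h1 (ih h2)

theorem exists_wk_of_reflTransGen {s t : V} (h : Relation.ReflTransGen E s t) :
    ∃ l, Wk E s t l := by
  induction h with
  | refl => exact ⟨[s], .single s⟩
  | tail _ h ih =>
    obtain ⟨l, hl⟩ := ih
    exact ⟨_, (hl.snoc h (c := fun _ _ => 0)).1⟩

theorem exists_path_of_reflTransGen {s t : V} (h : Relation.ReflTransGen E s t) :
    ∃ p, Wk E s t p ∧ p.Nodup := by
  obtain ⟨l, hl⟩ := exists_wk_of_reflTransGen h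
  exact exists_path hl

/-- A path inside the negative graph is a shortest path. -/
theorem walkWeight_le_of_negative_path {F : V → V → Prop} (hE : NonnegLongCycles E c)
    (hF : ∀ u v, F u v → E u v ∧ E v u ∧ c u v + c v u ≤ 0) {x y : V} {R P : List V}
    (hR : Wk F x y R) (hRn : R.Nodup) (hP : Wk E x y P) (hPn : P.Nodup) :
    walkWeight c R ≤ walkWeight c P := by
  obtain ⟨k, hk⟩ : ∃ k, P.length = k := ⟨_, rfl⟩
  induction k using Nat.strong_induction_on generalizing x R P with
  | _ k ih =>
  obtain ⟨P', rfl⟩ := hP.exists_cons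
  obtain ⟨R', rfl⟩ := hR.exists_cons
  by_cases hP' : P' = []
  · subst hP'
    obtain ⟨-, rfl⟩ := wk_singleton.1 hP
    rcases List.eq_nil_or_concat' R' with rfl | ⟨R'', z, rfl⟩
    · exact le_rfl
    · have : z = x := by
        have := hR.2.1
        rw [← List.cons_append, List.getLast?_append] at this
        simpa using this
      subst this
      simp at hRn
  · have hyP' : y ∈ P' := by
      have := hP.2.1
      rw [List.getLast?_cons_of_ne_nil hP'] at this
      exact List.mem_of_getLast? this
    -- `z` is the first vertex after `x` at which `P` meets `R` again. It suffices to compare the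
    -- parts from `x` to `z`; the rest is the induction hypothesis.
    obtain ⟨a, z, b, rfl, hzR, ha⟩ := exists_split_first (fun z => z ∈ x :: R') ⟨y, hyP', hR.last_mem⟩
    have hzx : z ≠ x := by
      rintro rfl
      simp at hPn
    have hzR' : z ∈ R' := by simpa [hzx] using hzR
    obtain ⟨R₁, R₂, rfl⟩ := List.append_of_mem hzR'
    rw [← List.cons_append] at hP hR hPn hRn
    obtain ⟨hP1, hP2⟩ := wk_split.1 hP
    change walkWeight c (x :: R₁ ++ z :: R₂) ≤ walkWeight c (x :: a ++ z :: b)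
    obtain ⟨hR1, hR2⟩ := wk_split.1 hR
    have hrest := ih (z :: b).length (by rw [← hk]; simp) hR2
      (hRn.sublist (List.sublist_append_right _ _)) hP2
      (hPn.sublist (List.sublist_append_right _ _)) rfl
    rw [walkWeight_split, walkWeight_split c (x :: a)]
    suffices walkWeight c (x :: R₁ ++ [z]) ≤ walkWeight c (x :: a ++ [z]) by linarith
    -- If both parts are the single arc `xz`, they are equal. Otherwise the part of `P` and the
    -- reversed part of `R` form a cycle with at least three arcs, of nonnegative weight, while the
    -- part of `R` and its reversal have sum at most zero.
    by_cases hshort : a = [] ∧ R₁ = []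
    · rw [hshort.1, hshort.2]
    · have hrev := hR1.reverse (E' := E) (fun u v h => (hF u v h).2.1)
      have hcyc := (hP1.append hrev (c := c))
      have e : (x :: a ++ [z]) ++ (x :: R₁ ++ [z]).reverse.tail = x :: ((a ++ z :: R₁.reverse) ++ [x]) := by
        simp
      rw [e] at hcyc
      have hnn := hE x (a ++ z :: R₁.reverse) (by
        simp only [List.mem_cons, List.mem_append] at ha
        simp only [List.nodup_cons, List.nodup_append, List.mem_append, List.mem_cons,
          List.cons_append, List.nodup_reverse, List.mem_reverse] at hPn hRn ⊢
        grind) hcyc.1.2.2 (by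
        simp only [List.length_append, List.length_cons, List.length_reverse]
        rcases not_and_or.1 hshort with h | h <;>
        · have := List.length_pos_iff.2 h
          omega)
      rw [hcyc.2] at hnn
      have := walkWeight_add_reverse_nonpos (c := c) (fun u v h => (hF u v h).2.2) hR1.2.2
      linarith

end Walks

end

section

/-! ## Shortest paths by sequences of negative trees -/

section Lists

variable {V : Type*} {E : V → V → Prop} {c : V → V → ℝ}

theorem isChain_and_left {p : V → Prop} {a : List V} {x : V} (h : (a ++ [x]).IsChain E)
    (ha : ∀ u ∈ a, p u) : (a ++ [x]).IsChain (fun u w => E u w ∧ p u) := by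
  rw [List.isChain_iff_forall_rel_of_append_cons_cons] at h ⊢
  intro u w l₁ l₂ e
  refine ⟨h e, ha u ?_⟩
  have e' : a ++ [x] = (l₁ ++ [u]) ++ w :: l₂ := by simp [e]
  rcases List.append_eq_append_iff.1 e' with ⟨a', h1, h2⟩ | ⟨c', h1, h2⟩
  · cases a' with
    | nil => simp at h1; rw [← h1]; simp
    | cons z a' => simp at h2
  · rw [h1]; simp

theorem isChain_and_right {p : V → Prop} {b : List V} {x : V} (h : (x :: b).IsChain E)
    (hb : ∀ u ∈ b, p u) : (x :: b).IsChain (fun u w => E u w ∧ p w) := by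
  rw [List.isChain_iff_forall_rel_of_append_cons_cons] at h ⊢
  intro u w l₁ l₂ e
  refine ⟨h e, hb w ?_⟩
  cases l₁ with
  | nil => simp at e; rw [e.2]; simp
  | cons z l₁ => simp at e; rw [e.2]; simp

theorem exists_last_arc (F : V → V → Prop) {s t : V} {P : List V} (h : Wk E s t P) :
    Wk (fun u v => E u v ∧ ¬ F u v) s t P ∨ ∃ l₁ p q l₂, P = l₁ ++ p :: q :: l₂ ∧ F p q ∧
      Wk (fun u v => E u v ∧ ¬ F u v) q t (q :: l₂) := by
  induction P generalizing s with
  | nil => exact absurd rfl h.ne_nil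
  | cons a P ih =>
    cases P with
    | nil => exact Or.inl (wk_singleton.2 (wk_singleton.1 h))
    | cons b P =>
      obtain ⟨rfl, hab, h'⟩ := wk_cons_cons.1 h
      rcases ih h' with hP | ⟨l₁, p, q, l₂, e, hF, hw⟩
      · by_cases hF : F a b
        · exact Or.inr ⟨[], a, b, P, rfl, hF, hP⟩
        · exact Or.inl (wk_cons_cons.2 ⟨rfl, ⟨hab, hF⟩, hP⟩)
      · exact Or.inr ⟨a :: l₁, p, q, l₂, by rw [e]; rfl, hF, hw⟩

theorem Wk.forall_mem {U : Set V} {s t : V} {R : List V} (h : Wk E s t R) (hs : s ∈ U)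
    (hE : ∀ u v, E u v → u ∈ U → v ∈ U) : ∀ z ∈ R, z ∈ U := by
  induction R generalizing s with
  | nil => simp
  | cons a R ih =>
    cases R with
    | nil =>
      obtain ⟨rfl, -⟩ := wk_singleton.1 h
      simpa using hs
    | cons b R =>
      obtain ⟨rfl, hab, h'⟩ := wk_cons_cons.1 h
      have := ih h' (hE _ _ hab hs)
      simpa [hs] using this

/-- Cutting a cycle open at an arc. -/
theorem exists_path_of_cycle {v a b : V} {l l₁ l₂ : List V} (hnd : (v :: l).Nodup)
    (hch : (v :: (l ++ [v])).IsChain E) (e : v :: (l ++ [v]) = l₁ ++ a :: b :: l₂) :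
    ∃ m, Wk E b a m ∧ m.Nodup ∧ m.length = l.length + 1 ∧
      walkWeight c (v :: (l ++ [v])) = walkWeight c m + c a b := by
  have hw : Wk E v v (v :: (l ++ [v])) := ⟨rfl, by
    rw [← List.cons_append, List.getLast?_append]; simp, hch⟩
  rw [e] at hw
  obtain ⟨h1, h2⟩ := wk_split.1 hw
  obtain ⟨-, -, h2⟩ := wk_cons_cons.1 h2
  obtain ⟨t, ht⟩ := h1.exists_cons
  have e2 : l ++ [v] = t ++ b :: l₂ := by
    have : v :: (l ++ [v]) = (l₁ ++ [a]) ++ b :: l₂ := by rw [e]; simp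
    rw [ht] at this
    simpa using this
  have h3 := h2.append (c := c) h1
  rw [ht, List.tail_cons] at h3
  have hperm : (b :: l₂ ++ t).Perm (v :: l) := by
    refine List.perm_append_comm.trans ?_
    rw [← e2]
    exact List.perm_append_singleton v l
  refine ⟨b :: l₂ ++ t, h3.1, hperm.nodup_iff.2 hnd, by rw [hperm.length_eq]; simp, ?_⟩
  rw [h3.2, e, walkWeight_split, ht]
  simp only [walkWeight]
  ring

theorem reflTransGen_mono {E' : V → V → Prop} {s t : V} (h : Relation.ReflTransGen E s t)
    (hE : ∀ u v, E u v → E' u v) : Relation.ReflTransGen E' s t := by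
  induction h with
  | refl => exact .refl
  | tail _ h ih => exact ih.tail (hE _ _ h)

theorem exists_crossing {U : Set V} {s t : V} (h : Relation.ReflTransGen E s t) (hs : s ∈ U)
    (ht : t ∉ U) : ∃ p q, E p q ∧ p ∈ U ∧ q ∉ U := by
  induction h with
  | refl => exact absurd hs ht
  | @tail b c' _ hbc ih =>
    by_cases hb : b ∈ U
    · exact ⟨b, c', hbc, hb, ht⟩
    · exact ih hb

end Lists

variable {n : ℕ}

/-- The matrix of the lengths of the shortest walks that use one path of every tree in a sequence
of trees, in this order. -/
def evalSeq (d₀ : Fin n → Fin n → WithTop ℝ) (τ : ℕ → Fin n → Fin n → WithTop ℝ)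
    (M : Fin n → Fin n → WithTop ℝ) (l : List ℕ) : Fin n → Fin n → WithTop ℝ :=
  l.foldl (fun M T => minPlus (minPlus M (τ T)) d₀) M

theorem evalSeq_snoc_le (d₀ : Fin n → Fin n → WithTop ℝ) (τ : ℕ → Fin n → Fin n → WithTop ℝ)
    (M : Fin n → Fin n → WithTop ℝ) (l : List ℕ) (T : ℕ) (s x y v : Fin n) :
    evalSeq d₀ τ M (l ++ [T]) s v ≤ evalSeq d₀ τ M l s x + τ T x y + d₀ y v := by
  simp only [evalSeq, List.foldl_append, List.foldl_cons, List.foldl_nil]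
  exact (minPlus_le _ _ _ y _).trans (add_le_add (minPlus_le _ _ _ x _) le_rfl)

/-- The arcs of a block together with the labels of its negative trees, and the matrices that the
algorithm computes. -/
structure BlockData (n : ℕ) where
  c : Fin n → Fin n → ℝ
  E : Fin n → Fin n → Prop
  F : Fin n → Fin n → Prop
  lab : Fin n → Fin n → ℕ
  d₀ : Fin n → Fin n → WithTop ℝ
  τ : ℕ → Fin n → Fin n → WithTop ℝ
  F_ne : ∀ u v, F u v → u ≠ v
  F_symm : ∀ u v, F u v → F v u
  F_le : ∀ u v, F u v → E u v
  F_neg : ∀ u v, F u v → c u v + c v u < 0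
  lab_symm : ∀ u v, F u v → lab u v = lab v u
  lab_conn : ∀ a b a' b', F a b → F a' b' → lab a b = lab a' b' →
    Relation.ReflTransGen (fun u v => F u v ∧ lab u v = lab a b) a a'
  -- The diagonal is excluded because the computed matrices of the trees are infinite there.
  tau_eq : ∀ T x y R, x ≠ y → Wk (fun u v => F u v ∧ lab u v = T) x y R → R.Nodup →
    τ T x y = walkWeight c R
  -- An upper bound suffices: these data serve only to bound computed entries by path lengths. The
  -- converse is the business of `Realized`.
  d₀_le : ∀ s v P, Wk (fun u v => E u v ∧ ¬ F u v) s v P → P.Nodup → d₀ s v ≤ walkWeight c P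

namespace BlockData

variable (b : BlockData n)

/-- The negative arcs with label `T`. -/
def FT (T : ℕ) (u v : Fin n) : Prop := b.F u v ∧ b.lab u v = T

/-- The arcs of the block without the negative arcs whose label is not in `S`. -/
def ES (S : Finset ℕ) (u v : Fin n) : Prop := b.E u v ∧ (b.F u v → b.lab u v ∈ S)

theorem FT_symm {T : ℕ} {u v : Fin n} (h : b.FT T u v) : b.FT T v u :=
  ⟨b.F_symm _ _ h.1, by rw [← b.lab_symm _ _ h.1, h.2]⟩

theorem FT_ES {S : Finset ℕ} {T : ℕ} (hT : T ∈ S) {u v : Fin n} (h : b.FT T u v) :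
    b.ES S u v :=
  ⟨b.F_le _ _ h.1, fun _ => h.2.symm ▸ hT⟩

/-- Every path has a sequence of trees that gives at most its length. -/
theorem exists_evalSeq_le (S : Finset ℕ) (hS : NonnegLongCycles (b.ES S) b.c) {s v : Fin n}
    {P : List (Fin n)} (hP : Wk (b.ES S) s v P) (hPn : P.Nodup) :
    ∃ l : List ℕ, l.Nodup ∧ (∀ T ∈ l, T ∈ S) ∧
      evalSeq b.d₀ b.τ b.d₀ l s v ≤ walkWeight b.c P := by
  induction S using Finset.strongInduction generalizing s v P with
  | H S ih =>
  -- After its last negative arc `pq` the path is bounded by `d₀`. The label `T` of this arc becomes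
  -- the last one of the sequence.
  rcases exists_last_arc b.F hP with h | ⟨l₁, p, q, l₂, rfl, hpq, hq⟩
  · exact ⟨[], by simp, by simp, b.d₀_le _ _ _ (h.mono fun u v h => ⟨h.1.1, h.2⟩) hPn⟩
  · set T := b.lab p q with hT
    have hPq : Wk (b.ES S) s v ((l₁ ++ [p]) ++ q :: l₂) := by simpa using hP
    have hPqn : ((l₁ ++ [p]) ++ q :: l₂).Nodup := by simpa using hPn
    have hTS : T ∈ S := (wk_cons_cons.1 (wk_split.1 hP).2).2.1.2 hpq
    -- `x` is the first vertex of the path on the tree `T`. The part from `x` to `q`, which may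
    -- leave the tree and return, is replaced by the tree path `R`, and this is not longer.
    obtain ⟨a, x, a', e, ⟨x', hx⟩, ha⟩ := exists_split_first (fun z => ∃ z', b.FT T z z')
      (l := l₁ ++ [p]) ⟨p, by simp, q, hpq, rfl⟩
    have e' : l₁ ++ p :: q :: l₂ = a ++ x :: (a' ++ q :: l₂) := by
      rw [← List.cons_append, ← List.append_assoc, ← e]; simp
    rw [e'] at hP hPn ⊢
    obtain ⟨h1, h2⟩ := wk_split.1 hP
    rw [← List.cons_append] at h2 hPn
    obtain ⟨h2, h3⟩ := wk_split.1 h2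
    have hxq : x ≠ q := by
      rintro rfl
      simp [List.nodup_append] at hPn
    obtain ⟨R, hR, hRn⟩ := exists_path_of_reflTransGen (b.lab_conn x x' q p hx.1 (b.F_symm _ _ hpq)
      (by rw [hx.2, hT, b.lab_symm _ _ hpq]))
    have hx2 := hx.2
    rw [hx.2] at hR
    have hRle : walkWeight b.c R ≤ walkWeight b.c (x :: a' ++ [q]) := by
      refine walkWeight_le_of_negative_path hS ?_ hR hRn h2 (hPn.sublist ?_)
      · intro u v huv
        exact ⟨b.FT_ES hTS huv, b.FT_ES hTS (b.FT_symm huv), (b.F_neg _ _ huv.1).le⟩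
      · simp
    -- No vertex before `x` is incident with an arc of label `T`, so the initial part lives in the
    -- smaller label set. This is what makes the labels of the sequence distinct.
    have h1' : Wk (b.ES (S.erase T)) s x (a ++ [x]) := by
      refine ⟨h1.1, h1.2.1, (isChain_and_left h1.2.2 ha).imp ?_⟩
      rintro u w ⟨huw, hu⟩
      refine ⟨huw.1, fun hF => Finset.mem_erase.2 ⟨fun h => hu ⟨w, hF, h⟩, huw.2 hF⟩⟩
    obtain ⟨l, hl, hlS, hle⟩ := ih (S.erase T) (Finset.erase_ssubset hTS)
      (hS.mono fun u v h => ⟨h.1, fun hF => Finset.mem_of_mem_erase (h.2 hF)⟩) h1' (by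
        refine hPn.sublist ?_
        simp)
    refine ⟨l ++ [T], ?_, ?_, ?_⟩
    · rw [List.nodup_append]
      refine ⟨hl, by simp, ?_⟩
      intro x hx y hy hxy
      obtain rfl : y = T := by simpa using hy
      exact Finset.notMem_erase T S (hxy ▸ hlS x hx)
    · intro x hx
      rcases List.mem_append.1 hx with hx | hx
      · exact Finset.mem_of_mem_erase (hlS x hx)
      · rw [List.mem_singleton.1 hx]
        exact hTS
    · refine (evalSeq_snoc_le _ _ _ _ _ _ x q _).trans ?_
      rw [b.tau_eq T x q R hxq hR hRn]
      have hd := b.d₀_le q v (q :: l₂) (hq.mono fun u v h => ⟨h.1.1, h.2⟩) (by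
        refine hPn.sublist ?_
        exact List.sublist_append_of_sublist_right (List.sublist_append_right _ _))
      refine (add_le_add (add_le_add hle le_rfl) hd).trans ?_
      rw [walkWeight_split b.c a x (a' ++ q :: l₂), ← List.cons_append, walkWeight_split b.c (x :: a')]
      norm_cast
      linarith

/-! ### Sufficiency of the tests: growing the trees leaf by leaf -/

/-- The negative forest has no cycles. -/
def NoCycle : Prop := ∀ w x y, b.F w x → b.F w y → x ≠ y →
  ¬ Relation.ReflTransGen (fun u v => b.F u v ∧ u ≠ w ∧ v ≠ w) x y

/-- The arcs with labels in `S` and the arcs with label `T` inside `U`. -/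
def EU (S : Finset ℕ) (T : ℕ) (U : Set (Fin n)) (u v : Fin n) : Prop :=
  b.E u v ∧ (b.F u v → b.lab u v ∈ S ∨ (b.lab u v = T ∧ u ∈ U ∧ v ∈ U))

/-- Adding one leaf of a tree does not create a negative cycle. -/
theorem nonneg_insert_leaf (hF : b.NoCycle) {S : Finset ℕ} {T : ℕ}
    (htest : ∀ l : List ℕ, l.Nodup → (∀ i ∈ l, i ∈ S) → ∀ x y,
      0 ≤ evalSeq b.d₀ b.τ b.d₀ l x y + b.τ T y x)
    (hS : NonnegLongCycles (b.ES S) b.c) {U : Set (Fin n)} {p q : Fin n}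
    (hU : ∀ x ∈ U, ∀ y ∈ U,
      Relation.ReflTransGen (fun u v => b.FT T u v ∧ u ∈ U ∧ v ∈ U) x y)
    (hN : NonnegLongCycles (b.EU S T U) b.c) (hpq : b.FT T p q) (hp : p ∈ U) (hq : q ∉ U) :
    NonnegLongCycles (b.EU S T (insert q U)) b.c := by
  -- A second neighbour of `q` in the connected set `U` would close a cycle of the forest. Hence the
  -- only arcs that become available are `pq` and `qp`.
  have hnbr : ∀ y ∈ U, b.FT T q y → y = p := by
    intro y hy hqy
    by_contra hne
    refine hF q y p hqy.1 (b.F_symm _ _ hpq.1) hne (reflTransGen_mono (hU y hy p hp) ?_)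
    rintro u v ⟨h1, h2, h3⟩
    exact ⟨h1.1, fun h => hq (h ▸ h2), fun h => hq (h ▸ h3)⟩
  have hpq' : p ≠ q := b.F_ne _ _ hpq.1
  have hnew : ∀ u w, b.EU S T (insert q U) u w → ¬ b.EU S T U u w →
      (u = p ∧ w = q) ∨ (u = q ∧ w = p) := by
    intro u w h1 h2
    simp only [EU, not_and, Classical.not_imp] at h2
    obtain ⟨hF1, h3⟩ := h2 h1.1
    rw [not_or] at h3
    obtain ⟨hl, hu, hw⟩ := (h1.2 hF1).resolve_left h3.1
    have hne := b.F_ne _ _ hF1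
    rcases hu with rfl | hu
    · have hwU : w ∈ U := hw.resolve_left hne.symm
      exact Or.inr ⟨rfl, hnbr w hwU ⟨hF1, hl⟩⟩
    · rcases hw with rfl | hw
      · exact Or.inl ⟨hnbr u hu (b.FT_symm ⟨hF1, hl⟩), rfl⟩
      · exact absurd ⟨hl, hu, hw⟩ h3.2
  have hmem : ∀ {x y : Fin n} {R : List (Fin n)}, x ∈ U →
      Wk (fun u v => b.FT T u v ∧ u ∈ U ∧ v ∈ U) x y R → ∀ z ∈ R, z ∈ U :=
    fun hx hR => hR.forall_mem hx fun u v h _ => h.2.2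
  have hFU : ∀ u v, b.FT T u v ∧ u ∈ U ∧ v ∈ U →
      b.EU S T U u v ∧ b.EU S T U v u ∧ b.c u v + b.c v u ≤ 0 := by
    rintro u v ⟨h, hu, hv⟩
    exact ⟨⟨b.F_le _ _ h.1, fun _ => Or.inr ⟨h.2, hu, hv⟩⟩,
      ⟨b.F_le _ _ (b.F_symm _ _ h.1), fun _ => Or.inr ⟨(b.FT_symm h).2, hv, hu⟩⟩,
      (b.F_neg _ _ h.1).le⟩
  intro v l hnd hch hl
  by_cases hold : (v :: (l ++ [v])).IsChain (b.EU S T U)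
  · exact hN v l hnd hold hl
  · rw [List.isChain_iff_forall_rel_of_append_cons_cons] at hold
    push Not at hold
    obtain ⟨x, y, l₁, l₂, e, hxy⟩ := hold
    have hxy' := List.isChain_iff_forall_rel_of_append_cons_cons.1 hch e
    obtain ⟨m, hm, hmn, hml, hmw⟩ := exists_path_of_cycle (c := b.c) hnd hch e
    rw [hmw]
    -- The cycle uses only one new arc: a repetition would repeat a vertex, and both directions
    -- together would leave only two arcs.
    have hchain : Wk (b.EU S T U) y x m := by
      refine ⟨hm.1, hm.2.1, ?_⟩
      rw [List.isChain_iff_forall_rel_of_append_cons_cons]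
      intro u w m₁ m₂ em
      by_contra huw
      have huw' := List.isChain_iff_forall_rel_of_append_cons_cons.1 hm.2.2 em
      have hmy := hm.1
      have hmx := hm.2.1
      have hlen : 1 ≤ m₁.length ∨ 1 ≤ m₂.length := by
        rw [em] at hml
        simp at hml
        omega
      have hhead : u = y → m₁ = [] := by
        rintro rfl
        cases m₁ with
        | nil => rfl
        | cons z m₁ =>
          rw [em] at hmn hmy
          obtain rfl : z = u := by simpa using hmy
          simp at hmn
      have hhead' : w ≠ y := by
        rintro rfl
        rw [em] at hmn hmy
        cases m₁ with
        | nil =>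
          obtain rfl : u = w := by simpa using hmy
          simp at hmn
        | cons z m₁ =>
          obtain rfl : z = w := by simpa using hmy
          simp at hmn
      have hlast : w = x → m₂ = [] := by
        rintro rfl
        rcases List.eq_nil_or_concat' m₂ with rfl | ⟨m₃, z, rfl⟩
        · rfl
        · rw [em] at hmn hmx
          have e3 : m₁ ++ u :: w :: (m₃ ++ [z]) = (m₁ ++ u :: w :: m₃) ++ [z] := by simp
          rw [e3, List.getLast?_append] at hmx
          obtain rfl : z = w := by simpa using hmx
          simp [List.nodup_append] at hmn
      rcases hnew _ _ hxy' hxy with ⟨rfl, rfl⟩ | ⟨rfl, rfl⟩ <;>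
      rcases hnew _ _ huw' huw with ⟨rfl, rfl⟩ | ⟨rfl, rfl⟩
      · exact hhead' rfl
      · rw [hhead rfl, hlast rfl] at hlen
        simp at hlen
      · rw [hhead rfl, hlast rfl] at hlen
        simp at hlen
      · exact hhead' rfl
    rcases hnew _ _ hxy' hxy with ⟨rfl, rfl⟩ | ⟨rfl, rfl⟩
    -- Case of the arc `pq`. From `q` the cycle runs outside `U` up to its first vertex `z` in `U`,
    -- without arcs of label `T`, so an earlier product bounds this part. The rest, from `z` to `p`,
    -- is at least the tree path, which together with `pq` is the tree path from `z` to `q`. The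
    -- test for `(q, z)` applies.
    · obtain ⟨a, z, a', rfl, hz, ha⟩ := exists_split_first (fun z => z ∈ U) ⟨x, hm.last_mem, hp⟩
      obtain ⟨h1, h2⟩ := wk_split.1 hchain
      have h1' : Wk (b.ES S) y z (a ++ [z]) := by
        refine ⟨h1.1, h1.2.1, (isChain_and_left h1.2.2 ha).imp ?_⟩
        rintro u w ⟨huw, hu⟩
        exact ⟨huw.1, fun hF => (huw.2 hF).resolve_right fun h => hu h.2.1⟩
      obtain ⟨l, hln, hlS, hle⟩ := b.exists_evalSeq_le S hS h1' (hmn.sublist (by simp))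
      obtain ⟨R, hR, hRn⟩ := exists_path_of_reflTransGen (hU z hz x hp)
      have hRle := walkWeight_le_of_negative_path hN hFU hR hRn h2
        (hmn.sublist (List.sublist_append_right _ _))
      have hRq := ((hR.mono (E' := b.FT T) fun u v h => h.1).snoc (c := b.c) hpq)
      have ht := htest l hln hlS y z
      rw [b.tau_eq T z y (R ++ [y]) (by rintro rfl; exact hq hz) hRq.1 (by
        rw [List.nodup_append]
        refine ⟨hRn, by simp, ?_⟩
        intro u hu w hw huw
        obtain rfl : w = y := by simpa using hw
        exact hq (huw ▸ hmem hz hR u hu)), hRq.2] at ht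
      have := ht.trans (add_le_add hle le_rfl)
      norm_cast at this
      rw [walkWeight_split]
      linarith
    -- The mirror case of the arc `qp`: now `z` is the last vertex in `U` before the cycle returns
    -- to `q`.
    · obtain ⟨a, z, a', rfl, hz, ha⟩ := exists_split_last (fun z => z ∈ U) ⟨y, hm.head_mem, hp⟩
      obtain ⟨h1, h2⟩ := wk_split.1 hchain
      have h2' : Wk (b.ES S) z x (z :: a') := by
        refine ⟨h2.1, h2.2.1, (isChain_and_right h2.2.2 ha).imp ?_⟩
        rintro u w ⟨huw, hw⟩
        exact ⟨huw.1, fun hF => (huw.2 hF).resolve_right fun h => hw h.2.2⟩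
      obtain ⟨l, hln, hlS, hle⟩ := b.exists_evalSeq_le S hS h2'
        (hmn.sublist (List.sublist_append_right _ _))
      obtain ⟨R, hR, hRn⟩ := exists_path_of_reflTransGen (hU y hp z hz)
      have hRle := walkWeight_le_of_negative_path hN hFU hR hRn h1 (hmn.sublist (by simp))
      have hRq := ((hR.mono (E' := b.FT T) fun u v h => h.1).cons (c := b.c) (b.FT_symm hpq))
      have ht := htest l hln hlS z x
      rw [b.tau_eq T x z (x :: R) (by rintro rfl; exact hq hz) hRq.1 (by
        rw [List.nodup_cons]
        exact ⟨fun h => hq (hmem hp hR x h), hRn⟩), hRq.2] at ht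
      have := ht.trans (add_le_add hle le_rfl)
      norm_cast at this
      rw [walkWeight_split]
      linarith

/-- Adding one tree does not create a negative cycle if all tests succeed. -/
theorem nonneg_insert_label (hF : b.NoCycle) {S : Finset ℕ} {T : ℕ}
    (htest : ∀ l : List ℕ, l.Nodup → (∀ i ∈ l, i ∈ S) → ∀ x y,
      0 ≤ evalSeq b.d₀ b.τ b.d₀ l x y + b.τ T y x)
    (hS : NonnegLongCycles (b.ES S) b.c) : NonnegLongCycles (b.ES (insert T S)) b.c := by
  by_cases hex : ∃ r r', b.FT T r r'
  · obtain ⟨r, r', hr⟩ := hex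
    -- The connected vertex sets that contain `r` and whose arcs of label `T` may be added safely. A
    -- maximal one contains the whole tree, since otherwise some tree arc leaves it and its end can
    -- be added as a leaf.
    let 𝒰 : Set (Set (Fin n)) := {U | r ∈ U ∧ (∀ x ∈ U, ∀ y ∈ U,
      Relation.ReflTransGen (fun u v => b.FT T u v ∧ u ∈ U ∧ v ∈ U) x y) ∧
      NonnegLongCycles (b.EU S T U) b.c}
    have h0 : {r} ∈ 𝒰 := by
      refine ⟨rfl, ?_, hS.mono ?_⟩
      · rintro x rfl y rfl
        exact .refl
      · rintro u v ⟨h1, h2⟩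
        refine ⟨h1, fun h => (h2 h).resolve_right ?_⟩
        rintro ⟨-, h3, h4⟩
        exact b.F_ne _ _ h (h3.trans h4.symm)
    obtain ⟨U, ⟨hrU, hU, hN⟩, hmax⟩ := (Set.toFinite 𝒰).exists_maximal ⟨_, h0⟩
    have hall : ∀ u v, b.FT T u v → u ∈ U := by
      intro u v huv
      by_contra hu
      have hru := b.lab_conn r r' u v hr.1 huv.1 (hr.2.trans huv.2.symm)
      rw [hr.2] at hru
      obtain ⟨p, q, hpq, hp, hq⟩ := exists_crossing hru hrU hu
      refine hq (hmax (y := insert q U) ⟨Or.inr hrU, ?_,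
        b.nonneg_insert_leaf hF htest hS hU hN hpq hp hq⟩ (Set.subset_insert _ _)
        (Set.mem_insert _ _))
      have hmono : ∀ x ∈ U, ∀ y ∈ U, Relation.ReflTransGen
          (fun u v => b.FT T u v ∧ u ∈ insert q U ∧ v ∈ insert q U) x y :=
        fun x hx y hy => reflTransGen_mono (hU x hx y hy) fun u v h => ⟨h.1, Or.inr h.2.1, Or.inr h.2.2⟩
      have h1 : (fun u v => b.FT T u v ∧ u ∈ insert q U ∧ v ∈ insert q U) p q :=
        ⟨hpq, Or.inr hp, Or.inl rfl⟩
      have h2 : (fun u v => b.FT T u v ∧ u ∈ insert q U ∧ v ∈ insert q U) q p :=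
        ⟨b.FT_symm hpq, Or.inl rfl, Or.inr hp⟩
      rintro x (rfl | hx) y (rfl | hy)
      · exact .refl
      · exact .head h2 (hmono p hp y hy)
      · exact .tail (hmono x hx p hp) h1
      · exact hmono x hx y hy
    refine hN.mono ?_
    rintro u v ⟨h1, h2⟩
    refine ⟨h1, fun h => ?_⟩
    rcases Finset.mem_insert.1 (h2 h) with hl | hl
    · exact Or.inr ⟨hl, hall u v ⟨h, hl⟩, hall v u (b.FT_symm ⟨h, hl⟩)⟩
    · exact Or.inl hl
  · refine hS.mono ?_
    rintro u v ⟨h1, h2⟩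
    refine ⟨h1, fun h => (Finset.mem_insert.1 (h2 h)).resolve_left fun hl => hex ⟨u, v, h, hl⟩⟩

/-- If the negative graph is a forest and all tests succeed, then there is no negative cycle with
more than two arcs. -/
theorem nonnegLongCycles_of_tests (hF : b.NoCycle) (γ : ℕ) (hlab : ∀ u v, b.F u v → b.lab u v < γ)
    (htest : ∀ (l : List ℕ) (T : ℕ), l.Nodup → (∀ i ∈ l, i < γ) → T < γ → T ∉ l → ∀ x y,
      0 ≤ evalSeq b.d₀ b.τ b.d₀ l x y + b.τ T y x)
    (h0 : NonnegLongCycles (fun u v => b.E u v ∧ ¬ b.F u v) b.c) : NonnegLongCycles b.E b.c := by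
  have key : ∀ k ≤ γ, NonnegLongCycles (b.ES (Finset.range k)) b.c := by
    intro k
    induction k with
    | zero => exact fun _ => h0.mono fun u v h => ⟨h.1, fun hF => by simpa using h.2 hF⟩
    | succ k ih =>
      intro hk
      rw [Finset.range_add_one]
      refine b.nonneg_insert_label hF (fun l hl hlS x y => htest l k hl ?_ hk ?_ x y)
        (ih (by omega))
      · intro i hi
        have := Finset.mem_range.1 (hlS i hi)
        omega
      · intro hi
        have := Finset.mem_range.1 (hlS k hi)
        omega
  refine (key γ le_rfl).mono fun u v h => ⟨h, fun hF => Finset.mem_range.2 (hlab u v hF)⟩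

end BlockData

end

section

/-! ## Every computed value belongs to a path -/

section Sound

variable {V : Type*} {D : Digraph V} {c : V → V → ℝ}

/-- The arcs of `D` that do not belong to the negative graph. -/
def OrdArc (D : Digraph V) (c : V → V → ℝ) (u v : V) : Prop := D.Adj u v ∧ ¬ (negGraph D c).Adj u v

theorem nonnegLongCycles_iff : NonnegLongCycles D.Adj c ↔ IsNearlyConservative D c := by
  constructor
  · intro h v l hc hw
    by_contra hl
    exact absurd (h v l hc.1 hc.2.2.2 (by omega)) (not_le.2 hw)
  · intro h v l hnd hch hl
    by_contra hw
    have := h v l ⟨hnd, rfl, by rw [← List.cons_append, List.getLast?_append]; simp, hch⟩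
      (not_le.1 hw)
    omega

/-- If `x` is finite, then it is at least the weight of a walk from `s` to `v` that contains
no negative edge in both directions and only negative arcs with labels in `L`. -/
def Realized (D : Digraph V) (c : V → V → ℝ) (lab : V → V → ℕ) (L : List ℕ) (s v : V)
    (x : WithTop ℝ) : Prop :=
  x ≠ ⊤ → ∃ O : V → V → Prop, (∀ u v, O u v → (negGraph D c).Adj u v ∧ lab u v ∈ L ∧ ¬ O v u) ∧
    ∃ p, Wk (fun u v => OrdArc D c u v ∨ O u v) s v p ∧ (walkWeight c p : WithTop ℝ) ≤ x

/-- Both directions of a negative edge carry the same label, so orientations that use disjoint sets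
of labels cannot conflict. -/
theorem Realized.add {lab : V → V → ℕ} (hlab : ∀ u v, (negGraph D c).Adj u v → lab u v = lab v u)
    {L L' : List ℕ} (hL : ∀ T ∈ L, T ∉ L') {s u v : V} {x y : WithTop ℝ}
    (hx : Realized D c lab L s u x) (hy : Realized D c lab L' u v y) :
    Realized D c lab (L ++ L') s v (x + y) := by
  intro hxy
  rw [Ne, WithTop.add_eq_top, not_or] at hxy
  obtain ⟨O, hO, p, hp, hpx⟩ := hx hxy.1
  obtain ⟨O', hO', p', hp', hpy⟩ := hy hxy.2
  refine ⟨fun u v => O u v ∨ O' u v, ?_, ?_⟩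
  · rintro a b (h | h)
    · obtain ⟨h1, h2, h3⟩ := hO a b h
      refine ⟨h1, List.mem_append_left _ h2, not_or.2 ⟨h3, fun h' => ?_⟩⟩
      obtain ⟨-, h4, -⟩ := hO' b a h'
      exact hL _ h2 (hlab _ _ h1 ▸ h4)
    · obtain ⟨h1, h2, h3⟩ := hO' a b h
      refine ⟨h1, List.mem_append_right _ h2, not_or.2 ⟨fun h' => ?_, h3⟩⟩
      obtain ⟨-, h4, -⟩ := hO b a h'
      exact hL _ h4 (hlab _ _ h1 ▸ h2)
  · have h := (hp.mono (E' := fun u v => OrdArc D c u v ∨ O u v ∨ O' u v)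
      (by tauto)).append (c := c) (hp'.mono (by tauto))
    refine ⟨_, h.1, ?_⟩
    rw [h.2, WithTop.coe_add]
    exact add_le_add hpx hpy

theorem not_two_orders {l : List V} (hl : l.Nodup) {u v : V} {a b a' b' : List V}
    (h : l = a ++ u :: v :: b) (h' : l = a' ++ v :: u :: b') : False := by
  induction l generalizing a a' with
  | nil => simp at h
  | cons x l ih =>
    rw [List.nodup_cons] at hl
    cases a with
    | nil =>
      cases a' with
      | nil => simp at h h'; grind
      | cons y a' => simp at h h'; grind
    | cons y a =>
      cases a' with
      | nil => simp at h h'; grind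
      | cons z a' =>
        simp at h h'
        exact ih hl.2 h.2 h'.2

/-- A path traverses an edge in at most one direction (`not_two_orders`), so its own arcs serve as
the orientation `O`. -/
theorem realized_of_negative_path {lab : V → V → ℕ} {T : ℕ} {x y : V} {R : List V} {w : WithTop ℝ}
    (hR : Wk (fun u v => (negGraph D c).Adj u v ∧ lab u v = T) x y R) (hRn : R.Nodup)
    (hw : (walkWeight c R : WithTop ℝ) ≤ w) : Realized D c lab [T] x y w := by
  intro _
  have hR' := hR.2.2
  rw [List.isChain_iff_forall_rel_of_append_cons_cons] at hR'
  refine ⟨fun u v => ∃ l₁ l₂, R = l₁ ++ u :: v :: l₂, ?_, R, ⟨hR.1, hR.2.1, ?_⟩, hw⟩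
  · rintro u v ⟨l₁, l₂, e⟩
    refine ⟨(hR' e).1, by simp [(hR' e).2], ?_⟩
    rintro ⟨l₁', l₂', e'⟩
    exact not_two_orders hRn e e'
  · rw [List.isChain_iff_forall_rel_of_append_cons_cons]
    intro u v l₁ l₂ e
    exact Or.inr ⟨l₁, l₂, e⟩

theorem realized_of_walk {lab : V → V → ℕ} {x y : V} {w : WithTop ℝ}
    (h : w ≠ ⊤ → ∃ p, Wk (OrdArc D c) x y p ∧ (walkWeight c p : WithTop ℝ) ≤ w) :
    Realized D c lab [] x y w := by
  intro hw
  obtain ⟨p, hp, hpw⟩ := h hw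
  exact ⟨fun _ _ => False, by simp, p, hp.mono (by tauto), hpw⟩

/-- On the ordinary arcs and the arcs of `O` all cycles are nonnegative: a negative 2-cycle would be
an edge of the negative graph with both directions in `O`, and longer cycles are covered by `hD`. So
loop erasure applies. -/
theorem Realized.exists_path (hloop : ∀ v, ¬ D.Adj v v) (hD : NonnegLongCycles D.Adj c)
    {lab : V → V → ℕ} {L : List ℕ} {s v : V} {x : WithTop ℝ} (h : Realized D c lab L s v x)
    (hx : x ≠ ⊤) : ∃ p, Wk D.Adj s v p ∧ p.Nodup ∧ (walkWeight c p : WithTop ℝ) ≤ x := by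
  obtain ⟨O, hO, p, hp, hpx⟩ := h hx
  have hsub : ∀ u v, OrdArc D c u v ∨ O u v → D.Adj u v := by
    rintro u v (h | h)
    · exact h.1
    · exact (hO _ _ h).1.2.1
  have hnn : NonnegCycles (fun u v => OrdArc D c u v ∨ O u v) c := by
    intro v l hnd hch
    match l with
    | [] =>
      simp only [List.nil_append, List.isChain_cons_cons] at hch
      exact absurd (hsub _ _ hch.1) (hloop v)
    | [u] =>
      simp only [List.cons_append, List.nil_append, List.isChain_cons_cons] at hch
      obtain ⟨h1, h2, -⟩ := hch
      simp only [walkWeight, List.cons_append, List.nil_append, add_zero]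
      by_contra hlt
      have hvu : v ≠ u := by
        rintro rfl
        simp at hnd
      have hF : (negGraph D c).Adj v u := ⟨hvu, hsub _ _ h1, hsub _ _ h2, not_le.1 hlt⟩
      have h1' := h1.resolve_left fun h => h.2 hF
      have h2' := h2.resolve_left fun h => h.2 hF.symm
      exact (hO _ _ h1').2.2 h2'
    | u :: w :: l => exact hD v _ hnd (hch.imp hsub) (by simp)
  obtain ⟨q, hq, hqn, hqw⟩ := exists_path_of_walk hnn hp
  exact ⟨q, hq.mono hsub, hqn, le_trans (by exact_mod_cast hqw) hpx⟩

theorem wk_self {E : V → V → Prop} {s : V} {p : List V} (h : Wk E s s p) (hp : p.Nodup) :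
    p = [s] := by
  obtain ⟨q, rfl⟩ := h.exists_cons
  rcases List.eq_nil_or_concat' q with rfl | ⟨q, z, rfl⟩
  · rfl
  · have := h.2.1
    rw [← List.cons_append, List.getLast?_append] at this
    obtain rfl : z = s := by simpa using this
    simp at hp

/-- A closed walk erases to the trivial path of weight zero. This gives the necessity of the tests.
-/
theorem Realized.nonneg (hloop : ∀ v, ¬ D.Adj v v) (hD : NonnegLongCycles D.Adj c)
    {lab : V → V → ℕ} {L : List ℕ} {s : V} {x : WithTop ℝ} (h : Realized D c lab L s s x) :
    0 ≤ x := by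
  by_cases hx : x = ⊤
  · rw [hx]
    exact le_top
  · obtain ⟨p, hp, hpn, hpw⟩ := h.exists_path hloop hD hx
    rw [wk_self hp hpn] at hpw
    simpa [walkWeight] using hpw

end Sound

/-- The tree factors have distinct labels and the factors `d₀` have none, so `Realized.add` applies
to each product. -/
theorem realized_evalSeq {n : ℕ} {D : Digraph (Fin n)} {c : Fin n → Fin n → ℝ}
    {lab : Fin n → Fin n → ℕ} {d₀ : Fin n → Fin n → WithTop ℝ}
    {τ : ℕ → Fin n → Fin n → WithTop ℝ}
    (hlab : ∀ u v, (negGraph D c).Adj u v → lab u v = lab v u)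
    (hd₀ : ∀ s v, Realized D c lab [] s v (d₀ s v))
    (hτ : ∀ T s v, Realized D c lab [T] s v (τ T s v)) (l : List ℕ) (hl : l.Nodup)
    (s v : Fin n) : Realized D c lab l s v (evalSeq d₀ τ d₀ l s v) := by
  induction l using List.reverseRecOn generalizing v with
  | nil => exact hd₀ s v
  | append_singleton l T ih =>
    simp only [evalSeq, List.foldl_append, List.foldl_cons, List.foldl_nil] at ih ⊢
    obtain ⟨y, hy⟩ := exists_minPlus_eq (minPlus (l.foldl
      (fun M T => minPlus (minPlus M (τ T)) d₀) d₀) (τ T)) d₀ s v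
    obtain ⟨x, hx⟩ := exists_minPlus_eq (l.foldl (fun M T => minPlus (minPlus M (τ T)) d₀) d₀)
      (τ T) s y
    rw [hy, hx]
    rw [List.nodup_append] at hl
    have h1 := Realized.add hlab (by
      intro T' hT' hT
      exact hl.2.2 T' hT' T (by simp) (by simpa using hT)) (ih hl.1 x) (hτ T x y)
    simpa using Realized.add hlab (by simp) h1 (hd₀ y v)

end

section

/-! ## Strong components and blocks -/

section Blocks

variable {V : Type*} {D : Digraph V} {c : V → V → ℝ}

/-- Mutual reachability. -/
def SameStrong (D : Digraph V) (u v : V) : Prop :=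
  Relation.ReflTransGen D.Adj u v ∧ Relation.ReflTransGen D.Adj v u

theorem SameStrong.symm {u v : V} (h : SameStrong D u v) : SameStrong D v u := ⟨h.2, h.1⟩

theorem SameStrong.refl (u : V) : SameStrong D u u := ⟨.refl, .refl⟩

theorem SameStrong.trans {u v w : V} (h : SameStrong D u v) (h' : SameStrong D v w) :
    SameStrong D u w := ⟨h.1.trans h'.1, h'.2.trans h.2⟩

/-- Adjacency in the underlying graph of the strong components. -/
def StrongAdj (D : Digraph V) (u v : V) : Prop :=
  u ≠ v ∧ (D.Adj u v ∨ D.Adj v u) ∧ SameStrong D u v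

theorem StrongAdj.symm {u v : V} (h : StrongAdj D u v) : StrongAdj D v u :=
  ⟨h.1.symm, h.2.1.symm, h.2.2.symm⟩

/-- Connectivity in the underlying graph of the strong components without the vertex `w`. -/
def ConnWithout (D : Digraph V) (w u v : V) : Prop :=
  Relation.ReflTransGen (fun a b => StrongAdj D a b ∧ a ≠ w ∧ b ≠ w) u v

theorem ConnWithout.symm {w u v : V} (h : ConnWithout D w u v) : ConnWithout D w v u := by
  induction h with
  | refl => exact .refl
  | tail _ h ih => exact .head ⟨h.1.symm, h.2.2, h.2.1⟩ ih

theorem wk_without {E : V → V → Prop} {w u v : V} {l : List V} (h : Wk E u v l)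
    (hw : w ∉ l) : Wk (fun a b => E a b ∧ a ≠ w ∧ b ≠ w) u v l := by
  refine ⟨h.1, h.2.1, ?_⟩
  have h2 := h.2.2
  rw [List.isChain_iff_forall_rel_of_append_cons_cons] at h2 ⊢
  intro a b l₁ l₂ e
  refine ⟨h2 e, ?_, ?_⟩ <;>
  · rintro rfl
    exact hw (by rw [e]; simp)

theorem Wk.connWithout {w u v : V} {l : List V} (h : Wk (StrongAdj D) u v l)
    (hw : w ∉ l) : ConnWithout D w u v := reflTransGen_of_wk (wk_without h hw)

theorem Wk.sameStrong {u v : V} {l : List V} (h : Wk (StrongAdj D) u v l) : SameStrong D u v := by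
  have := reflTransGen_of_wk h
  clear h
  induction this with
  | refl => exact .refl _
  | tail _ h ih => exact ih.trans h.2.2

/-- Two vertices of the same strong component that no third vertex separates. -/
def SameBlock (D : Digraph V) (u v : V) : Prop :=
  SameStrong D u v ∧ ∀ w, w ≠ u → w ≠ v → ConnWithout D w u v

theorem SameBlock.symm {u v : V} (h : SameBlock D u v) : SameBlock D v u :=
  ⟨h.1.symm, fun w h1 h2 => (h.2 w h2 h1).symm⟩

theorem SameBlock.refl (u : V) : SameBlock D u u := ⟨.refl u, fun _ _ _ => .refl⟩

theorem StrongAdj.sameBlock {u v : V} (h : StrongAdj D u v) : SameBlock D u v :=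
  ⟨h.2.2, fun _ h1 h2 => .single ⟨h, h1.symm, h2.symm⟩⟩

/-- The vertex `u` lies in the block of `x` and `y`. -/
def InBlock (D : Digraph V) (x y u : V) : Prop := SameBlock D u x ∧ SameBlock D u y

/-- A vertex `w` cannot equal both `x` and `y`; connect `u` and `v` without `w` through the one that
differs from `w`. -/
theorem InBlock.sameBlock {x y u v : V} (hxy : x ≠ y) (hu : InBlock D x y u)
    (hv : InBlock D x y v) : SameBlock D u v := by
  refine ⟨hu.1.1.trans hv.1.1.symm, fun w h1 h2 => ?_⟩
  by_cases hw : w = x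
  · have hwy : w ≠ y := hw ▸ hxy
    exact (hu.2.2 w h1 hwy).trans (hv.2.2 w h2 hwy).symm
  · exact (hu.1.2 w h1 hw).trans (hv.1.2 w h2 hw).symm

/-- Any two different vertices of a block determine it, so a block can be named by a pair. -/
theorem inBlock_congr {x y u v z : V} (hxy : x ≠ y) (hs : SameBlock D x y) (huv : u ≠ v)
    (hu : InBlock D x y u) (hv : InBlock D x y v) : InBlock D u v z ↔ InBlock D x y z := by
  have hx : InBlock D x y x := ⟨.refl x, hs⟩
  have hy : InBlock D x y y := ⟨hs.symm, .refl y⟩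
  refine ⟨fun h => ⟨h.sameBlock huv ⟨hu.1.symm, hv.1.symm⟩, h.sameBlock huv ⟨hu.2.symm, hv.2.symm⟩⟩,
    fun h => ⟨h.sameBlock hxy hu, h.sameBlock hxy hv⟩⟩

/-- A path between two vertices of a block stays in the block. -/
theorem InBlock.of_mem_path {x y s t : V} (hxy : x ≠ y) (hs : InBlock D x y s)
    (ht : InBlock D x y t) {p : List V} (hp : Wk (StrongAdj D) s t p) (hpn : p.Nodup) {z : V}
    (hz : z ∈ p) (hsb : SameBlock D x y) : InBlock D x y z := by
  have key : ∀ u, InBlock D x y u → SameBlock D z u := by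
    intro u hu
    obtain ⟨p₁, p₂, rfl⟩ := List.append_of_mem hz
    obtain ⟨h1, h2⟩ := wk_split.1 hp
    refine ⟨(h1.sameStrong.symm).trans (hs.1.1.trans hu.1.1.symm), fun w hwz hwu => ?_⟩
    -- A vertex `w ≠ z` lies on at most one side of `z` on the path. Follow the other side to an end
    -- of the path, and go on inside the block.
    by_cases hw : w ∈ p₁ ++ [z]
    · have hw2 : w ∉ z :: p₂ := by
        intro h
        rw [List.nodup_append] at hpn
        have hw1 : w ∈ p₁ := by simpa [hwz] using hw
        exact hpn.2.2 w hw1 w h rfl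
      have hwt : w ≠ t := fun h => hw2 (h ▸ h2.last_mem)
      exact (h2.connWithout hw2).trans ((ht.sameBlock hxy hu).2 w hwt hwu)
    · have hws : w ≠ s := fun h => hw (h ▸ h1.head_mem)
      exact (h1.connWithout hw).symm.trans ((hs.sameBlock hxy hu).2 w hws hwu)
  exact ⟨key x ⟨.refl x, hsb⟩, key y ⟨hsb.symm, .refl y⟩⟩

theorem Wk.strongAdj (hloop : ∀ v, ¬ D.Adj v v) {s t : V} {p : List V} (h : Wk D.Adj s t p)
    (hts : Relation.ReflTransGen D.Adj t s) : Wk (StrongAdj D) s t p := by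
  induction p generalizing s with
  | nil => exact absurd rfl h.ne_nil
  | cons a p ih =>
    cases p with
    | nil => exact wk_singleton.2 (wk_singleton.1 h)
    | cons b p =>
      obtain ⟨rfl, hab, h'⟩ := wk_cons_cons.1 h
      refine wk_cons_cons.2 ⟨rfl, ⟨?_, Or.inl hab, .single hab, (reflTransGen_of_wk h').trans hts⟩,
        ih h' (hts.tail hab)⟩
      rintro rfl
      exact hloop _ hab

theorem strongAdj_of_negGraph {u v : V} (h : (negGraph D c).Adj u v) : StrongAdj D u v :=
  ⟨h.1, Or.inl h.2.1, .single h.2.1, .single h.2.2.1⟩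

/-- It suffices to look for negative cycles inside the blocks. -/
theorem nonnegLongCycles_of_blocks (hloop : ∀ v, ¬ D.Adj v v)
    (h : ∀ x y, x ≠ y → SameBlock D x y →
      NonnegLongCycles (fun u v => D.Adj u v ∧ InBlock D x y u ∧ InBlock D x y v) c) :
    NonnegLongCycles D.Adj c := by
  intro v l hnd hch hl
  match l, hl with
  | u :: l, hl =>
    have hw : Wk D.Adj v v (v :: (u :: l ++ [v])) := ⟨rfl, by
      rw [← List.cons_append, List.getLast?_append]; simp, hch⟩
    have hw := hw.strongAdj hloop .refl
    have hvu : v ≠ u := by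
      rintro rfl
      simp at hnd
    obtain ⟨-, hadj, hw'⟩ := wk_cons_cons.1 hw
    have hsb := hadj.sameBlock
    -- Without its first arc `vu` the cycle is a path from `u` to `v`. Its ends lie in the block of
    -- `v` and `u`, hence so does the whole cycle.
    have hin : ∀ z ∈ u :: (l ++ [v]), InBlock D v u z := fun z hz =>
      InBlock.of_mem_path hvu ⟨hsb.symm, .refl u⟩ ⟨.refl v, hsb⟩ hw' (by
        have := (List.perm_append_singleton v (u :: l)).nodup_iff.2 hnd
        simpa using this) hz hsb
    refine h v u hvu hsb v (u :: l) hnd ?_ hl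
    rw [List.isChain_iff_forall_rel_of_append_cons_cons] at hch ⊢
    intro a b l₁ l₂ e
    have hin' : ∀ z ∈ v :: (u :: l ++ [v]), InBlock D v u z := by
      intro z hz
      rcases List.mem_cons.1 hz with rfl | hz
      · exact hin _ (by simp)
      · exact hin z (by simpa using hz)
    exact ⟨hch e, hin' a (by rw [e]; simp), hin' b (by rw [e]; simp)⟩

/-! ## Forests -/

/-- The negative graph has no cycle. -/
def NegForest (D : Digraph V) (c : V → V → ℝ) : Prop :=
  ∀ w x y, (negGraph D c).Adj w x → (negGraph D c).Adj w y → x ≠ y →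
    ¬ Relation.ReflTransGen (fun u v => (negGraph D c).Adj u v ∧ u ≠ w ∧ v ≠ w) x y

/-- A cycle of the negative graph can be traversed in both directions, and the two weights have
negative sum; so one of them is a negative cycle with at least three arcs. -/
theorem negForest_of_nonnegLongCycles (hD : NonnegLongCycles D.Adj c) : NegForest D c := by
  intro w x y hx hy hxy hconn
  obtain ⟨p, hp, hpn⟩ := exists_path_of_reflTransGen hconn
  have hwp : w ∉ p := by
    intro h
    exact hp.forall_mem (U := {z | z ≠ w}) hx.ne' (fun u v h _ => h.2.2) w h rfl
  have hp' : Wk (negGraph D c).Adj x y p := hp.mono fun u v h => h.1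
  have hcyc := ((hp'.snoc (c := c) hy.symm).1.cons (c := c) hx).1
  have hlen : 2 ≤ p.length := by
    obtain ⟨p', rfl⟩ := hp'.exists_cons
    cases p' with
    | nil => exact absurd (wk_singleton.1 hp').2 hxy
    | cons z p' => simp
  have h1 := hD w p (List.nodup_cons.2 ⟨hwp, hpn⟩) (hcyc.2.2.imp fun u v h => h.2.1) hlen
  have hrev := hcyc.reverse (E' := (negGraph D c).Adj) fun u v h => h.symm
  have e : (w :: (p ++ [w])).reverse = w :: (p.reverse ++ [w]) := by simp
  have h2 := hD w p.reverse (List.nodup_cons.2 ⟨by simpa using hwp, by simpa using hpn⟩)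
    (by rw [← e]; exact hrev.2.2.imp fun u v h => h.2.1) (by simpa using hlen)
  rw [← e] at h2
  have h3 := walkWeight_add_reverse_neg (c := c) (fun u v h => h.2.2.2) hcyc.2.2 (by simp)
  linarith

theorem NegForest.no_long_cycle (h : NegForest D c) {v : V} {l : List V} (hnd : (v :: l).Nodup)
    (hch : (v :: (l ++ [v])).IsChain (negGraph D c).Adj) (hl : 2 ≤ l.length) : False := by
  match l, hl with
  | a :: l, hl =>
    rcases List.eq_nil_or_concat' l with rfl | ⟨m, b, rfl⟩
    · simp at hl
    · have h1 : (negGraph D c).Adj v a := by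
        simp only [List.cons_append, List.isChain_cons_cons] at hch
        exact hch.1
      have e : v :: (a :: (m ++ [b]) ++ [v]) = (v :: a :: m) ++ b :: [v] := by simp
      have hch2 := hch
      rw [List.isChain_iff_forall_rel_of_append_cons_cons] at hch2
      have h2 := hch2 e
      have hw : Wk (negGraph D c).Adj a b (a :: (m ++ [b])) := by
        refine ⟨rfl, by rw [← List.cons_append, List.getLast?_append]; simp, ?_⟩
        simp only [List.cons_append, List.isChain_cons_cons] at hch
        have := hch.2
        rw [← List.cons_append] at this
        exact (List.isChain_append.1 this).1
      have hab : a ≠ b := by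
        rintro rfl
        simp at hnd
      exact h v a b h1 h2.symm hab (reflTransGen_of_wk (wk_without hw (List.nodup_cons.1 hnd).1))

/-- Needed to invoke `HasFewNegTrees`, whose premise is stated with `IsAcyclic`. -/
theorem NegForest.isAcyclic (h : NegForest D c) : (negGraph D c).IsAcyclic := by
  intro v p hp
  have h3 := hp.three_le_length
  have hnd := hp.support_nodup
  have hch := p.isChain_adj_support
  have hlen := p.length_support
  have hl := p.getLast_support
  obtain ⟨q, hq⟩ : ∃ q, p.support = v :: q := ⟨_, p.cons_tail_support.symm⟩
  rw [hq] at hnd hch hlen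
  rw [List.tail_cons] at hnd
  rcases List.eq_nil_or_concat' q with rfl | ⟨m, z, rfl⟩
  · simp only [List.length_cons, List.length_nil] at hlen
    omega
  · have hz : z = v := by
      have e : p.support.getLast? = some v := by
        rw [List.getLast?_eq_some_getLast p.support_ne_nil, hl]
      rw [hq, ← List.cons_append, List.getLast?_append] at e
      simpa using e
    subst hz
    refine h.no_long_cycle ((List.perm_append_singleton z m).nodup_iff.1 hnd) hch ?_
    simp only [List.length_cons, List.length_append, List.length_nil] at hlen
    omega

theorem NegForest.nonnegLongCycles (h : NegForest D c) : NonnegLongCycles (negGraph D c).Adj c :=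
  fun _ _ hnd hch hl => (h.no_long_cycle hnd hch hl).elim

/-- In a forest, no cycle is negative for the weights of the reversed arcs with opposite sign. -/
theorem NegForest.nonnegCycles (h : NegForest D c) :
    NonnegCycles (negGraph D c).Adj fun u v => - c v u := by
  intro v l hnd hch
  match l with
  | [] =>
    simp only [List.nil_append, List.isChain_cons_cons] at hch
    exact absurd rfl hch.1.1
  | [u] =>
    simp only [List.cons_append, List.nil_append, List.isChain_cons_cons] at hch
    have := hch.1.2.2.2
    simp only [walkWeight, List.cons_append, List.nil_append, add_zero]
    linarith
  | u :: w :: l => exact (h.no_long_cycle hnd hch (by simp)).elim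

end Blocks

end

section

/-! ## Labels of the negative trees -/

section Blocks

variable {V : Type*} {D : Digraph V} {c : V → V → ℝ}

theorem reachable_iff {s t : V} : Reachable D s t ↔ Relation.ReflTransGen D.Adj s t := by
  constructor
  · rintro ⟨l, h, -⟩
    exact reflTransGen_of_wk h
  · intro h
    obtain ⟨p, hp, hpn⟩ := exists_path_of_reflTransGen h
    exact ⟨p, hp, hpn⟩

theorem reachable_induce {G : SimpleGraph V} {B : Set V} {E : V → V → Prop}
    (hE : ∀ u v, E u v → G.Adj u v) {s t : V} {p : List V} (hp : Wk E s t p)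
    (hB : ∀ z ∈ p, z ∈ B) (hs : s ∈ B) (ht : t ∈ B) :
    (G.induce B).Reachable ⟨s, hs⟩ ⟨t, ht⟩ := by
  induction p generalizing s with
  | nil => exact absurd rfl hp.ne_nil
  | cons a p ih =>
    cases p with
    | nil =>
      obtain ⟨rfl, rfl⟩ := wk_singleton.1 hp
      exact .refl _
    | cons b p =>
      obtain ⟨rfl, hab, hp'⟩ := wk_cons_cons.1 hp
      have hb : b ∈ B := hB b (by simp)
      have h1 : (G.induce B).Adj ⟨a, hs⟩ ⟨b, hb⟩ := hE _ _ hab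
      exact h1.reachable.trans (ih hp' (fun z hz => hB z (by simp [hz])) hb)

theorem reflTransGen_of_reachable_induce {G : SimpleGraph V} {B : Set V} {s t : B}
    (h : (G.induce B).Reachable s t) :
    Relation.ReflTransGen (fun u v => G.Adj u v ∧ u ∈ B ∧ v ∈ B) (s : V) t := by
  rw [SimpleGraph.reachable_iff_reflTransGen] at h
  induction h with
  | refl => exact .refl
  | @tail a b _ h ih => exact ih.tail ⟨h, a.2, b.2⟩

theorem sameStrong_iff {u v : V} : SameStrong D u v ↔ Reachable D u v ∧ Reachable D v u := by
  simp [SameStrong, reachable_iff]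

/-- Paths between vertices of a block stay in it, which gives connectivity, also after the removal
of a vertex. It is maximal because no third vertex separates two vertices of a nonseparable set, so
a larger such set would still consist of vertices in one block with `x` and `y`. -/
theorem isWeakBlock_inBlock (hloop : ∀ v, ¬ D.Adj v v) {x y : V} (hxy : x ≠ y)
    (hsb : SameBlock D x y) : IsWeakBlock D {u | SameStrong D u x} {u | InBlock D x y u} := by
  have hadj : ∀ u v, StrongAdj D u v → D.toSimpleGraphInclusive.Adj u v :=
    fun u v h => (SimpleGraph.fromRel_adj _ _ _).2 ⟨h.1, h.2.1⟩
  have hx : InBlock D x y x := ⟨.refl x, hsb⟩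
  refine ⟨⟨fun u hu => hu.1.1, ?_, ?_⟩, ?_⟩
  · rw [SimpleGraph.connected_iff]
    refine ⟨?_, ⟨⟨x, hx⟩⟩⟩
    rintro ⟨u, hu⟩ ⟨v, hv⟩
    have huv := hu.1.1.trans hv.1.1.symm
    obtain ⟨p, hp, hpn⟩ := exists_path_of_reflTransGen huv.1
    have hp' := hp.strongAdj hloop huv.2
    exact reachable_induce hadj hp' (fun z hz => hu.of_mem_path hxy hv hp' hpn hz hsb) hu hv
  · rintro w - ⟨u, hu, huw⟩ ⟨v, hv, hvw⟩
    have hconn := (hu.sameBlock hxy hv).2 w (Ne.symm huw) (Ne.symm hvw)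
    obtain ⟨p, hp, hpn⟩ := exists_path_of_reflTransGen hconn
    have hp' := hp.mono (E' := StrongAdj D) fun u v h => h.1
    have hpw := hp.forall_mem (U := {z | z ≠ w}) huw fun u v h _ => h.2.2
    exact reachable_induce hadj hp'
      (fun z hz => Set.mem_sdiff_of_mem (hu.of_mem_path hxy hv hp' hpn hz hsb) (hpw z hz))
      (Set.mem_sdiff_of_mem hu huw) (Set.mem_sdiff_of_mem hv hvw)
  · rintro S ⟨hSK, hconn, hcut⟩ hBS z hz
    have hstrong : ∀ u ∈ S, ∀ v ∈ S, D.toSimpleGraphInclusive.Adj u v → StrongAdj D u v := by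
      intro u hu v hv h
      obtain ⟨h1, h2⟩ := (SimpleGraph.fromRel_adj _ _ _).1 h
      exact ⟨h1, h2, (hSK hu).trans (SameStrong.symm (hSK hv))⟩
    have key : ∀ a ∈ S, SameBlock D z a := by
      intro a ha
      refine ⟨(hSK hz).trans (SameStrong.symm (hSK ha)), fun w hwz hwa => ?_⟩
      by_cases hw : w ∈ S
      · refine reflTransGen_mono (reflTransGen_of_reachable_induce
          (hcut w hw ⟨z, ⟨hz, Ne.symm hwz⟩⟩ ⟨a, ⟨ha, Ne.symm hwa⟩⟩)) ?_
        rintro u v ⟨h, ⟨hu, huw⟩, ⟨hv, hvw⟩⟩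
        exact ⟨hstrong u hu v hv h, huw, hvw⟩
      · refine reflTransGen_mono (reflTransGen_of_reachable_induce
          (hconn.preconnected ⟨z, hz⟩ ⟨a, ha⟩)) ?_
        rintro u v ⟨h, hu, hv⟩
        exact ⟨hstrong u hu v hv h, fun e => hw (e ▸ hu), fun e => hw (e ▸ hv)⟩
    exact ⟨key x (hBS hx), key y (hBS ⟨hsb.symm, .refl y⟩)⟩

/-- Connectivity in the negative graph. -/
def NegConn (D : Digraph V) (c : V → V → ℝ) (u v : V) : Prop :=
  Relation.ReflTransGen (negGraph D c).Adj u v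

theorem NegConn.symm {u v : V} (h : NegConn D c u v) : NegConn D c v u := by
  unfold NegConn at *
  rw [← SimpleGraph.reachable_iff_reflTransGen] at *
  exact h.symm

/-- Two different vertices of the same negative tree of a block. -/
def SameTree (D : Digraph V) (c : V → V → ℝ) (x y : V) : Prop :=
  x ≠ y ∧ NegConn D c x y ∧ SameBlock D x y

theorem sameTree_of_adj {u v : V} (h : (negGraph D c).Adj u v) : SameTree D c u v :=
  ⟨h.1, .single h, (strongAdj_of_negGraph h).sameBlock⟩

theorem Wk.strongAdj_of_negGraph {u v : V} {p : List V} (h : Wk (negGraph D c).Adj u v p) :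
    Wk (StrongAdj D) u v p :=
  h.mono fun _ _ => NearlyConservative.strongAdj_of_negGraph

end Blocks

variable {n : ℕ} {D : Digraph (Fin n)} {c : Fin n → Fin n → ℝ}

/-- `r` represents a negative tree of the block of `x` and `y`. -/
def TreeRoot (D : Digraph (Fin n)) (c : Fin n → Fin n → ℝ) (ρ : Fin n → Fin n → Fin n)
    (x y r : Fin n) : Prop :=
  InBlock D x y r ∧ ∃ z, InBlock D x y z ∧ SameTree D c r z ∧ ρ r z = r

/-- `ρ x y` is the last vertex of the negative tree of `x` and `y` in their block, and `lab x y`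
is the number of the trees of the block that come before this tree. -/
structure TreeLabels (D : Digraph (Fin n)) (c : Fin n → Fin n → ℝ) (ρ : Fin n → Fin n → Fin n)
    (lab : Fin n → Fin n → ℕ) : Prop where
  rho : ∀ x y, SameTree D c x y → InBlock D x y (ρ x y) ∧ NegConn D c (ρ x y) x ∧
    ∀ z, InBlock D x y z → NegConn D c z x → z ≤ ρ x y
  lab : ∀ x y, SameTree D c x y → lab x y = {r | r < ρ x y ∧ TreeRoot D c ρ x y r}.ncard

namespace TreeLabels

variable {ρ : Fin n → Fin n → Fin n} {lab : Fin n → Fin n → ℕ}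

/-- The root is the largest vertex of the tree within the block, so it does not depend on the pair
by which both are named. -/
theorem rho_eq (h : TreeLabels D c ρ lab) {x y u v : Fin n} (hxy : SameTree D c x y)
    (huv : SameTree D c u v) (hu : InBlock D x y u) (hv : InBlock D x y v)
    (hux : NegConn D c u x) : ρ u v = ρ x y := by
  obtain ⟨h1, h2, h3⟩ := h.rho x y hxy
  obtain ⟨h4, h5, h6⟩ := h.rho u v huv
  have hB : ∀ z, InBlock D u v z ↔ InBlock D x y z := fun z =>
    inBlock_congr hxy.1 hxy.2.2 huv.1 hu hv
  exact le_antisymm (h3 _ ((hB _).1 h4) (h5.trans hux)) (h6 _ ((hB _).2 h1) (h2.trans hux.symm))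

theorem treeRoot_congr {x y u v : Fin n} (hxy : SameTree D c x y)
    (huv : u ≠ v) (hu : InBlock D x y u) (hv : InBlock D x y v) (r : Fin n) :
    TreeRoot D c ρ u v r ↔ TreeRoot D c ρ x y r := by
  have hB : ∀ z, InBlock D u v z ↔ InBlock D x y z := fun z =>
    inBlock_congr hxy.1 hxy.2.2 huv hu hv
  simp only [TreeRoot, hB]

theorem lab_eq (h : TreeLabels D c ρ lab) {x y u v : Fin n} (hxy : SameTree D c x y)
    (huv : SameTree D c u v) (hu : InBlock D x y u) (hv : InBlock D x y v)
    (hux : NegConn D c u x) : lab u v = lab x y := by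
  rw [h.lab _ _ hxy, h.lab _ _ huv, h.rho_eq hxy huv hu hv hux]
  simp only [treeRoot_congr hxy huv.1 hu hv]

theorem treeRoot_rho (h : TreeLabels D c ρ lab) {x y : Fin n} (hxy : SameTree D c x y) :
    TreeRoot D c ρ x y (ρ x y) := by
  obtain ⟨h1, h2, -⟩ := h.rho x y hxy
  refine ⟨h1, ?_⟩
  by_cases hx : ρ x y = x
  · have hy : InBlock D x y y := ⟨hxy.2.2.symm, .refl y⟩
    have hne : ρ x y ≠ y := by rw [hx]; exact hxy.1
    have ht : SameTree D c (ρ x y) y := ⟨hne, h2.trans hxy.2.1, h1.2⟩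
    exact ⟨y, hy, ht, h.rho_eq hxy ht h1 hy h2⟩
  · have hy : InBlock D x y x := ⟨.refl x, hxy.2.2⟩
    have ht : SameTree D c (ρ x y) x := ⟨hx, h2, h1.1⟩
    exact ⟨x, hy, ht, h.rho_eq hxy ht h1 hy h2⟩

/-- The label counts the smaller roots in the block, and the root of the earlier tree is counted for
the later tree but not for itself. -/
theorem lab_lt (h : TreeLabels D c ρ lab) {x y u v : Fin n} (hxy : SameTree D c x y)
    (huv : SameTree D c u v) (hu : InBlock D x y u) (hv : InBlock D x y v)
    (hlt : ρ x y < ρ u v) : lab x y < lab u v := by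
  rw [h.lab _ _ hxy, h.lab _ _ huv]
  simp only [treeRoot_congr hxy huv.1 hu hv]
  refine Set.ncard_lt_ncard ?_
  refine ⟨fun r hr => ⟨hr.1.trans hlt, hr.2⟩, fun hsub => ?_⟩
  exact lt_irrefl _ (hsub (show ρ x y ∈ {r | r < ρ u v ∧ TreeRoot D c ρ x y r} from
    ⟨hlt, h.treeRoot_rho hxy⟩)).1

/-- Different roots in a block have different labels by `lab_lt`, and equal roots connect the two
trees. -/
theorem negConn_of_lab_eq (h : TreeLabels D c ρ lab) {x y u v : Fin n} (hxy : SameTree D c x y)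
    (huv : SameTree D c u v) (hu : InBlock D x y u) (hv : InBlock D x y v)
    (hlab : lab u v = lab x y) : NegConn D c u x := by
  obtain ⟨h1, h2, -⟩ := h.rho x y hxy
  obtain ⟨-, h5, -⟩ := h.rho u v huv
  have hB : ∀ z, InBlock D u v z ↔ InBlock D x y z := fun z =>
    inBlock_congr hxy.1 hxy.2.2 huv.1 hu hv
  rcases lt_trichotomy (ρ x y) (ρ u v) with hlt | he | hlt
  · exact absurd (h.lab_lt hxy huv hu hv hlt) (by omega)
  · exact h5.symm.trans (he ▸ h2)
  · exact absurd (h.lab_lt huv hxy ((hB _).2 ⟨.refl x, hxy.2.2⟩)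
      ((hB _).2 ⟨hxy.2.2.symm, .refl y⟩) hlt) (by omega)

theorem lab_symm (h : TreeLabels D c ρ lab) {u v : Fin n} (huv : (negGraph D c).Adj u v) :
    lab u v = lab v u :=
  (h.lab_eq (sameTree_of_adj huv) (sameTree_of_adj huv.symm)
    ⟨(sameTree_of_adj huv).2.2.symm, .refl v⟩ ⟨.refl u, (sameTree_of_adj huv).2.2⟩
    (.single huv.symm)).symm

/-- The number of labels is bounded by the number of the negative trees of a block. -/
theorem lab_lt_of_hasFewNegTrees (h : TreeLabels D c ρ lab) (hloop : ∀ v, ¬ D.Adj v v)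
    (hF : NegForest D c) {γ : ℕ} (hγ : HasFewNegTrees D c γ) {x y : Fin n}
    (hxy : SameTree D c x y) : lab x y < γ := by
  set B : Set (Fin n) := {u | InBlock D x y u} with hB
  have hle : numNegTrees D c B ≤ γ := by
    refine hγ hF.isAcyclic {u | SameStrong D u x} B ⟨x, ?_⟩ (isWeakBlock_inBlock hloop hxy.1 hxy.2.2)
    simp [sameStrong_iff]
  refine lt_of_lt_of_le ?_ hle
  -- Strict, because `ρ x y` is a root that its own label does not count.
  have h1 : lab x y < {r | TreeRoot D c ρ x y r}.ncard := by
    rw [h.lab _ _ hxy]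
    refine Set.ncard_lt_ncard ⟨fun r hr => hr.2, fun hsub => ?_⟩
    exact lt_irrefl _ (hsub (h.treeRoot_rho hxy)).1
  refine h1.trans_le ?_
  classical
  -- Roots are sent to their components in the graph induced on the block. The value outside `B` is
  -- never used.
  let f : Fin n → ((negGraph D c).induce B).ConnectedComponent := fun r =>
    if hr : r ∈ B then SimpleGraph.connectedComponentMk _ ⟨r, hr⟩ else
      SimpleGraph.connectedComponentMk _ ⟨ρ x y, (h.treeRoot_rho hxy).1⟩
  have hf : ∀ r (hr : r ∈ B), f r = SimpleGraph.connectedComponentMk _ ⟨r, hr⟩ :=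
    fun r hr => dif_pos hr
  refine Set.ncard_le_ncard_of_injOn f ?_ ?_ (Set.toFinite _)
  · rintro r ⟨hrB, z, hzB, hrz, -⟩
    rw [hf r hrB]
    obtain ⟨p, hp, hpn⟩ := exists_path_of_reflTransGen hrz.2.1
    have hreach : ((negGraph D c).induce B).Reachable ⟨r, hrB⟩ ⟨z, hzB⟩ :=
      reachable_induce (fun u v h => h) hp (fun w hw => InBlock.of_mem_path hxy.1 hrB hzB
        hp.strongAdj_of_negGraph hpn hw hxy.2.2) hrB hzB
    refine ⟨⟨r, hrB⟩, ?_, ⟨z, hzB⟩, ?_, fun e => hrz.1 (congrArg Subtype.val e)⟩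
    · exact SimpleGraph.ConnectedComponent.mem_supp_iff _ _ |>.2 rfl
    · rw [SimpleGraph.ConnectedComponent.mem_supp_iff]
      exact SimpleGraph.ConnectedComponent.sound hreach.symm
  · rintro r ⟨hrB, z, hzB, hrz, hρ⟩ r' ⟨hrB', z', hzB', hrz', hρ'⟩ he
    rw [hf r hrB, hf r' hrB'] at he
    have hreach := reflTransGen_of_reachable_induce (SimpleGraph.ConnectedComponent.exact he)
    have hconn : NegConn D c r r' := reflTransGen_mono hreach fun u v h => h.1
    have hBr : ∀ w, InBlock D r z w ↔ InBlock D x y w := fun w =>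
      inBlock_congr hxy.1 hxy.2.2 hrz.1 hrB hzB
    have := h.rho_eq hrz hrz' ((hBr _).2 hrB') ((hBr _).2 hzB') hconn.symm
    rw [← hρ, ← hρ', this]

end TreeLabels

end

section

/-! ## Correctness of the matrices -/

variable {n : ℕ} {D : Digraph (Fin n)} {c : Fin n → Fin n → ℝ}

/-- A path with both ends in a block stays there, so all its edges belong to one tree of the block
and carry one label. -/
theorem TreeLabels.labelled_path {ρ : Fin n → Fin n → Fin n} {lab : Fin n → Fin n → ℕ}
    (h : TreeLabels D c ρ lab) {s s' t : Fin n} (hs : SameTree D c s s')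
    (ht : InBlock D s s' t) {R : List (Fin n)} (hR : Wk (negGraph D c).Adj s t R)
    (hRn : R.Nodup) :
    Wk (fun u v => ((negGraph D c).Adj u v ∧ InBlock D s s' u ∧ InBlock D s s' v) ∧
      lab u v = lab s s') s t R := by
  refine ⟨hR.1, hR.2.1, ?_⟩
  have hch := hR.2.2
  rw [List.isChain_iff_forall_rel_of_append_cons_cons] at hch ⊢
  intro u v l₁ l₂ e
  have huv := hch e
  have hmem : ∀ z ∈ R, InBlock D s s' z := fun z hz =>
    InBlock.of_mem_path hs.1 ⟨.refl s, hs.2.2⟩ ht hR.strongAdj_of_negGraph hRn hz hs.2.2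
  have hu := hmem u (by rw [e]; simp)
  have hv := hmem v (by rw [e]; simp)
  refine ⟨⟨huv, hu, hv⟩, h.lab_eq hs (sameTree_of_adj huv) hu hv ?_⟩
  rw [e] at hR
  exact NegConn.symm (reflTransGen_of_wk (wk_split.1 hR).1)

/-- The properties of the matrices that the algorithm computes. -/
structure MatrixSpec (D : Digraph (Fin n)) (c : Fin n → Fin n → ℝ) (γ : ℕ)
    (d₀ rt : Fin n → Fin n → WithTop ℝ) (τ : ℕ → Fin n → Fin n → WithTop ℝ)
    (ρ : Fin n → Fin n → Fin n) (lab : Fin n → Fin n → ℕ) : Prop where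
  d₀_le : ∀ s v P, Wk (OrdArc D c) s v P → P.Nodup → d₀ s v ≤ walkWeight c P
  -- Only a walk is promised, since the arcs outside `F` may still contain negative cycles.
  d₀_sound : ∀ s v, d₀ s v ≠ ⊤ →
    ∃ p, Wk (OrdArc D c) s v p ∧ (walkWeight c p : WithTop ℝ) ≤ d₀ s v
  rt_le : ∀ s v P, Wk (negGraph D c).Adj s v P → P.Nodup →
    rt s v ≤ walkWeight (fun u v => - c v u) P
  rt_sound : ∀ s v, rt s v ≠ ⊤ → ∃ p, Wk (negGraph D c).Adj s v p ∧
    (walkWeight (fun u v => - c v u) p : WithTop ℝ) ≤ rt s v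
  -- The sign and the transposition undo those of `rt`, which belongs to the weights `-c(vu)`.
  tau : ∀ T < γ, ∀ x y (r : ℝ), SameTree D c x y → lab x y = T → rt y x = r → τ T x y = (-r : ℝ)
  tau_top : ∀ T < γ, ∀ x y, τ T x y ≠ ⊤ → SameTree D c x y ∧ lab x y = T
  tau_top' : ∀ T, γ ≤ T → ∀ x y, τ T x y = ⊤
  labels : TreeLabels D c ρ lab

namespace MatrixSpec

variable {γ : ℕ} {d₀ rt : Fin n → Fin n → WithTop ℝ} {τ : ℕ → Fin n → Fin n → WithTop ℝ}
  {ρ : Fin n → Fin n → Fin n} {lab : Fin n → Fin n → ℕ}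

theorem reverse_weight (R : List (Fin n)) :
    walkWeight (fun u v => - c v u) R.reverse = - walkWeight c R := by
  rw [walkWeight_reverse]
  exact walkWeight_neg c R

/-- With the weights `c` every edge of `F` is a negative 2-cycle, so shortest walks are useless. For
`-c(vu)` no cycle of a forest is negative, and loop erasure makes the computed value the weight of a
path. All paths of the forest between two vertices have equal weight, by
`walkWeight_le_of_negative_path` inside `F`. -/
theorem rt_eq (h : MatrixSpec D c γ d₀ rt τ ρ lab) (hF : NegForest D c) {x y : Fin n}
    {R : List (Fin n)} (hR : Wk (negGraph D c).Adj x y R) (hRn : R.Nodup) :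
    rt y x = (- walkWeight c R : ℝ) := by
  have hrev := hR.reverse (E' := (negGraph D c).Adj) fun u v h => h.symm
  have h1 := h.rt_le y x R.reverse hrev (by simpa using hRn)
  rw [reverse_weight] at h1
  refine le_antisymm h1 ?_
  obtain ⟨p, hp, hpw⟩ := h.rt_sound y x (by
    intro h2
    rw [h2] at h1
    exact absurd (top_le_iff.1 h1) (WithTop.coe_ne_top))
  obtain ⟨q, hq, hqn, hqw⟩ := exists_path_of_walk hF.nonnegCycles hp
  refine le_trans ?_ hpw
  have hqr := hq.reverse (E' := (negGraph D c).Adj) fun u v h => h.symm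
  have h3 := walkWeight_le_of_negative_path hF.nonnegLongCycles
    (fun u v h => ⟨h, h.symm, h.2.2.2.le⟩) hqr (by simpa using hqn) hR hRn
  have h4 := reverse_weight (c := c) q.reverse
  rw [List.reverse_reverse] at h4
  norm_cast
  linarith

theorem realized_tau (h : MatrixSpec D c γ d₀ rt τ ρ lab) (hF : NegForest D c) (T : ℕ)
    (x y : Fin n) : Realized D c lab [T] x y (τ T x y) := by
  by_cases hx : τ T x y = ⊤
  · exact fun hx' => absurd hx hx'
  have hT : T < γ := by
    by_contra hT
    exact hx (h.tau_top' T (not_lt.1 hT) x y)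
  obtain ⟨hxy, hl⟩ := h.tau_top T hT x y hx
  obtain ⟨R, hR, hRn⟩ := exists_path_of_reflTransGen hxy.2.1
  have hrt := h.rt_eq hF hR hRn
  have htau := h.tau T hT x y _ hxy hl hrt
  refine realized_of_negative_path (R := R) ?_ hRn ?_
  · refine (h.labels.labelled_path hxy ⟨hxy.2.2.symm, .refl y⟩ hR hRn).mono ?_
    rintro u v ⟨⟨h1, -⟩, h2⟩
    exact ⟨h1, h2.trans hl⟩
  · rw [htau]
    simp

theorem realized_d₀ (h : MatrixSpec D c γ d₀ rt τ ρ lab) (s v : Fin n) :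
    Realized D c lab [] s v (d₀ s v) := realized_of_walk (h.d₀_sound s v)

theorem realized_seq (h : MatrixSpec D c γ d₀ rt τ ρ lab) (hF : NegForest D c) {l : List ℕ}
    (hl : l.Nodup) (s v : Fin n) : Realized D c lab l s v (evalSeq d₀ τ d₀ l s v) :=
  realized_evalSeq (fun _ _ huv => h.labels.lab_symm huv) h.realized_d₀ (h.realized_tau hF) l hl s v

/-- The data of the block of two vertices. -/
def blockData (h : MatrixSpec D c γ d₀ rt τ ρ lab) (hF : NegForest D c) {x y : Fin n}
    (hlab : ∀ u v, SameTree D c u v → lab u v < γ) (hxy : x ≠ y) : BlockData n where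
  c := c
  E u v := D.Adj u v ∧ InBlock D x y u ∧ InBlock D x y v
  F u v := (negGraph D c).Adj u v ∧ InBlock D x y u ∧ InBlock D x y v
  lab := lab
  d₀ := d₀
  τ := τ
  F_ne u v h := h.1.1
  F_symm u v h := ⟨h.1.symm, h.2.2, h.2.1⟩
  F_le u v h := ⟨h.1.2.1, h.2⟩
  F_neg u v h := h.1.2.2.2
  lab_symm u v huv := h.labels.lab_symm huv.1
  lab_conn a b a' b' hab hab' hl := by
    have hpair : ∀ {u v : Fin n}, InBlock D x y u → InBlock D x y v → SameBlock D u v :=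
      fun hu hv => hu.sameBlock hxy hv
    have ha' : InBlock D a b a' := ⟨hpair hab'.2.1 hab.2.1, hpair hab'.2.1 hab.2.2⟩
    have hb' : InBlock D a b b' := ⟨hpair hab'.2.2 hab.2.1, hpair hab'.2.2 hab.2.2⟩
    have ht := sameTree_of_adj hab.1
    have hconn := h.labels.negConn_of_lab_eq ht (sameTree_of_adj hab'.1) ha' hb' hl.symm
    obtain ⟨R, hR, hRn⟩ := exists_path_of_reflTransGen hconn.symm
    refine reflTransGen_of_wk ((h.labels.labelled_path ht ha' hR hRn).mono ?_)
    rintro u v ⟨⟨h1, h2, h3⟩, h4⟩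
    have hx : InBlock D a b x := ⟨hab.2.1.1.symm, hab.2.2.1.symm⟩
    have hy : InBlock D a b y := ⟨hab.2.1.2.symm, hab.2.2.2.symm⟩
    exact ⟨⟨h1, ⟨h2.sameBlock ht.1 hx, h2.sameBlock ht.1 hy⟩,
      ⟨h3.sameBlock ht.1 hx, h3.sameBlock ht.1 hy⟩⟩, h4⟩
  tau_eq T s t R hst hR hRn := by
    obtain ⟨R', rfl⟩ := hR.exists_cons
    cases R' with
    | nil => exact absurd (wk_singleton.1 hR).2 hst
    | cons s' R' =>
      obtain ⟨-, ⟨hss', rfl⟩, -⟩ := wk_cons_cons.1 hR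
      have hB := hR.forall_mem (U := {z | InBlock D x y z}) hss'.2.1 fun u v h _ => h.1.2.2
      have ht : InBlock D x y t := hB t hR.last_mem
      have hR' : Wk (negGraph D c).Adj s t (s :: s' :: R') := hR.mono fun u v h => h.1.1
      have hT : SameTree D c s t := ⟨hst, reflTransGen_of_wk hR', hss'.2.1.sameBlock hxy ht⟩
      have hl : lab s t = lab s s' := h.labels.lab_eq (sameTree_of_adj hss'.1) hT
        ⟨.refl s, hss'.2.1.sameBlock hxy hss'.2.2⟩
        ⟨ht.sameBlock hxy hss'.2.1, ht.sameBlock hxy hss'.2.2⟩ .refl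
      rw [h.tau _ (hlab _ _ (sameTree_of_adj hss'.1)) s t _ hT hl (h.rt_eq hF hR' hRn), neg_neg]
  d₀_le s v P hP hPn := h.d₀_le s v P (hP.mono (by
    rintro u v ⟨⟨h1, h2⟩, h3⟩
    exact ⟨h1, fun h => h3 ⟨h, h2⟩⟩)) hPn

theorem d₀_self_le (h : MatrixSpec D c γ d₀ rt τ ρ lab) (s : Fin n) : d₀ s s ≤ 0 := by
  simpa [walkWeight] using h.d₀_le s s [s] (.single s) (by simp)

/-- The tests of the algorithm succeed if and only if there is no negative cycle with more than
two arcs. -/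
theorem tests_iff (h : MatrixSpec D c γ d₀ rt τ ρ lab) (hloop : ∀ v, ¬ D.Adj v v)
    (hF : NegForest D c) (hγ : HasFewNegTrees D c γ) :
    NonnegLongCycles D.Adj c ↔ (∀ x y, 0 ≤ d₀ x y + d₀ y x) ∧
      ∀ (l : List ℕ) (T : ℕ), l.Nodup → (∀ i ∈ l, i < γ) → T < γ → T ∉ l → ∀ x y,
        0 ≤ evalSeq d₀ τ d₀ l x y + τ T y x := by
  have hsymm : ∀ u v, (negGraph D c).Adj u v → lab u v = lab v u :=
    fun _ _ huv => h.labels.lab_symm huv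
  constructor
  -- Each tested sum is realized by a closed walk; `T ∉ l` keeps the labels of the two parts
  -- disjoint.
  · intro hD
    refine ⟨fun x y => ?_, fun l T hl _ _ hT x y => ?_⟩
    · exact (Realized.add hsymm (by simp) (h.realized_d₀ x y) (h.realized_d₀ y x)).nonneg hloop hD
    · refine (Realized.add hsymm ?_ (h.realized_seq hF hl x y) (h.realized_tau hF T y x)).nonneg
        hloop hD
      intro T' hT' hTT'
      rw [List.mem_singleton.1 hTT'] at hT'
      exact hT hT'
  · rintro ⟨h0, htest⟩
    refine nonnegLongCycles_of_blocks hloop fun x y hxy hsb => ?_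
    have hlab : ∀ u v, SameTree D c u v → lab u v < γ := fun u v huv =>
      h.labels.lab_lt_of_hasFewNegTrees hloop hF hγ huv
    refine (h.blockData hF hlab hxy).nonnegLongCycles_of_tests ?_ γ ?_ htest ?_
    · intro w a b ha hb hab hconn
      refine hF w a b ha.1 hb.1 hab (reflTransGen_mono hconn ?_)
      rintro u v ⟨h1, h2⟩
      exact ⟨h1.1, h2⟩
    · intro u v huv
      exact hlab u v (sameTree_of_adj huv.1)
    · intro v l hnd hch hl
      have hch' : (v :: (l ++ [v])).IsChain (OrdArc D c) := hch.imp (by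
        rintro u v ⟨⟨h1, h2⟩, h3⟩
        exact ⟨h1, fun h => h3 ⟨h, h2⟩⟩)
      -- A cycle of arcs outside `F` is cut before its last arc `zv` into two paths, which the test
      -- on `d₀` bounds.
      rcases List.eq_nil_or_concat' l with rfl | ⟨m, z, rfl⟩
      · simp at hl
      · have e : v :: (m ++ [z] ++ [v]) = (v :: m) ++ z :: [v] := by simp
        have hw : Wk (OrdArc D c) v v (v :: (m ++ [z] ++ [v])) := ⟨rfl, by
          rw [← List.cons_append, List.getLast?_append]; simp, hch'⟩
        rw [e] at hw
        obtain ⟨h1, h2⟩ := wk_split.1 hw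
        have h3 := h.d₀_le v z _ h1 hnd
        have h4 := h.d₀_le z v _ h2 (by
          simp only [List.nodup_cons, List.mem_append, List.mem_singleton] at hnd ⊢
          simp
          rintro rfl
          exact hnd.1 (Or.inr rfl))
        have h5 := (h0 v z).trans (add_le_add h3 h4)
        show 0 ≤ walkWeight c _
        rw [e, walkWeight_split]
        exact_mod_cast h5

/-- The entries for two vertices of the same block are at most the lengths of the paths. -/
theorem exists_seq_le (h : MatrixSpec D c γ d₀ rt τ ρ lab) (hloop : ∀ v, ¬ D.Adj v v)
    (hγ : HasFewNegTrees D c γ) (hD : NonnegLongCycles D.Adj c) {s t : Fin n}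
    (hst : SameBlock D s t) {P : List (Fin n)} (hP : Wk D.Adj s t P) (hPn : P.Nodup) :
    ∃ l : List ℕ, l.Nodup ∧ (∀ i ∈ l, i < γ) ∧
      minPlus (evalSeq d₀ τ d₀ l) d₀ s t ≤ walkWeight c P := by
  have hF := negForest_of_nonnegLongCycles hD
  suffices ∃ l : List ℕ, l.Nodup ∧ (∀ i ∈ l, i < γ) ∧ evalSeq d₀ τ d₀ l s t ≤ walkWeight c P by
    obtain ⟨l, h1, h2, h3⟩ := this
    -- The program collects results by relaxing with a product, whence the superfluous factor `d₀`;
    -- it is harmless because `d₀ t t ≤ 0`.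
    refine ⟨l, h1, h2, (minPlus_le _ _ s t t).trans ?_⟩
    simpa using add_le_add h3 (h.d₀_self_le t)
  by_cases hne : s = t
  · subst hne
    rw [wk_self hP hPn]
    exact ⟨[], by simp, by simp, by simpa [evalSeq, walkWeight] using h.d₀_self_le s⟩
  · have hlab : ∀ u v, SameTree D c u v → lab u v < γ := fun u v huv =>
      h.labels.lab_lt_of_hasFewNegTrees hloop hF hγ huv
    have hs : InBlock D s t s := ⟨.refl s, hst⟩
    have ht : InBlock D s t t := ⟨hst.symm, .refl t⟩
    have hP' := hP.strongAdj hloop hst.1.2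
    have hmem : ∀ z ∈ P, InBlock D s t z := fun z hz => hs.of_mem_path hne ht hP' hPn hz hst
    have hE : ∀ u v, (D.Adj u v ∧ InBlock D s t u ∧ InBlock D s t v) →
        (h.blockData hF hlab hne).ES (Finset.range γ) u v := fun u v huv =>
      ⟨huv, fun hF => Finset.mem_range.2 (hlab _ _ (sameTree_of_adj hF.1))⟩
    obtain ⟨l, h1, h2, h3⟩ := (h.blockData hF hlab hne).exists_evalSeq_le (Finset.range γ)
      (hD.mono fun u v h => h.1.1) (P := P) (s := s) (v := t) (by
        refine ⟨hP.1, hP.2.1, ?_⟩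
        have hch := hP.2.2
        rw [List.isChain_iff_forall_rel_of_append_cons_cons] at hch ⊢
        intro u v l₁ l₂ e
        exact hE u v ⟨hch e, hmem u (by rw [e]; simp), hmem v (by rw [e]; simp)⟩) hPn
    exact ⟨l, h1, fun i hi => Finset.mem_range.1 (h2 i hi), h3⟩

/-- The finite entries belong to paths. -/
theorem exists_path_le (h : MatrixSpec D c γ d₀ rt τ ρ lab) (hloop : ∀ v, ¬ D.Adj v v)
    (hD : NonnegLongCycles D.Adj c) {l : List ℕ} (hl : l.Nodup) {s t : Fin n}
    (hx : minPlus (evalSeq d₀ τ d₀ l) d₀ s t ≠ ⊤) : ∃ p, Wk D.Adj s t p ∧ p.Nodup ∧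
      (walkWeight c p : WithTop ℝ) ≤ minPlus (evalSeq d₀ τ d₀ l) d₀ s t := by
  have hF := negForest_of_nonnegLongCycles hD
  obtain ⟨j, hj⟩ := exists_minPlus_eq (evalSeq d₀ τ d₀ l) d₀ s t
  rw [hj] at hx ⊢
  exact (Realized.add (fun _ _ huv => h.labels.lab_symm huv) (by simp) (h.realized_seq hF hl s j)
    (h.realized_d₀ j t)).exists_path hloop hD hx

end MatrixSpec

end

section

/-! ## The preparation of the matrices -/

namespace Cmd

/-- Upper bounds hold for paths, and finite entries are attained only by walks. Therefore nothing
need be assumed about the cycles of `E`. -/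
theorem floydWarshall_walks {n : ℕ} {a : ℕ} {m : Memory} (hm : m.nat 0 0 0 = n)
    {E : Fin n → Fin n → Prop} {w : Fin n → Fin n → ℝ} (hw : ∀ i, w i i = 0)
    (h : ∀ i j, (i = j ∨ E i j → m.mat n a i j = w i j) ∧ (¬ (i = j ∨ E i j) → m.mat n a i j = ⊤)) :
    (∀ s t l, Wk E s t l → l.Nodup → ((floydWarshall a).exec m).mat n a s t ≤ walkWeight w l) ∧
    (∀ s t, ((floydWarshall a).exec m).mat n a s t ≠ ⊤ → ∃ l, Wk E s t l ∧
      (walkWeight w l : WithTop ℝ) ≤ ((floydWarshall a).exec m).mat n a s t) := by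
  constructor
  · intro s t l hl hn
    refine (floydWarshall_le hm (fun i => ?_) hl.1 hl.2.1 hn).trans ?_
    · rw [(h i i).1 (Or.inl rfl), hw]
      rfl
    · have hch := hl.2.2
      clear hl hn
      induction l with
      | nil => simp [pathSum, walkWeight]
      | cons x l ih =>
        cases l with
        | nil => simp [pathSum, walkWeight]
        | cons y l =>
          rw [List.isChain_cons_cons] at hch
          simp only [pathSum, walkWeight, WithTop.coe_add]
          exact add_le_add ((h x y).1 (Or.inr hch.1)).le (ih hch.2)
  · refine floydWarshall_sound hm (fun s t x => x ≠ ⊤ → ∃ l, Wk E s t l ∧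
      (walkWeight w l : WithTop ℝ) ≤ x) ?_ ?_
    · intro i j k x y hx hy hxy
      rw [Ne, WithTop.add_eq_top, not_or] at hxy
      obtain ⟨l, hl, hlx⟩ := hx hxy.1
      obtain ⟨l', hl', hly⟩ := hy hxy.2
      have := hl.append (c := w) hl'
      refine ⟨_, this.1, ?_⟩
      rw [this.2, WithTop.coe_add]
      exact add_le_add hlx hly
    · intro i k hik
      by_cases hE : i = k ∨ E i k
      · rw [(h i k).1 hE]
        rcases hE with rfl | hE
        · exact ⟨[i], .single i, by simp [walkWeight, hw]⟩
        · exact ⟨[i, k], by simp [Wk, hE], by simp [walkWeight]⟩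
      · exact absurd ((h i k).2 hE) hik

theorem floydWarshall_ne_top {n : ℕ} {a : ℕ} {m : Memory} (hm : m.nat 0 0 0 = n)
    {E : Fin n → Fin n → Prop} {w : Fin n → Fin n → ℝ} (hw : ∀ i, w i i = 0)
    (h : ∀ i j, (i = j ∨ E i j → m.mat n a i j = w i j) ∧ (¬ (i = j ∨ E i j) → m.mat n a i j = ⊤))
    (s t : Fin n) :
    ((floydWarshall a).exec m).mat n a s t ≠ ⊤ ↔ Relation.ReflTransGen E s t := by
  obtain ⟨h1, h2⟩ := floydWarshall_walks hm hw h
  constructor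
  · intro hs
    obtain ⟨l, hl, -⟩ := h2 s t hs
    exact reflTransGen_of_wk hl
  · intro hs
    obtain ⟨p, hp, hpn⟩ := exists_path_of_reflTransGen hs
    intro htop
    have := h1 s t p hp hpn
    rw [htop] at this
    exact absurd (top_le_iff.1 this) WithTop.coe_ne_top

attribute [simp] fill_writesNat fill_writesReal relax_writesNat relax_writesReal

@[simp] theorem floydWarshall_writesNat {a b : ℕ} :
    (floydWarshall b).WritesNat a ↔ a = 8 ∨ a = 4 ∨ a = 6 ∨ a = 2 * b + 1 := relax_writesNat

@[simp] theorem floydWarshall_writesReal {a b : ℕ} : (floydWarshall b).WritesReal a ↔ a = b :=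
  relax_writesReal

/-- Set the cell `(0, 0)` of the array `a` to `1` if `b` holds for some indices. -/
def flagScan (a : ℕ) (b : Test) : Cmd :=
  for2 4 6 (ite b (setNat a (.const 0) (.const 0) (.const 1)) skip)

@[simp] theorem flagScan_writesNat {a b : ℕ} {t : Test} :
    (flagScan b t).WritesNat a ↔ a = 4 ∨ a = 6 ∨ a = b := by
  simp [flagScan, WritesNat]

@[simp] theorem flagScan_writesReal {a b : ℕ} {t : Test} : ¬ (flagScan b t).WritesReal a := by
  simp [flagScan, WritesReal]

theorem nat_flagScan {a : ℕ} (ha4 : 4 ≠ a) (ha6 : 6 ≠ a) (ha0 : 0 ≠ a) {b : Test} {m : Memory} {n : ℕ}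
    (hm : m.nat 0 0 0 = n) {β : Fin n → Fin n → Prop}
    (h : ∀ m' (i j : Fin n), (flagScan a b).SameOff m m' → m'.nat 4 0 0 = i → m'.nat 6 0 0 = j →
      (b.holds m' ↔ β i j)) :
    ((flagScan a b).exec m).nat a 0 0 ≠ 0 ↔ m.nat a 0 0 ≠ 0 ∨ ∃ i j, β i j := by
  have key := for2_inv (v := 4) (w := 6)
    (P := (ite b (setNat a (.const 0) (.const 0) (.const 1)) skip)) hm
    (by simp [WritesNat, ha4]) (by simp [WritesNat, ha0])
    (by decide) (by decide) (by decide)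
    (fun x y m' => m'.nat a 0 0 ≠ 0 ↔ m.nat a 0 0 ≠ 0 ∨
      ∃ i j : Fin n, ((i : ℕ) < x ∨ ((i : ℕ) = x ∧ (j : ℕ) < y)) ∧ β i j)
    (by
      intro i j m' v x hv hJ
      have : a ≠ v := by rcases hv with rfl | rfl <;> omega
      simpa [Memory.writeNat, this] using hJ)
    (by simp)
    (by
      intro x m' hx hJ
      rw [hJ]
      refine or_congr_right (exists_congr fun i => exists_congr fun j => and_congr_left fun _ => ?_)
      have := j.2
      omega)
    (by
      intro x y m' hx hy h4 h6 hs hJ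
      have hb := h m' ⟨x, hx⟩ ⟨y, hy⟩ hs h4 h6
      by_cases hβ : β ⟨x, hx⟩ ⟨y, hy⟩
      · simp only [exec, hb.2 hβ, if_true, NatExpr.val]
        simp only [Memory.writeNat, and_self, if_true]
        exact iff_of_true one_ne_zero (Or.inr ⟨⟨x, hx⟩, ⟨y, hy⟩, Or.inr ⟨rfl, Nat.lt_succ_self y⟩, hβ⟩)
      · simp only [exec, mt hb.1 hβ, if_false]
        rw [hJ]
        refine or_congr_right (exists_congr fun i => exists_congr fun j => and_congr_left fun hij => ?_)
        have : ¬ ((i : ℕ) = x ∧ (j : ℕ) = y) := by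
          rintro ⟨rfl, rfl⟩
          exact hβ hij
        omega)
  rw [flagScan, key]
  refine or_congr_right (exists_congr fun i => exists_congr fun j => ?_)
  simp

end Cmd

/-! ### Tests -/

/-- Disjunction of tests. -/
def Test.or (a b : Test) : Test := .not (.and (.not a) (.not b))

@[simp] theorem Test.or_holds {a b : Test} {m : Memory} : (a.or b).holds m ↔ a.holds m ∨ b.holds m := by
  simp only [Test.or, Test.holds]
  tauto

/-- The test that `ij` is an arc. -/
def adjTest (i j : NatExpr) : Test := Cmd.finiteTest 0 i j

/-- The test that `ij` is a negative edge. -/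
def negTest (i j : NatExpr) : Test :=
  .and (adjTest i j) (.and (adjTest j i)
    (.realLt (.add (.read 0 i j) (.read 0 j i)) .zero))

/-- The test that `i` and `j` lie in the same strong component. -/
def strongTest (i j : NatExpr) : Test := .and (Cmd.finiteTest 2 i j) (Cmd.finiteTest 2 j i)

/-- The test that `i` and `j` lie in the same block. -/
def blockTest (i j : NatExpr) : Test := .and (strongTest i j) (.natEq (.read 24 i j) (.const 0))

variable {n : ℕ} {D : Digraph (Fin n)} {c : Fin n → Fin n → ℝ} {m m' : Memory}

/-! ### What the memory holds after each stage -/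

/-- The memory holds the input. -/
structure HasInput (D : Digraph (Fin n)) (c : Fin n → Fin n → ℝ) (m : Memory) : Prop where
  size : m.nat 0 0 0 = n
  adj : ∀ u v : Fin n, m.nat 1 u v ≠ 0 ↔ D.Adj u v
  weight : ∀ u v : Fin n, D.Adj u v → m.real 0 u v = c u v
  zero : ∀ u v : Fin n, ¬ D.Adj u v → m.real 0 u v = 0

theorem hasInput_inputMemory (D : Digraph (Fin n)) (c : Fin n → Fin n → ℝ) :
    HasInput D c (inputMemory D c) where
  size := by simp [inputMemory]
  adj u v := by
    simp only [inputMemory, one_ne_zero, false_and, if_false, true_and]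
    constructor
    · intro h
      by_contra hadj
      refine h (if_neg ?_)
      rintro ⟨-, u', v', h1, h2, h3⟩
      rw [Fin.ext h2, Fin.ext h3] at h1
      exact hadj h1
    · intro h
      rw [if_pos ⟨rfl, u, v, h, rfl, rfl⟩]
      exact one_ne_zero
  weight u v h := by simp [inputMemory, h]
  zero u v h := by simp [inputMemory, h]

theorem HasInput.congr (h : HasInput D c m) (h0 : m'.nat 0 = m.nat 0) (h1 : m'.nat 1 = m.nat 1)
    (h2 : m'.real 0 = m.real 0) : HasInput D c m' where
  size := by rw [h0, h.size]
  adj := by rw [h1]; exact h.adj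
  weight := by rw [h2]; exact h.weight
  zero := by rw [h2]; exact h.zero

theorem HasInput.sameOff (h : HasInput D c m) {P : Cmd} (hs : P.SameOff m m')
    (hN : ∀ a ∈ [0, 1], ¬ P.WritesNat a) (hR : ¬ P.WritesReal 0) : HasInput D c m' :=
  h.congr (hs.1 _ (hN 0 (by simp))) (hs.1 _ (hN 1 (by simp))) (hs.2 _ hR)

theorem adjTest_holds (h : HasInput D c m) {i j : NatExpr} {u v : Fin n} (hi : i.val m = u)
    (hj : j.val m = v) : (adjTest i j).holds m ↔ D.Adj u v := by
  rw [adjTest, Cmd.finiteTest_holds, Memory.wt_ne_top, hi, hj]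
  exact h.adj u v

theorem negTest_holds (h : HasInput D c m) (hloop : ∀ v, ¬ D.Adj v v) {i j : NatExpr} {u v : Fin n}
    (hi : i.val m = u) (hj : j.val m = v) : (negTest i j).holds m ↔ (negGraph D c).Adj u v := by
  simp only [negTest, Test.holds, adjTest_holds h hi hj, adjTest_holds h hj hi, RealExpr.val, hi, hj]
  constructor
  · rintro ⟨h1, h2, h3⟩
    rw [h.weight _ _ h1, h.weight _ _ h2] at h3
    exact ⟨fun e => hloop v (e ▸ h1), h1, h2, h3⟩
  · rintro ⟨-, h1, h2, h3⟩
    refine ⟨h1, h2, ?_⟩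
    rw [h.weight _ _ h1, h.weight _ _ h2]
    exact h3

/-- The memory holds the input and the matrix of reachability. -/
structure HasStrong (D : Digraph (Fin n)) (c : Fin n → Fin n → ℝ) (m : Memory) : Prop
    extends HasInput D c m where
  reach : ∀ u v : Fin n, m.nat 5 u v ≠ 0 ↔ Relation.ReflTransGen D.Adj u v

theorem HasStrong.congr (h : HasStrong D c m) (h0 : m'.nat 0 = m.nat 0) (h1 : m'.nat 1 = m.nat 1)
    (h2 : m'.real 0 = m.real 0) (h5 : m'.nat 5 = m.nat 5) : HasStrong D c m' where
  toHasInput := h.toHasInput.congr h0 h1 h2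
  reach := by rw [h5]; exact h.reach

theorem HasStrong.sameOff (h : HasStrong D c m) {P : Cmd} (hs : P.SameOff m m')
    (hN : ∀ a ∈ [0, 1, 5], ¬ P.WritesNat a) (hR : ¬ P.WritesReal 0) : HasStrong D c m' :=
  h.congr (hs.1 _ (hN 0 (by simp))) (hs.1 _ (hN 1 (by simp))) (hs.2 _ hR) (hs.1 _ (hN 5 (by simp)))

theorem strongTest_holds (h : HasStrong D c m) {i j : NatExpr} {u v : Fin n} (hi : i.val m = u)
    (hj : j.val m = v) : (strongTest i j).holds m ↔ SameStrong D u v := by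
  simp only [strongTest, Test.holds, Cmd.finiteTest_holds, Memory.wt_ne_top, hi, hj]
  exact and_congr (h.reach u v) (h.reach v u)

/-- The memory holds the input, the matrix of reachability and the matrix of separating
vertices. -/
structure HasBlocks (D : Digraph (Fin n)) (c : Fin n → Fin n → ℝ) (m : Memory) : Prop
    extends HasStrong D c m where
  -- Pairs in different strong components are never marked either, so `blockTest` asks for the same
  -- component as well.
  sep_zero : ∀ u v : Fin n, SameStrong D u v → (m.nat 24 u v = 0 ↔ SameBlock D u v)
  -- A separator `z` is stored as `z + 1`, so that `0` can stand for its absence.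
  sep_succ : ∀ (u v : Fin n) (w : ℕ), m.nat 24 u v = w + 1 → ∃ z : Fin n, (z : ℕ) = w ∧
    z ≠ u ∧ z ≠ v ∧ SameStrong D u v ∧ ¬ ConnWithout D z u v

theorem HasBlocks.congr (h : HasBlocks D c m) (h0 : m'.nat 0 = m.nat 0) (h1 : m'.nat 1 = m.nat 1)
    (h2 : m'.real 0 = m.real 0) (h5 : m'.nat 5 = m.nat 5) (h24 : m'.nat 24 = m.nat 24) :
    HasBlocks D c m' where
  toHasStrong := h.toHasStrong.congr h0 h1 h2 h5
  sep_zero := by rw [h24]; exact h.sep_zero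
  sep_succ := by rw [h24]; exact h.sep_succ

theorem HasBlocks.sameOff (h : HasBlocks D c m) {P : Cmd} (hs : P.SameOff m m')
    (hN : ∀ a ∈ [0, 1, 5, 24], ¬ P.WritesNat a) (hR : ¬ P.WritesReal 0) : HasBlocks D c m' :=
  h.congr (hs.1 _ (hN 0 (by simp))) (hs.1 _ (hN 1 (by simp))) (hs.2 _ hR) (hs.1 _ (hN 5 (by simp))) (hs.1 _ (hN 24 (by simp)))

theorem blockTest_holds (h : HasBlocks D c m) {i j : NatExpr} {u v : Fin n} (hi : i.val m = u)
    (hj : j.val m = v) : (blockTest i j).holds m ↔ SameBlock D u v := by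
  simp only [blockTest, Test.holds, strongTest_holds h.toHasStrong hi hj, NatExpr.val, hi, hj]
  constructor
  · rintro ⟨h1, h2⟩
    exact (h.sep_zero u v h1).1 h2
  · intro h1
    exact ⟨h1.1, (h.sep_zero u v h1.1).2 h1⟩

end

section

namespace Cmd

/-! ## Closures and marks -/

/-- Compute the distances for the arcs that `b` selects, with the weights `e`. -/
def closure (a : ℕ) (b : Test) (e : RealExpr) : Cmd :=
  seq (fill a (.or (.natEq rowIdx colIdx) b) e) (floydWarshall a)

@[simp] theorem closure_writesNat {a x : ℕ} {b : Test} {e : RealExpr} :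
    (closure a b e).WritesNat x ↔ x = 8 ∨ x = 4 ∨ x = 6 ∨ x = 2 * a + 1 := by
  simp only [closure, WritesNat, fill_writesNat, floydWarshall_writesNat]
  tauto

@[simp] theorem closure_writesReal {a x : ℕ} {b : Test} {e : RealExpr} :
    (closure a b e).WritesReal x ↔ x = a := by
  simp [closure, WritesReal]

section Closure

variable {n a : ℕ} {b : Test} {e : RealExpr} {m : Memory} {E : Fin n → Fin n → Prop}
  {w : Fin n → Fin n → ℝ}

theorem closure_fill (hm : m.nat 0 0 0 = n)
    (h : ∀ m' (i j : Fin n), (closure a b e).SameOff m m' → m'.nat 4 0 0 = i → m'.nat 6 0 0 = j →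
      (i ≠ j → (b.holds m' ↔ E i j)) ∧ (i = j ∨ E i j → e.val m' = w i j)) (i j : Fin n) :
    (i = j ∨ E i j →
      ((fill a (.or (.natEq rowIdx colIdx) b) e).exec m).mat n a i j = w i j) ∧
    (¬ (i = j ∨ E i j) → ((fill a (.or (.natEq rowIdx colIdx) b) e).exec m).mat n a i j = ⊤) := by
  rw [mat_fill hm (β := fun i j => i = j ∨ E i j) (ε := w) ?_ i j]
  · exact ⟨fun h => if_pos h, fun h => if_neg h⟩
  · intro m' i j hs h4 h6
    obtain ⟨h1, h2⟩ := h m' i j ((SameOff.refl _ m).trans hs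
      (by simp only [fill_writesNat, closure_writesNat]; tauto)
      (by simp only [fill_writesReal, closure_writesReal]; tauto)) h4 h6
    refine ⟨?_, h2⟩
    rw [Test.or_holds]
    simp only [Test.holds, NatExpr.val_var, h4, h6]
    by_cases hij : i = j
    · simp [hij]
    · rw [h1 hij, Fin.ext_iff]

theorem closure_walks (hm : m.nat 0 0 0 = n) (hw : ∀ i, w i i = 0)
    (h : ∀ m' (i j : Fin n), (closure a b e).SameOff m m' → m'.nat 4 0 0 = i → m'.nat 6 0 0 = j →
      (i ≠ j → (b.holds m' ↔ E i j)) ∧ (i = j ∨ E i j → e.val m' = w i j)) :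
    (∀ s t l, Wk E s t l → l.Nodup → ((closure a b e).exec m).mat n a s t ≤ walkWeight w l) ∧
    (∀ s t, ((closure a b e).exec m).mat n a s t ≠ ⊤ → ∃ l, Wk E s t l ∧
      (walkWeight w l : WithTop ℝ) ≤ ((closure a b e).exec m).mat n a s t) :=
  floydWarshall_walks (by rw [exec_nat_of_not_writes (by simp), hm]) hw (closure_fill hm h)

theorem closure_ne_top (hm : m.nat 0 0 0 = n) (hw : ∀ i, w i i = 0)
    (h : ∀ m' (i j : Fin n), (closure a b e).SameOff m m' → m'.nat 4 0 0 = i → m'.nat 6 0 0 = j →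
      (i ≠ j → (b.holds m' ↔ E i j)) ∧ (i = j ∨ E i j → e.val m' = w i j)) (s t : Fin n) :
    ((closure a b e).exec m).mat n a s t ≠ ⊤ ↔ Relation.ReflTransGen E s t :=
  floydWarshall_ne_top (by rw [exec_nat_of_not_writes (by simp), hm]) hw (closure_fill hm h) s t

end Closure

/-- Write `e` into the entries of the natural-number array `a` that `b` selects. -/
def mark (a : ℕ) (b : Test) (e : NatExpr) : Cmd :=
  for2 4 6 (ite b (setNat a rowIdx colIdx e) skip)

@[simp] theorem mark_writesNat {a x : ℕ} {b : Test} {e : NatExpr} :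
    (mark a b e).WritesNat x ↔ x = 4 ∨ x = 6 ∨ x = a := by
  simp [mark, WritesNat]

@[simp] theorem mark_writesReal {a x : ℕ} {b : Test} {e : NatExpr} :
    ¬ (mark a b e).WritesReal x := by
  simp [mark, WritesReal]

-- Each cell is visited once and still holds its old value when `b` and `e` are evaluated. Hence `e`
-- may read the cell it overwrites, as the counter of the labels does.
open Classical in
theorem nat_mark {a : ℕ} (ha4 : 4 ≠ a) (ha6 : 6 ≠ a) (ha0 : 0 ≠ a) {b : Test} {e : NatExpr}
    {m : Memory} {n : ℕ} (hm : m.nat 0 0 0 = n) {β : Fin n → Fin n → Prop} {ε : Fin n → Fin n → ℕ}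
    (h : ∀ m' (i j : Fin n), (mark a b e).SameOff m m' → m'.nat 4 0 0 = i → m'.nat 6 0 0 = j →
      m'.nat a i j = m.nat a i j → (b.holds m' ↔ β i j) ∧ (β i j → e.val m' = ε i j))
    (u v : Fin n) :
    ((mark a b e).exec m).nat a u v = if β u v then ε u v else m.nat a u v := by
  have key := for2_inv (v := 4) (w := 6) (P := (ite b (setNat a rowIdx colIdx e) skip)) hm
    (by simp [WritesNat, ha4]) (by simp [WritesNat, ha0])
    (by decide) (by decide) (by decide)
    (fun x y m' => ∀ u v : Fin n, m'.nat a u v =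
      if ((u : ℕ) < x ∨ ((u : ℕ) = x ∧ (v : ℕ) < y)) ∧ β u v then ε u v else m.nat a u v)
    (by
      intro i j m' v x hv hJ
      have : a ≠ v := by rcases hv with rfl | rfl <;> omega
      simpa [Memory.writeNat, this] using hJ)
    (by simp)
    (by
      intro x m' hx hJ u v
      rw [hJ]
      refine if_congr (and_congr_left fun _ => ?_) rfl rfl
      have := v.2
      omega)
    (by
      intro x y m' hx hy h4 h6 hs hJ u v
      obtain ⟨h1, h2⟩ := h m' ⟨x, hx⟩ ⟨y, hy⟩ hs h4 h6 (by rw [hJ, if_neg]; simp)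
      by_cases huv : (u : ℕ) = x ∧ (v : ℕ) = y
      · obtain ⟨rfl, rfl⟩ := huv
        by_cases hβ : β u v
        · simp [exec, h1.2 hβ, Memory.writeNat, h4, h6, hβ, h2 hβ]
        · simp [exec, mt h1.1 hβ, hβ, hJ]
      · have e1 : ((ite b (setNat a rowIdx colIdx e) skip).exec m').nat a u v = m'.nat a u v := by
          simp only [exec]
          split_ifs
          · simp [Memory.writeNat, h4, h6, huv]
          · rfl
        rw [e1, hJ]
        refine if_congr (and_congr_left fun _ => ?_) rfl rfl
        omega)
  have := key u v
  rw [show mark a b e = for2 4 6 (ite b (setNat a rowIdx colIdx e) skip) from rfl, this]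
  refine if_congr ?_ rfl rfl
  simp

/-- Marks in a loop: the last mark remains. -/
theorem nat_for_mark {a v : ℕ} (ha4 : 4 ≠ a) (ha6 : 6 ≠ a) (ha0 : 0 ≠ a) (hav : a ≠ v)
    {b : Test} {e : NatExpr} {P : Cmd} (hP0 : ¬ P.WritesNat 0) (hPa : ¬ P.WritesNat a) (hv0 : 0 ≠ v)
    {m : Memory} {n : ℕ} (hm : m.nat 0 0 0 = n) {β : Fin n → Fin n → Fin n → Prop} {ε : Fin n → ℕ}
    (h : ∀ m₁ m' (z i j : Fin n), (for_ v (seq P (mark a b e))).SameOff m m₁ → m₁.nat v 0 0 = z →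
      (mark a b e).SameOff (P.exec m₁) m' → m'.nat 4 0 0 = i → m'.nat 6 0 0 = j →
      (b.holds m' ↔ β z i j) ∧ e.val m' = ε z) (u w : Fin n) :
    (∃ z, β z u w ∧ ((for_ v (seq P (mark a b e))).exec m).nat a u w = ε z ∧
      ∀ z', z < z' → ¬ β z' u w) ∨
    ((∀ z, ¬ β z u w) ∧ ((for_ v (seq P (mark a b e))).exec m).nat a u w = m.nat a u w) := by
  have key := for_inv (v := v) (P := seq P (mark a b e)) (m := m)
    (fun k m' => (∃ z : Fin n, (z : ℕ) < k ∧ β z u w ∧ m'.nat a u w = ε z ∧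
      ∀ z' : Fin n, z < z' → (z' : ℕ) < k → ¬ β z' u w) ∨
      ((∀ z : Fin n, (z : ℕ) < k → ¬ β z u w) ∧ m'.nat a u w = m.nat a u w))
    (Or.inr ⟨by simp, by simp [Memory.writeNat, hav]⟩)
    (by
      classical
      intro k m₁ hk hv hs hI
      rw [hm] at hk
      have hsz : (P.exec m₁).nat 0 0 0 = n := by
        rw [exec_nat_of_not_writes hP0, hs.1 0 (by simp [WritesNat, hv0, hP0, ha0]), hm]
      have e1 := nat_mark ha4 ha6 ha0 (b := b) (e := e) hsz (β := β ⟨k, hk⟩)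
        (ε := fun _ _ => ε ⟨k, hk⟩)
        (fun m' i j hs' h4 h6 _ => by
          obtain ⟨h1, h2⟩ := h m₁ m' ⟨k, hk⟩ i j hs hv hs' h4 h6
          exact ⟨h1, fun _ => h2⟩) u w
      rw [exec_nat_of_not_writes hPa] at e1
      have e2 : (((seq P (mark a b e)).exec m₁).writeNat v 0 0 (k + 1)).nat a u w =
          ((mark a b e).exec (P.exec m₁)).nat a u w := by
        simp [Memory.writeNat, hav, exec]
      rw [e2, e1]
      by_cases hβ : β ⟨k, hk⟩ u w
      · refine Or.inl ⟨⟨k, hk⟩, Nat.lt_succ_self k, hβ, if_pos hβ, fun z' h1 h2 => ?_⟩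
        have : k < (z' : ℕ) := h1
        omega
      · rw [if_neg hβ]
        have hlt : ∀ z : Fin n, (z : ℕ) < k + 1 → β z u w → (z : ℕ) < k := by
          intro z hz hzβ
          have : (z : ℕ) ≠ k := by
            intro hzk
            exact hβ ((Fin.ext hzk : z = ⟨k, hk⟩) ▸ hzβ)
          omega
        rcases hI with ⟨z, h1, h2, h3, h4⟩ | ⟨h1, h2⟩
        · exact Or.inl ⟨z, by omega, h2, h3, fun z' h5 h6 h7 => h4 z' h5 (hlt z' h6 h7) h7⟩
        · exact Or.inr ⟨fun z hz hzβ => h1 z (hlt z hz hzβ) hzβ, h2⟩)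
  rw [hm] at key
  rcases key with ⟨z, -, h2, h3, h4⟩ | ⟨h1, h2⟩
  · exact Or.inl ⟨z, h2, h3, fun z' h => h4 z' h z'.2⟩
  · exact Or.inr ⟨fun z => h1 z z.2, h2⟩

/-- A loop over scans that set a flag. -/
theorem nat_for_flagScan {a v : ℕ} (ha4 : 4 ≠ a) (ha6 : 6 ≠ a) (ha0 : 0 ≠ a) (hav : a ≠ v)
    {b : Test} {P : Cmd} (hP0 : ¬ P.WritesNat 0) (hPa : ¬ P.WritesNat a) (hv0 : 0 ≠ v)
    {m : Memory} {n : ℕ} (hm : m.nat 0 0 0 = n) {β : Fin n → Fin n → Fin n → Prop}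
    (h : ∀ m₁ m' (z i j : Fin n), (for_ v (seq P (flagScan a b))).SameOff m m₁ →
      m₁.nat v 0 0 = z → (flagScan a b).SameOff (P.exec m₁) m' → m'.nat 4 0 0 = i →
      m'.nat 6 0 0 = j → (b.holds m' ↔ β z i j)) :
    ((for_ v (seq P (flagScan a b))).exec m).nat a 0 0 ≠ 0 ↔
      m.nat a 0 0 ≠ 0 ∨ ∃ z i j, β z i j := by
  have key := for_inv (v := v) (P := seq P (flagScan a b)) (m := m)
    (fun k m' => m'.nat a 0 0 ≠ 0 ↔ m.nat a 0 0 ≠ 0 ∨ ∃ z i j : Fin n, (z : ℕ) < k ∧ β z i j)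
    (by simp [Memory.writeNat, hav])
    (by
      intro k m₁ hk hv hs hI
      rw [hm] at hk
      have hsz : (P.exec m₁).nat 0 0 0 = n := by
        rw [exec_nat_of_not_writes hP0, hs.1 0 (by simp [WritesNat, hv0, hP0, ha0]), hm]
      have e1 := nat_flagScan ha4 ha6 ha0 (b := b) hsz (β := β ⟨k, hk⟩)
        (fun m' i j hs' h4 h6 => h m₁ m' ⟨k, hk⟩ i j hs hv hs' h4 h6)
      rw [exec_nat_of_not_writes hPa, hI] at e1
      have e2 : (((seq P (flagScan a b)).exec m₁).writeNat v 0 0 (k + 1)).nat a 0 0 =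
          ((flagScan a b).exec (P.exec m₁)).nat a 0 0 := by
        simp [Memory.writeNat, hav, exec]
      rw [e2, e1, or_assoc]
      refine or_congr_right ⟨?_, ?_⟩
      · rintro (⟨z, i, j, h1, h2⟩ | ⟨i, j, h2⟩)
        · exact ⟨z, i, j, by omega, h2⟩
        · exact ⟨⟨k, hk⟩, i, j, Nat.lt_succ_self k, h2⟩
      · rintro ⟨z, i, j, h1, h2⟩
        by_cases hz : (z : ℕ) = k
        · obtain rfl : z = ⟨k, hk⟩ := Fin.ext hz
          exact Or.inr ⟨i, j, h2⟩
        · exact Or.inl ⟨z, i, j, by omega, h2⟩)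
  rw [hm] at key
  rw [key]
  simp

end Cmd

variable {n : ℕ} {D : Digraph (Fin n)} {c : Fin n → Fin n → ℝ} {m m' : Memory}

/-! ### Reachability -/

open Cmd

/-- Compute the matrix of reachability. -/
def reachCmd : Cmd := closure 2 (adjTest rowIdx colIdx) .zero

theorem hasStrong_reachCmd (h : HasInput D c m) : HasStrong D c (reachCmd.exec m) := by
  refine ⟨h.sameOff (sameOff_exec _ m) (by simp [reachCmd]) (by simp [reachCmd]), fun u v => ?_⟩
  rw [← closure_ne_top (a := 2) (b := adjTest rowIdx colIdx) (e := .zero) h.size (E := D.Adj)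
    (w := fun _ _ => 0) (fun _ => rfl) ?_ u v, Memory.mat, Memory.wt_ne_top]
  · rfl
  · intro m' i j hs h4 h6
    have h' := h.sameOff hs (by simp) (by simp)
    exact ⟨fun _ => adjTest_holds h' (i := rowIdx) (j := colIdx) h4 h6, fun _ => rfl⟩

/-! ### Separating vertices -/

/-- The test that the arc from row to column avoids the vertex in the variable `10`. -/
def avoidTest : Test :=
  .and (.not (.natEq rowIdx (.var 10))) (.not (.natEq colIdx (.var 10)))

/-- Compute the pairs that a vertex separates. -/
def sepCmd : Cmd :=
  for_ 10 (seq
    (closure 3 (.and avoidTest (.and (strongTest rowIdx colIdx)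
      (.or (adjTest rowIdx colIdx) (adjTest colIdx rowIdx)))) .zero)
    (mark 24 (.and avoidTest (.and (strongTest rowIdx colIdx) (.not (finiteTest 3 rowIdx colIdx))))
      (.add (.var 10) (.const 1))))

theorem avoidTest_holds {w i j : Fin n} (h10 : m.nat 10 0 0 = w) (h4 : m.nat 4 0 0 = i)
    (h6 : m.nat 6 0 0 = j) : avoidTest.holds m ↔ i ≠ w ∧ j ≠ w := by
  simp [avoidTest, Test.holds, h10, h4, h6, Fin.ext_iff]

/-- For each `w`, a closure of the underlying edges of the strong components that avoid `w` decides
which pairs `w` separates. Any separator may remain in the table; only its existence and its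
property matter. -/
theorem hasBlocks_sepCmd (h : HasStrong D c m) (h24 : ∀ u v : Fin n, m.nat 24 u v = 0) :
    HasBlocks D c (sepCmd.exec m) := by
  have hst := h.sameOff (sameOff_exec sepCmd m) (by simp [sepCmd, WritesNat])
    (by simp [sepCmd, WritesReal])
  have key := nat_for_mark (a := 24) (v := 10) (by decide) (by decide) (by decide) (by decide)
    (P := closure 3 (.and avoidTest (.and (strongTest rowIdx colIdx)
      (.or (adjTest rowIdx colIdx) (adjTest colIdx rowIdx)))) .zero)
    (b := .and avoidTest (.and (strongTest rowIdx colIdx) (.not (finiteTest 3 rowIdx colIdx))))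
    (e := .add (.var 10) (.const 1)) (by simp) (by simp) (by decide) h.size
    (β := fun w i j => (i ≠ w ∧ j ≠ w) ∧ SameStrong D i j ∧ ¬ ConnWithout D w i j)
    (ε := fun w => (w : ℕ) + 1) (by
      intro m₁ m' w i j hs hw hs' h4 h6
      have h1 := h.sameOff hs (by simp [WritesNat]) (by simp [WritesReal])
      set P := closure 3 (.and avoidTest (.and (strongTest rowIdx colIdx)
        (.or (adjTest rowIdx colIdx) (adjTest colIdx rowIdx)))) .zero with hP
      have h2 : HasStrong D c (P.exec m₁) := h1.sameOff (sameOff_exec P m₁) (by simp [hP])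
        (by simp [hP])
      have h3 := h2.sameOff hs' (by simp) (by simp)
      have hw' : m'.nat 10 0 0 = w := by
        rw [hs'.1 10 (by simp), exec_nat_of_not_writes (by simp [hP]), hw]
      refine ⟨?_, by simp [NatExpr.val, hw']⟩
      have hconn : ((P.exec m₁).mat n 3 i j ≠ ⊤) ↔ ConnWithout D w i j := by
        refine closure_ne_top h1.size (w := fun _ _ => 0) (fun _ => rfl) ?_ i j
        intro m'' i j hs'' h4 h6
        have h5 := h1.sameOff hs'' (by simp) (by simp)
        have hw'' : m''.nat 10 0 0 = w := by rw [hs''.1 10 (by simp), hw]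
        refine ⟨fun hij => ?_, fun _ => rfl⟩
        simp only [Test.holds, Test.or_holds, avoidTest_holds hw'' h4 h6,
          strongTest_holds h5 (i := rowIdx) (j := colIdx) h4 h6,
          adjTest_holds h5.toHasInput (i := rowIdx) (j := colIdx) h4 h6,
          adjTest_holds h5.toHasInput (i := colIdx) (j := rowIdx) h6 h4, StrongAdj]
        tauto
      have hfin : (finiteTest 3 rowIdx colIdx).holds m' ↔ ConnWithout D w i j := by
        rw [finiteTest_holds, NatExpr.val_var, NatExpr.val_var, h4, h6, hs'.wt (by simp) (by simp)]
        exact hconn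
      rw [← hfin]
      simp only [Test.holds, avoidTest_holds hw' h4 h6,
          strongTest_holds h3 (i := rowIdx) (j := colIdx) h4 h6])
  refine ⟨hst, fun u v huv => ?_, fun u v w huv => ?_⟩
  · rcases key u v with ⟨w, ⟨⟨h1, h2⟩, h3, h4⟩, h5, -⟩ | ⟨h1, h2⟩
    · refine iff_of_false ?_ fun hb => h4 (hb.2 w h1.symm h2.symm)
      rw [sepCmd, h5]
      exact Nat.succ_ne_zero _
    · refine iff_of_true ?_ ⟨huv, fun w hw1 hw2 => ?_⟩
      · rw [sepCmd, h2, h24]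
      · by_contra hc
        exact h1 w ⟨⟨hw1.symm, hw2.symm⟩, huv, hc⟩
  · rcases key u v with ⟨z, ⟨⟨h1, h2⟩, h3, h4⟩, h5, -⟩ | ⟨h1, h2⟩
    · rw [sepCmd, h5] at huv
      exact ⟨z, Nat.succ_injective huv, h1.symm, h2.symm, h3, h4⟩
    · rw [sepCmd, h2, h24] at huv
      omega

/-! ### The forest test -/

/-- Set the flag if the negative graph has a cycle. -/
def forestCmd : Cmd :=
  for_ 10 (seq
    (closure 4 (.and avoidTest (negTest rowIdx colIdx)) .zero)
    (flagScan 30 (.and (negTest (.var 10) rowIdx) (.and (negTest (.var 10) colIdx)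
      (.and (.not (.natEq rowIdx colIdx)) (finiteTest 4 rowIdx colIdx))))))

theorem nat_forestCmd (h : HasInput D c m) (hloop : ∀ v, ¬ D.Adj v v) :
    (forestCmd.exec m).nat 30 0 0 ≠ 0 ↔ m.nat 30 0 0 ≠ 0 ∨ ¬ NegForest D c := by
  rw [forestCmd, nat_for_flagScan (a := 30) (v := 10) (by decide) (by decide) (by decide)
    (by decide) (by simp) (by simp) (by decide) h.size
    (β := fun w x y => (negGraph D c).Adj w x ∧ (negGraph D c).Adj w y ∧ x ≠ y ∧
      Relation.ReflTransGen (fun u v => (negGraph D c).Adj u v ∧ u ≠ w ∧ v ≠ w) x y)]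
  · simp only [NegForest]
    push Not
    rfl
  · intro m₁ m' w i j hs hw hs' h4 h6
    have h1 := h.sameOff hs (by simp [WritesNat]) (by simp [WritesReal])
    set P := closure 4 (.and avoidTest (negTest rowIdx colIdx)) .zero with hP
    have h2 : HasInput D c (P.exec m₁) := h1.sameOff (sameOff_exec P m₁) (by simp [hP])
      (by simp [hP])
    have h3 := h2.sameOff hs' (by simp) (by simp)
    have hw' : m'.nat 10 0 0 = w := by
      rw [hs'.1 10 (by simp), exec_nat_of_not_writes (by simp [hP]), hw]
    have hconn : ((P.exec m₁).mat n 4 i j ≠ ⊤) ↔ Relation.ReflTransGen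
        (fun u v => (negGraph D c).Adj u v ∧ u ≠ w ∧ v ≠ w) i j := by
      refine closure_ne_top h1.size (w := fun _ _ => 0) (fun _ => rfl) ?_ i j
      intro m'' i j hs'' h4 h6
      have h5 := h1.sameOff hs'' (by simp) (by simp)
      have hw'' : m''.nat 10 0 0 = w := by rw [hs''.1 10 (by simp), hw]
      refine ⟨fun hij => ?_, fun _ => rfl⟩
      simp only [Test.holds, avoidTest_holds hw'' h4 h6,
        negTest_holds h5 hloop (i := rowIdx) (j := colIdx) h4 h6]
      tauto
    have hfin : (finiteTest 4 rowIdx colIdx).holds m' ↔ Relation.ReflTransGen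
        (fun u v => (negGraph D c).Adj u v ∧ u ≠ w ∧ v ≠ w) i j := by
      rw [finiteTest_holds, NatExpr.val_var, NatExpr.val_var, h4, h6, hs'.wt (by simp) (by simp)]
      exact hconn
    simp only [Test.holds, negTest_holds h3 hloop (i := .var 10) (j := rowIdx) hw' h4,
      negTest_holds h3 hloop (i := .var 10) (j := colIdx) hw' h6, hfin, NatExpr.val_var, h4, h6,
      Ne, Fin.ext_iff]

end

section

open Cmd

variable {n : ℕ} {D : Digraph (Fin n)} {c : Fin n → Fin n → ℝ} {m m' : Memory}

/-! ### Distances without negative arcs and inside the negative graph -/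

theorem walkWeight_congr {V : Type*} {E : V → V → Prop} {w w' : V → V → ℝ}
    (h : ∀ u v, E u v → w u v = w' u v) {l : List V} (hl : l.IsChain E) :
    walkWeight w l = walkWeight w' l := by
  induction l with
  | nil => rfl
  | cons a l ih =>
    cases l with
    | nil => rfl
    | cons b l =>
      rw [List.isChain_cons_cons] at hl
      simp only [walkWeight, h _ _ hl.1, ih hl.2]

/-- The test that the sum of the entry `(i, j)` of `A` and the entry `(j, i)` of `B` is negative. -/
def negSumTest (A B : ℕ) : Test :=
  .and (finiteTest A rowIdx colIdx) (.and (finiteTest B colIdx rowIdx)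
    (.realLt (.add (.read A rowIdx colIdx) (.read B colIdx rowIdx)) .zero))

theorem negSumTest_holds {A B : ℕ} {i j : Fin n} (h4 : m.nat 4 0 0 = i) (h6 : m.nat 6 0 0 = j) :
    (negSumTest A B).holds m ↔ m.mat n A i j + m.mat n B j i < 0 := by
  simp only [negSumTest, Test.holds, finiteTest_holds, NatExpr.val_var, h4, h6, RealExpr.val,
    Memory.mat]
  by_cases hA : m.wt A i j = ⊤
  · simp [hA]
  by_cases hB : m.wt B j i = ⊤
  · simp [hB]
  rw [Memory.wt_of_ne (Memory.wt_ne_top.1 hA), Memory.wt_of_ne (Memory.wt_ne_top.1 hB)]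
  norm_cast
  simp

/-- Compute the distances without negative arcs. -/
def ordCmd : Cmd :=
  closure 5 (.and (adjTest rowIdx colIdx) (.not (negTest rowIdx colIdx))) (.read 0 rowIdx colIdx)

/-- The diagonal enters a closure as the trivial path. Its weight is zero because the input stores
`0` where there is no arc and `D` has no loops. -/
theorem real_zero (h : HasInput D c m) (hloop : ∀ v, ¬ D.Adj v v) (v : Fin n) :
    m.real 0 v v = 0 := h.zero v v (hloop v)

theorem ordCmd_spec (h : HasInput D c m) (hloop : ∀ v, ¬ D.Adj v v) :
    (∀ s v P, Wk (OrdArc D c) s v P → P.Nodup → (ordCmd.exec m).mat n 5 s v ≤ walkWeight c P) ∧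
    (∀ s v, (ordCmd.exec m).mat n 5 s v ≠ ⊤ → ∃ p, Wk (OrdArc D c) s v p ∧
      (walkWeight c p : WithTop ℝ) ≤ (ordCmd.exec m).mat n 5 s v) := by
  have key := closure_walks (a := 5)
    (b := .and (adjTest rowIdx colIdx) (.not (negTest rowIdx colIdx))) (e := .read 0 rowIdx colIdx)
    h.size (E := OrdArc D c) (w := fun i j => m.real 0 i j) (real_zero h hloop) (by
      intro m' i j hs h4 h6
      have h' := h.sameOff hs (by simp) (by simp)
      refine ⟨fun _ => ?_, fun _ => ?_⟩
      · simp only [Test.holds, adjTest_holds h' (i := rowIdx) (j := colIdx) h4 h6,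
          negTest_holds h' hloop (i := rowIdx) (j := colIdx) h4 h6, OrdArc]
      · simp only [RealExpr.val, NatExpr.val_var, h4, h6]
        rw [hs.2 0 (by simp)])
  have hw : ∀ s t l, Wk (OrdArc D c) s t l → walkWeight (fun i j : Fin n => m.real 0 i j) l = walkWeight c l :=
    fun s t l hl => walkWeight_congr (fun u v huv => h.weight u v huv.1) hl.2.2
  refine ⟨fun s v P hP hPn => ?_, fun s v hsv => ?_⟩
  · rw [← hw _ _ _ hP]
    exact key.1 s v P hP hPn
  · obtain ⟨p, hp, hpw⟩ := key.2 s v hsv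
    rw [hw _ _ _ hp] at hpw
    exact ⟨p, hp, hpw⟩

/-- Compute the distances in the negative graph for the reversed arcs with opposite sign. -/
def treeCmd : Cmd :=
  closure 6 (negTest rowIdx colIdx) (.sub .zero (.read 0 colIdx rowIdx))

theorem treeCmd_fill (h : HasInput D c m) (hloop : ∀ v, ¬ D.Adj v v) (m' : Memory) (i j : Fin n)
    (hs : treeCmd.SameOff m m') (h4 : m'.nat 4 0 0 = i) (h6 : m'.nat 6 0 0 = j) :
    (i ≠ j → ((negTest rowIdx colIdx).holds m' ↔ (negGraph D c).Adj i j)) ∧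
    (i = j ∨ (negGraph D c).Adj i j →
      (RealExpr.sub .zero (.read 0 colIdx rowIdx)).val m' = - m.real 0 j i) := by
  have h' := h.sameOff hs (by simp [treeCmd]) (by simp [treeCmd])
  refine ⟨fun _ => negTest_holds h' hloop (i := rowIdx) (j := colIdx) h4 h6, fun _ => ?_⟩
  simp only [RealExpr.val, NatExpr.val_var, h4, h6]
  rw [hs.2 0 (by simp [treeCmd]), zero_sub]

theorem treeCmd_spec (h : HasInput D c m) (hloop : ∀ v, ¬ D.Adj v v) :
    (∀ s v P, Wk (negGraph D c).Adj s v P → P.Nodup →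
      (treeCmd.exec m).mat n 6 s v ≤ walkWeight (fun u v => - c v u) P) ∧
    (∀ s v, (treeCmd.exec m).mat n 6 s v ≠ ⊤ → ∃ p, Wk (negGraph D c).Adj s v p ∧
      (walkWeight (fun u v => - c v u) p : WithTop ℝ) ≤ (treeCmd.exec m).mat n 6 s v) := by
  have key := closure_walks (a := 6) h.size (E := (negGraph D c).Adj)
    (w := fun i j => - m.real 0 j i) (by simp [real_zero h hloop]) (treeCmd_fill h hloop)
  have hw : ∀ s t l, Wk (negGraph D c).Adj s t l →
      walkWeight (fun i j : Fin n => - m.real 0 j i) l = walkWeight (fun u v => - c v u) l :=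
    fun s t l hl => walkWeight_congr (fun u v huv => by rw [h.weight v u huv.2.2.1]) hl.2.2
  refine ⟨fun s v P hP hPn => ?_, fun s v hsv => ?_⟩
  · rw [← hw _ _ _ hP]
    exact key.1 s v P hP hPn
  · obtain ⟨p, hp, hpw⟩ := key.2 s v hsv
    rw [hw _ _ _ hp] at hpw
    exact ⟨p, hp, hpw⟩

/-! ### Labels of the trees -/

/-- The memory holds the blocks and the connectivity in the negative graph. -/
structure HasTrees (D : Digraph (Fin n)) (c : Fin n → Fin n → ℝ) (m : Memory) : Prop
    extends HasBlocks D c m where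
  conn : ∀ u v : Fin n, m.nat 13 u v ≠ 0 ↔ NegConn D c u v

theorem HasTrees.sameOff (h : HasTrees D c m) {P : Cmd} (hs : P.SameOff m m')
    (hN : ∀ a ∈ [0, 1, 5, 24, 13], ¬ P.WritesNat a) (hR : ¬ P.WritesReal 0) : HasTrees D c m' where
  toHasBlocks := h.toHasBlocks.sameOff hs (fun a ha => hN a (by
    simp only [List.mem_cons, List.not_mem_nil, or_false] at ha ⊢
    tauto)) hR
  conn := by
    rw [hs.1 13 (hN 13 (by simp))]
    exact h.conn

theorem hasTrees_treeCmd (h : HasBlocks D c m) (hloop : ∀ v, ¬ D.Adj v v) :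
    HasTrees D c (treeCmd.exec m) := by
  refine ⟨h.sameOff (sameOff_exec _ m) (by simp [treeCmd]) (by simp [treeCmd]), fun u v => ?_⟩
  rw [NegConn, ← closure_ne_top (a := 6) h.size (w := fun i j => - m.real 0 j i)
    (by simp [real_zero h.toHasInput hloop]) (treeCmd_fill h.toHasInput hloop) u v, Memory.mat,
    Memory.wt_ne_top]
  rfl

/-- The test that `i` and `j` are different vertices of the same negative tree of a block. -/
def sameTreeTest (i j : NatExpr) : Test :=
  .and (.not (.natEq i j)) (.and (finiteTest 6 i j) (blockTest i j))

theorem connTest_holds (h : HasTrees D c m) {i j : NatExpr} {u v : Fin n} (hi : i.val m = u)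
    (hj : j.val m = v) : (finiteTest 6 i j).holds m ↔ NegConn D c u v := by
  rw [finiteTest_holds, Memory.wt_ne_top, hi, hj]
  exact h.conn u v

theorem sameTreeTest_holds (h : HasTrees D c m) {i j : NatExpr} {u v : Fin n} (hi : i.val m = u)
    (hj : j.val m = v) : (sameTreeTest i j).holds m ↔ SameTree D c u v := by
  simp only [sameTreeTest, Test.holds, connTest_holds h hi hj, blockTest_holds h.toHasBlocks hi hj,
    SameTree, hi, hj, Ne, Fin.ext_iff]

/-- The test that the vertex `u` lies in the block of `i` and `j`. -/
def inBlockTest (i j u : NatExpr) : Test := .and (blockTest u i) (blockTest u j)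

theorem inBlockTest_holds (h : HasBlocks D c m) {i j u : NatExpr} {x y z : Fin n}
    (hi : i.val m = x) (hj : j.val m = y) (hu : u.val m = z) :
    (inBlockTest i j u).holds m ↔ InBlock D x y z := by
  simp only [inBlockTest, Test.holds, blockTest_holds h hu hi, blockTest_holds h hu hj, InBlock]

/-- Compute the last vertices of the trees. -/
def rootCmd : Cmd :=
  for_ 10 (seq skip (mark 26 (.and (inBlockTest rowIdx colIdx (.var 10))
    (finiteTest 6 (.var 10) rowIdx)) (.var 10)))

/-- The memory holds the blocks, the connectivity in the negative graph, and the roots of the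
trees. -/
structure HasRoots (D : Digraph (Fin n)) (c : Fin n → Fin n → ℝ) (ρ : Fin n → Fin n → Fin n)
    (m : Memory) : Prop extends HasTrees D c m where
  root : ∀ u v : Fin n, m.nat 26 u v = ρ u v

theorem HasRoots.sameOff {ρ : Fin n → Fin n → Fin n} (h : HasRoots D c ρ m) {P : Cmd}
    (hs : P.SameOff m m') (hN : ∀ a ∈ [0, 1, 5, 24, 13, 26], ¬ P.WritesNat a)
    (hR : ¬ P.WritesReal 0) : HasRoots D c ρ m' where
  toHasTrees := h.toHasTrees.sameOff hs (fun a ha => hN a (by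
    simp only [List.mem_cons, List.not_mem_nil, or_false] at ha ⊢
    tauto)) hR
  root := by
    rw [hs.1 26 (hN 26 (by simp))]
    exact h.root

/-- Candidates are marked in increasing order and the last mark remains, so it is the largest vertex
of the tree in the block. A mark exists since `x` itself is a candidate. -/
theorem hasRoots_rootCmd (h : HasTrees D c m) (h26 : ∀ u v : Fin n, m.nat 26 u v = 0) :
    ∃ ρ : Fin n → Fin n → Fin n, HasRoots D c ρ (rootCmd.exec m) ∧ ∀ x y, SameTree D c x y →
      InBlock D x y (ρ x y) ∧ NegConn D c (ρ x y) x ∧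
        ∀ z, InBlock D x y z → NegConn D c z x → z ≤ ρ x y := by
  have key := nat_for_mark (a := 26) (v := 10) (by decide) (by decide) (by decide) (by decide)
    (P := skip) (b := .and (inBlockTest rowIdx colIdx (.var 10)) (finiteTest 6 (.var 10) rowIdx))
    (e := .var 10) (by simp [WritesNat]) (by simp [WritesNat]) (by decide) h.size
    (β := fun z x y => InBlock D x y z ∧ NegConn D c z x) (ε := fun z => z) (by
      intro m₁ m' z i j hs hz hs' h4 h6
      have h1 := h.sameOff hs (by simp [WritesNat]) (by simp [WritesReal])
      have h2 : HasTrees D c m' := HasTrees.sameOff (m := m₁) h1 hs' (by simp) (by simp)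
      have hz' : m'.nat 10 0 0 = z := (congrFun₂ (hs'.1 10 (by simp)) 0 0).trans hz
      exact ⟨by simp only [Test.holds, inBlockTest_holds h2.toHasBlocks (i := rowIdx) (j := colIdx)
        (u := .var 10) h4 h6 hz', connTest_holds h2 (i := .var 10) (j := rowIdx) hz' h4], hz'⟩)
  -- An entry without a mark holds `0`, which is also a vertex; thus `ρ` is defined for all pairs.
  have hlt : ∀ u v : Fin n, (rootCmd.exec m).nat 26 u v < n := by
    intro u v
    rcases key u v with ⟨z, -, h2, -⟩ | ⟨-, h2⟩
    · rw [rootCmd, h2]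
      exact z.2
    · rw [rootCmd, h2, h26]
      exact u.pos
  refine ⟨fun u v => ⟨_, hlt u v⟩, ⟨h.sameOff (sameOff_exec _ m) (by simp [rootCmd, WritesNat])
    (by simp [rootCmd, WritesReal]), fun u v => rfl⟩, fun x y hxy => ?_⟩
  rcases key x y with ⟨z, h1, h2, h3⟩ | ⟨h1, -⟩
  · have e : (⟨(rootCmd.exec m).nat 26 x y, hlt x y⟩ : Fin n) = z := Fin.ext h2
    simp only [e]
    exact ⟨h1.1, h1.2, fun z' h4 h5 => not_lt.1 fun hz => h3 z' hz ⟨h4, h5⟩⟩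
  · exact absurd ⟨⟨.refl x, hxy.2.2⟩, .refl⟩ (h1 x)

/-- Compute for which pairs the vertex in the variable `10` is a root of a tree. -/
def isRootCmd : Cmd :=
  -- Array `32` is reused for every candidate root and has to be reset.
  seq (mark 32 trueTest (.const 0)) (for_ 12 (seq skip (mark 32
    (.and (inBlockTest rowIdx colIdx (.var 10)) (.and (inBlockTest rowIdx colIdx (.var 12))
      (.and (sameTreeTest (.var 10) (.var 12)) (.natEq (.read 26 (.var 10) (.var 12)) (.var 10)))))
    (.const 1))))

theorem isRootCmd_spec {ρ : Fin n → Fin n → Fin n} (h : HasRoots D c ρ m) {r : Fin n}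
    (hr : m.nat 10 0 0 = r) (x y : Fin n) :
    (isRootCmd.exec m).nat 32 x y = 1 ↔ TreeRoot D c ρ x y r := by
  set m₀ := (mark 32 trueTest (.const 0)).exec m with hm₀
  have h0 : HasRoots D c ρ m₀ := h.sameOff (sameOff_exec _ m) (by simp) (by simp)
  have hr0 : m₀.nat 10 0 0 = r := by rw [hm₀, exec_nat_of_not_writes (by simp), hr]
  have key := nat_for_mark (a := 32) (v := 12) (by decide) (by decide) (by decide) (by decide)
    (P := skip) (b := .and (inBlockTest rowIdx colIdx (.var 10))
      (.and (inBlockTest rowIdx colIdx (.var 12)) (.and (sameTreeTest (.var 10) (.var 12))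
        (.natEq (.read 26 (.var 10) (.var 12)) (.var 10)))))
    (e := .const 1) (by simp [WritesNat]) (by simp [WritesNat]) (by decide) h0.size
    (β := fun z x y => InBlock D x y r ∧ InBlock D x y z ∧ SameTree D c r z ∧ ρ r z = r)
    (ε := fun _ => 1) (by
      intro m₁ m' z i j hs hz hs' h4 h6
      have h1 := h0.sameOff hs (by simp [WritesNat]) (by simp [WritesReal])
      have h2 : HasRoots D c ρ m' := HasRoots.sameOff (m := m₁) h1 hs' (by simp) (by simp)
      have hz' : m'.nat 12 0 0 = z := (congrFun₂ (hs'.1 12 (by simp)) 0 0).trans hz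
      have hr' : m'.nat 10 0 0 = r := by
        rw [hs'.1 10 (by simp)]
        change m₁.nat 10 0 0 = r
        rw [hs.1 10 (by simp [WritesNat]), hr0]
      refine ⟨?_, rfl⟩
      simp only [Test.holds, inBlockTest_holds h2.toHasBlocks (i := rowIdx) (j := colIdx)
        (u := .var 10) h4 h6 hr', inBlockTest_holds h2.toHasBlocks (i := rowIdx) (j := colIdx)
        (u := .var 12) h4 h6 hz', sameTreeTest_holds h2.toHasTrees (i := .var 10) (j := .var 12)
        hr' hz', NatExpr.val, hr', hz', h2.root, Fin.ext_iff]) x y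
  have hz : m₀.nat 32 x y = 0 := by
    rw [hm₀, nat_mark (by decide) (by decide) (by decide) h.size (β := fun _ _ => True)
      (ε := fun _ _ => 0) (fun m' i j _ _ _ _ =>
        ⟨iff_true_intro (trueTest_holds m'), fun _ => rfl⟩), if_pos trivial]
  rw [hz] at key
  rw [isRootCmd, exec, ← hm₀, TreeRoot]
  rcases key with ⟨z, ⟨h1, h2⟩, h3, -⟩ | ⟨h1, h2⟩
  · exact iff_of_true h3 ⟨h1, z, h2⟩
  · refine iff_of_false ?_ ?_
    · intro h3
      rw [h2] at h3
      exact zero_ne_one h3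
    · rintro ⟨h3, z, h4⟩
      exact h1 z ⟨h3, h4⟩

/-- Compute the labels of the trees. -/
def labelCmd : Cmd :=
  for_ 10 (seq isRootCmd (mark 28 (.and (.natEq (.read 32 rowIdx colIdx) (.const 1))
    (.natLt (.var 10) (.read 26 rowIdx colIdx))) (.add (.read 28 rowIdx colIdx) (.const 1))))

/-- After the candidates below `k`, the cell counts the roots below `min k (ρ x y)`; each further
root below `ρ x y` adds one. -/
theorem labelCmd_spec {ρ : Fin n → Fin n → Fin n} (h : HasRoots D c ρ m)
    (h28 : ∀ u v : Fin n, m.nat 28 u v = 0) (x y : Fin n) :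
    (labelCmd.exec m).nat 28 x y = {r | r < ρ x y ∧ TreeRoot D c ρ x y r}.ncard := by
  have key := for_inv (v := 10) (P := seq isRootCmd
    (mark 28 (.and (.natEq (.read 32 rowIdx colIdx) (.const 1))
      (.natLt (.var 10) (.read 26 rowIdx colIdx))) (.add (.read 28 rowIdx colIdx) (.const 1))))
    (m := m)
    (fun k m' => ∀ x y : Fin n,
      m'.nat 28 x y = {r : Fin n | (r : ℕ) < k ∧ r < ρ x y ∧ TreeRoot D c ρ x y r}.ncard)
    (by simp [Memory.writeNat, h28])
    (by
      classical
      intro k m₁ hk hv hs hI x y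
      rw [h.size] at hk
      set r : Fin n := ⟨k, hk⟩ with hr
      have h1 := h.sameOff hs (by simp [WritesNat, isRootCmd]) (by simp [WritesReal, isRootCmd])
      set m₂ := isRootCmd.exec m₁ with hm₂
      have h2 : HasRoots D c ρ m₂ := h1.sameOff (sameOff_exec _ m₁) (by simp [WritesNat, isRootCmd])
        (by simp [WritesReal, isRootCmd])
      have hr2 : m₂.nat 10 0 0 = r := by
        rw [hm₂, exec_nat_of_not_writes (by simp [isRootCmd, WritesNat]), hv]
      have e1 := nat_mark (a := 28) (by decide) (by decide) (by decide)
        (b := .and (.natEq (.read 32 rowIdx colIdx) (.const 1))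
          (.natLt (.var 10) (.read 26 rowIdx colIdx)))
        (e := .add (.read 28 rowIdx colIdx) (.const 1)) h2.size
        (β := fun x y => TreeRoot D c ρ x y r ∧ r < ρ x y) (ε := fun x y => m₂.nat 28 x y + 1)
        (fun m' i j hs' h4 h6 hij => by
          have h3 : HasRoots D c ρ m' := h2.sameOff hs' (by simp) (by simp)
          refine ⟨?_, fun _ => by simp [NatExpr.val, h4, h6, hij]⟩
          simp only [Test.holds, NatExpr.val, h4, h6, h3.root, hs'.1 10 (by simp), hr2,
            hs'.1 32 (by simp)]
          rw [isRootCmd_spec h1 (r := r) hv, Fin.lt_def]) x y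
      have e2 : m₂.nat 28 x y = m₁.nat 28 x y := by
        rw [hm₂, exec_nat_of_not_writes (by simp [isRootCmd, WritesNat])]
      rw [e2, hI] at e1
      have e3 : ∀ P : Cmd, ((P.exec m₂).writeNat 10 0 0 (k + 1)).nat 28 x y =
          (P.exec m₂).nat 28 x y := by
        intro P
        simp [Memory.writeNat]
      rw [exec, ← hm₂, e3, e1]
      split_ifs with hβ
      · rw [← Set.ncard_insert_of_notMem (a := r) (by simp [hr])]
        congr 1
        ext z
        simp only [Set.mem_insert_iff, Set.mem_ofPred_eq]
        constructor
        · rintro (rfl | hz)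
          · exact ⟨Nat.lt_succ_self k, hβ.2, hβ.1⟩
          · exact ⟨by omega, hz.2⟩
        · rintro ⟨hz, hz'⟩
          by_cases hzk : (z : ℕ) = k
          · exact Or.inl (Fin.ext hzk)
          · exact Or.inr ⟨by omega, hz'⟩
      · congr 1
        ext z
        simp only [Set.mem_ofPred_eq]
        constructor
        · rintro ⟨hz, hz'⟩
          exact ⟨by omega, hz'⟩
        · rintro ⟨hz, hz'⟩
          refine ⟨?_, hz'⟩
          by_contra hzk
          obtain rfl : z = r := Fin.ext (by simp only [hr]; omega)
          exact hβ ⟨hz'.2, hz'.1⟩)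
  rw [h.size] at key
  rw [labelCmd, key x y]
  congr 1
  ext z
  simp

/-! ### The matrices of the trees -/

/-- Compute the matrices of the trees with labels below `γ`. -/
def tausCmd : ℕ → Cmd
  | 0 => skip
  -- Even numbers from 20 are for the trees and odd numbers from 21 for the prefixes of sequences,
  -- so both families grow with `γ` without collision.
  | T + 1 => seq (tausCmd T) (fill (20 + 2 * T)
      (.and (sameTreeTest rowIdx colIdx) (.natEq (.read 28 rowIdx colIdx) (.const T)))
      (.sub .zero (.read 6 colIdx rowIdx)))

theorem tausCmd_writesNat {γ a : ℕ} (h : (tausCmd γ).WritesNat a) :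
    a = 4 ∨ a = 6 ∨ ∃ T, a = 2 * (20 + 2 * T) + 1 := by
  induction γ with
  | zero => exact h.elim
  | succ T ih =>
    rcases h with h | h
    · exact ih h
    · rw [fill_writesNat] at h
      rcases h with h | h | h
      · exact Or.inl h
      · exact Or.inr (Or.inl h)
      · exact Or.inr (Or.inr ⟨T, h⟩)

theorem tausCmd_writesReal {γ a : ℕ} (h : (tausCmd γ).WritesReal a) : ∃ T, a = 20 + 2 * T := by
  induction γ with
  | zero => exact h.elim
  | succ T ih =>
    rcases h with h | h
    · exact ih h
    · rw [fill_writesReal] at h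
      exact ⟨T, h⟩

open Classical in
theorem tausCmd_spec (h : HasTrees D c m) (γ T : ℕ) (hT : T < γ) (x y : Fin n) :
    ((tausCmd γ).exec m).mat n (20 + 2 * T) x y =
      if SameTree D c x y ∧ m.nat 28 x y = T then ((- m.real 6 y x : ℝ) : WithTop ℝ) else ⊤ := by
  induction γ with
  | zero => omega
  | succ γ ih =>
    set m₁ := (tausCmd γ).exec m with hm₁
    have hN : ∀ a ∈ [0, 1, 5, 24, 13, 28], ¬ (tausCmd γ).WritesNat a := by
      intro a ha hw
      simp only [List.mem_cons, List.not_mem_nil, or_false] at ha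
      rcases tausCmd_writesNat hw with h | h | ⟨T, h⟩ <;> omega
    have hR : ∀ a ∈ [0, 6], ¬ (tausCmd γ).WritesReal a := by
      intro a ha hw
      simp only [List.mem_cons, List.not_mem_nil, or_false] at ha
      obtain ⟨T, h⟩ := tausCmd_writesReal hw
      omega
    have h1 : HasTrees D c m₁ := h.sameOff (sameOff_exec _ m) (fun a ha => hN a (by
      simp only [List.mem_cons, List.not_mem_nil, or_false] at ha ⊢
      omega)) (hR 0 (by simp))
    change ((fill (20 + 2 * γ) _ _).exec m₁).mat n (20 + 2 * T) x y = _
    by_cases hTγ : T = γ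
    · subst hTγ
      rw [mat_fill h1.size (β := fun x y => SameTree D c x y ∧ m.nat 28 x y = T)
        (ε := fun x y => - m.real 6 y x) ?_ x y]
      · congr
      · intro m' i j hs h4 h6
        have h2 : HasTrees D c m' := h1.sameOff hs (by simp; omega) (by simp; omega)
        constructor
        · simp only [Test.holds, sameTreeTest_holds h2 (i := rowIdx) (j := colIdx) h4 h6,
            NatExpr.val, h4, h6]
          rw [hs.1 28 (by simp; omega), hm₁, exec_nat_of_not_writes (hN 28 (by simp))]
        · intro _
          simp only [RealExpr.val, NatExpr.val_var, h4, h6]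
          rw [hs.2 6 (by simp; omega), hm₁, exec_real_of_not_writes (hR 6 (by simp)), zero_sub]
    · rw [mat_exec _ n (by simp; omega) (by simp; omega), hm₁]
      exact ih (by omega)

end

section

namespace Cmd

/-! ### Sequences of trees -/

/-- Set all entries of a matrix to infinity. -/
def clear (a : ℕ) : Cmd := fill a (.not trueTest) .zero

/-- Copy the matrix `b` to the matrix `a`. -/
def copy (a b : ℕ) : Cmd := fill a (finiteTest b rowIdx colIdx) (.read b rowIdx colIdx)

@[simp] theorem clear_writesNat {a x : ℕ} :
    (clear a).WritesNat x ↔ x = 4 ∨ x = 6 ∨ x = 2 * a + 1 := fill_writesNat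

@[simp] theorem clear_writesReal {a x : ℕ} : (clear a).WritesReal x ↔ x = a := fill_writesReal

@[simp] theorem copy_writesNat {a b x : ℕ} :
    (copy a b).WritesNat x ↔ x = 4 ∨ x = 6 ∨ x = 2 * a + 1 := fill_writesNat

@[simp] theorem copy_writesReal {a b x : ℕ} : (copy a b).WritesReal x ↔ x = a := fill_writesReal

theorem mat_clear {n a : ℕ} {m : Memory} (hm : m.nat 0 0 0 = n) (i j : Fin n) :
    ((clear a).exec m).mat n a i j = ⊤ := by
  rw [clear, mat_fill hm (β := fun _ _ => False) (ε := fun _ _ => 0)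
    (fun m' _ _ _ _ _ => ⟨by simp [Test.holds, trueTest_holds], fun h => h.elim⟩) i j, if_neg id]

theorem mat_fill_read {n a b : ℕ} {t : Test} {m : Memory} (hm : m.nat 0 0 0 = n) (hab : a ≠ b)
    {β : Fin n → Fin n → Prop} (hβ : ∀ i j, β i j → m.mat n b i j ≠ ⊤)
    (h : ∀ m' (i j : Fin n), (fill a t (.read b rowIdx colIdx)).SameOff m m' →
      m'.nat 4 0 0 = i → m'.nat 6 0 0 = j → (t.holds m' ↔ β i j)) (i j : Fin n) :
    (β i j → ((fill a t (.read b rowIdx colIdx)).exec m).mat n a i j = m.mat n b i j) ∧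
    (¬ β i j → ((fill a t (.read b rowIdx colIdx)).exec m).mat n a i j = ⊤) := by
  rw [mat_fill hm (β := β) (ε := fun i j => m.real b i j) (fun m' i j hs h4 h6 => by
    refine ⟨h m' i j hs h4 h6, fun _ => ?_⟩
    simp only [RealExpr.val, NatExpr.val_var, h4, h6]
    rw [hs.2 b (by simp [hab.symm])]) i j]
  refine ⟨fun hij => ?_, fun hij => if_neg hij⟩
  rw [if_pos hij, Memory.mat, Memory.wt_of_ne (Memory.wt_ne_top.1 (hβ i j hij))]

theorem mat_copy {n a b : ℕ} {m : Memory} (hm : m.nat 0 0 0 = n) (hab : a ≠ b) :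
    ((copy a b).exec m).mat n a = m.mat n b := by
  funext i j
  obtain ⟨h1, h2⟩ := mat_fill_read hm hab (t := finiteTest b rowIdx colIdx)
    (β := fun i j => m.mat n b i j ≠ ⊤) (fun _ _ h => h) (fun m' i j hs h4 h6 => by
      rw [finiteTest_holds, NatExpr.val_var, NatExpr.val_var, h4, h6, hs.wt (by simp; omega)
        (by simp [hab.symm]), Memory.mat]) i j
  by_cases h : m.mat n b i j = ⊤
  · rw [h]
    exact h2 (not_not.2 h)
  · exact h1 h

/-- The min-plus product of the matrices `A` and `B`. -/
def mulCmd (dst A B : ℕ) : Cmd := seq (clear dst) (relax trueTest dst A B)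

@[simp] theorem mulCmd_writesNat {dst A B a : ℕ} :
    (mulCmd dst A B).WritesNat a ↔ a = 8 ∨ a = 4 ∨ a = 6 ∨ a = 2 * dst + 1 := by
  simp only [mulCmd, WritesNat, clear_writesNat, relax_writesNat]
  tauto

@[simp] theorem mulCmd_writesReal {dst A B a : ℕ} :
    (mulCmd dst A B).WritesReal a ↔ a = dst := by
  simp [mulCmd, WritesReal]

theorem mat_mulCmd {n dst A B : ℕ} {m : Memory} (hm : m.nat 0 0 0 = n) (hA : dst ≠ A)
    (hB : dst ≠ B) :
    ((mulCmd dst A B).exec m).mat n dst = minPlus (m.mat n A) (m.mat n B) := by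
  funext i j
  rw [mulCmd, exec, mat_relax (by rw [exec_nat_of_not_writes (by simp), hm]) hA hB, mat_clear hm,
    min_eq_right le_top, mat_exec _ n (by simp; omega) (by simp [hA.symm]),
    mat_exec _ n (by simp; omega) (by simp [hB.symm])]

/-- Extend the sequence of length `r` by the tree `T`. -/
def stepCmd (r T : ℕ) : Cmd :=
  seq (mulCmd 8 (21 + 2 * r) (20 + 2 * T)) (mulCmd (21 + 2 * (r + 1)) 8 5)

/-- Go through all extensions of a sequence of length `r` by duplicate-free sequences of labels
in `L`. -/
def seqCmd : ℕ → ℕ → List ℕ → Cmd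
  | 0, r, _ => relax trueTest 7 (21 + 2 * r) 5
  -- Depth-first search: the matrix `21 + 2 * r` holds the product for the current prefix of length
  -- `r`. The recursion takes place in the program text, so the matrix loops are composed in
  -- sequence and not nested.
  | k + 1, r, L => seq (relax trueTest 7 (21 + 2 * r) 5) (L.foldr (fun T P =>
      seq (seq (flagScan 30 (negSumTest (21 + 2 * r) (20 + 2 * T)))
        (seq (stepCmd r T) (seqCmd k (r + 1) (L.erase T)))) P) skip)

theorem stepCmd_writesNat {r T a : ℕ} : (stepCmd r T).WritesNat a ↔
    a = 8 ∨ a = 4 ∨ a = 6 ∨ a = 17 ∨ a = 2 * (21 + 2 * (r + 1)) + 1 := by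
  simp only [stepCmd, WritesNat, mulCmd_writesNat]
  tauto

theorem stepCmd_writesReal {r T a : ℕ} : (stepCmd r T).WritesReal a ↔
    a = 8 ∨ a = 21 + 2 * (r + 1) := by
  simp only [stepCmd, WritesReal, mulCmd_writesReal]

/-- The point is `r < q`: deeper levels overwrite only longer prefixes, so the current one is intact
when the next tree is tried. -/
theorem seqCmd_writesNat {k r : ℕ} {L : List ℕ} {a : ℕ} (h : (seqCmd k r L).WritesNat a) :
    a = 4 ∨ a = 6 ∨ a = 8 ∨ a = 15 ∨ a = 17 ∨ a = 30 ∨ ∃ q, r < q ∧ a = 2 * (21 + 2 * q) + 1 := by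
  induction k generalizing r L with
  | zero =>
    simp only [seqCmd, relax_writesNat] at h
    omega
  | succ k ih =>
    rcases h with h | h
    · rw [relax_writesNat] at h
      omega
    · have key : ∀ L' : List ℕ, (L'.foldr (fun T P =>
          seq (seq (flagScan 30 (negSumTest (21 + 2 * r) (20 + 2 * T)))
            (seq (stepCmd r T) (seqCmd k (r + 1) (L.erase T)))) P) skip).WritesNat a →
          a = 4 ∨ a = 6 ∨ a = 8 ∨ a = 15 ∨ a = 17 ∨ a = 30 ∨
            ∃ q, r < q ∧ a = 2 * (21 + 2 * q) + 1 := by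
        intro L' h'
        induction L' with
        | nil => exact h'.elim
        | cons T L' ihL =>
          rcases h' with (h' | h' | h') | h'
          · rw [flagScan_writesNat] at h'
            omega
          · rw [stepCmd_writesNat] at h'
            rcases h' with h' | h' | h' | h' | h'
            · omega
            · omega
            · omega
            · omega
            · exact Or.inr (Or.inr (Or.inr (Or.inr (Or.inr (Or.inr ⟨r + 1, by omega, h'⟩)))))
          · rcases ih h' with h' | h' | h' | h' | h' | h' | ⟨q, h1, h2⟩
            · omega
            · omega
            · omega
            · omega
            · omega
            · omega
            · exact Or.inr (Or.inr (Or.inr (Or.inr (Or.inr (Or.inr ⟨q, by omega, h2⟩)))))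
          · exact ihL h'
      exact key L h

theorem seqCmd_writesReal {k r : ℕ} {L : List ℕ} {a : ℕ} (h : (seqCmd k r L).WritesReal a) :
    a = 7 ∨ a = 8 ∨ ∃ q, r < q ∧ a = 21 + 2 * q := by
  induction k generalizing r L with
  | zero =>
    simp only [seqCmd, relax_writesReal] at h
    omega
  | succ k ih =>
    rcases h with h | h
    · rw [relax_writesReal] at h
      omega
    · have key : ∀ L' : List ℕ, (L'.foldr (fun T P =>
          seq (seq (flagScan 30 (negSumTest (21 + 2 * r) (20 + 2 * T)))
            (seq (stepCmd r T) (seqCmd k (r + 1) (L.erase T)))) P) skip).WritesReal a →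
          a = 7 ∨ a = 8 ∨ ∃ q, r < q ∧ a = 21 + 2 * q := by
        intro L' h'
        induction L' with
        | nil => exact h'.elim
        | cons T L' ihL =>
          rcases h' with (h' | h' | h') | h'
          · exact (flagScan_writesReal h').elim
          · rw [stepCmd_writesReal] at h'
            rcases h' with h' | h'
            · exact Or.inr (Or.inl h')
            · exact Or.inr (Or.inr ⟨r + 1, by omega, h'⟩)
          · rcases ih h' with h' | h' | ⟨q, h1, h2⟩
            · exact Or.inl h'
            · exact Or.inr (Or.inl h')
            · exact Or.inr (Or.inr ⟨q, by omega, h2⟩)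
          · exact ihL h'
      exact key L h

variable {n : ℕ} {d₀ : Fin n → Fin n → WithTop ℝ} {τ : ℕ → Fin n → Fin n → WithTop ℝ}
  {M : Fin n → Fin n → WithTop ℝ}

/-- The matrix `7` and the flag `30` have been updated for the sequences in `S` and the tests
in `Q`. -/
structure Explored (d₀ : Fin n → Fin n → WithTop ℝ) (τ : ℕ → Fin n → Fin n → WithTop ℝ)
    (M : Fin n → Fin n → WithTop ℝ) (S : List ℕ → Prop) (Q : List ℕ → ℕ → Prop)
    (m m' : Memory) : Prop where
  le : ∀ i k, m'.mat n 7 i k ≤ m.mat n 7 i k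
  le_seq : ∀ l, S l → ∀ i k, m'.mat n 7 i k ≤ minPlus (evalSeq d₀ τ M l) d₀ i k
  eq : ∀ i k, m'.mat n 7 i k = m.mat n 7 i k ∨
    ∃ l, S l ∧ m'.mat n 7 i k = minPlus (evalSeq d₀ τ M l) d₀ i k
  flag : m'.nat 30 0 0 ≠ 0 ↔ m.nat 30 0 0 ≠ 0 ∨
    ∃ l T, Q l T ∧ ∃ i j, evalSeq d₀ τ M l i j + τ T j i < 0

namespace Explored

variable {S S' : List ℕ → Prop} {Q Q' : List ℕ → ℕ → Prop} {m m' m'' : Memory}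

theorem trans (h : Explored d₀ τ M S Q m m') (h' : Explored d₀ τ M S' Q' m' m'') :
    Explored d₀ τ M (fun l => S l ∨ S' l) (fun l T => Q l T ∨ Q' l T) m m'' where
  le i k := (h'.le i k).trans (h.le i k)
  le_seq l hl i k := hl.elim (fun hl => (h'.le i k).trans (h.le_seq l hl i k))
    (fun hl => h'.le_seq l hl i k)
  eq i k := by
    rcases h'.eq i k with e | ⟨l, hl, e⟩
    · rw [e]
      rcases h.eq i k with e' | ⟨l, hl, e'⟩
      · exact Or.inl e'
      · exact Or.inr ⟨l, Or.inl hl, e'⟩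
    · exact Or.inr ⟨l, Or.inr hl, e⟩
  flag := by
    rw [h'.flag, h.flag, or_assoc]
    refine or_congr_right ?_
    constructor
    · rintro (⟨l, T, hq, h⟩ | ⟨l, T, hq, h⟩)
      · exact ⟨l, T, Or.inl hq, h⟩
      · exact ⟨l, T, Or.inr hq, h⟩
    · rintro ⟨l, T, hq | hq, h⟩
      · exact Or.inl ⟨l, T, hq, h⟩
      · exact Or.inr ⟨l, T, hq, h⟩

theorem congr (h : Explored d₀ τ M S Q m m') (hS : ∀ l, S' l ↔ S l) (hQ : ∀ l T, Q' l T ↔ Q l T) :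
    Explored d₀ τ M S' Q' m m' := by
  have e1 : S' = S := funext fun l => propext (hS l)
  have e2 : Q' = Q := funext fun l => funext fun T => propext (hQ l T)
  rw [e1, e2]
  exact h

/-- Evaluating `T :: l` from `M` is evaluating `l` from the matrix extended by `T`, so results for
the extended prefix transfer. -/
theorem cons {T : ℕ} (h : Explored d₀ τ (minPlus (minPlus M (τ T)) d₀) S Q m m') :
    Explored d₀ τ M (fun l => ∃ l', l = T :: l' ∧ S l') (fun l T' => ∃ l', l = T :: l' ∧ Q l' T')
      m m' where
  le := h.le
  le_seq := by
    rintro _ ⟨l, rfl, hl⟩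
    exact h.le_seq l hl
  eq i k := by
    rcases h.eq i k with e | ⟨l, hl, e⟩
    · exact Or.inl e
    · exact Or.inr ⟨_, ⟨l, rfl, hl⟩, e⟩
  flag := by
    rw [h.flag]
    refine or_congr_right ⟨?_, ?_⟩
    · rintro ⟨l, T', hq, h⟩
      exact ⟨_, T', ⟨l, rfl, hq⟩, h⟩
    · rintro ⟨_, T', ⟨l, rfl, hq⟩, h⟩
      exact ⟨l, T', hq, h⟩

theorem of_eq (h7 : m'.mat n 7 = m.mat n 7) (h30 : m'.nat 30 = m.nat 30) :
    Explored d₀ τ M (fun _ => False) (fun _ _ => False) m m' where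
  le i k := by rw [h7]
  le_seq _ h := h.elim
  eq i k := Or.inl (by rw [h7])
  flag := by simp [h30]

end Explored

theorem explored_relax {m : Memory} {r : ℕ} (hm : m.nat 0 0 0 = n) (h5 : m.mat n 5 = d₀)
    (hM : m.mat n (21 + 2 * r) = M) :
    Explored d₀ τ M (fun l => l = []) (fun _ _ => False) m
      ((relax trueTest 7 (21 + 2 * r) 5).exec m) := by
  have key : ∀ i k, ((relax trueTest 7 (21 + 2 * r) 5).exec m).mat n 7 i k =
      min (m.mat n 7 i k) (minPlus M d₀ i k) := by
    intro i k
    rw [mat_relax hm (by omega) (by omega), h5, hM]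
  refine ⟨fun i k => ?_, ?_, fun i k => ?_, ?_⟩
  · rw [key]
    exact min_le_left _ _
  · rintro _ rfl i k
    rw [key]
    exact min_le_right _ _
  · rw [key]
    rcases min_choice (m.mat n 7 i k) (minPlus M d₀ i k) with e | e
    · exact Or.inl e
    · exact Or.inr ⟨[], rfl, e⟩
  · rw [exec_nat_of_not_writes (by simp)]
    simp

theorem explored_flagScan {m : Memory} {r T : ℕ} (hm : m.nat 0 0 0 = n)
    (hT : m.mat n (20 + 2 * T) = τ T) (hM : m.mat n (21 + 2 * r) = M) :
    Explored d₀ τ M (fun _ => False) (fun l T' => l = [] ∧ T' = T) m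
      ((flagScan 30 (negSumTest (21 + 2 * r) (20 + 2 * T))).exec m) := by
  have e7 := mat_exec (P := flagScan 30 (negSumTest (21 + 2 * r) (20 + 2 * T))) m n (a := 7)
    (by simp) (by simp)
  refine ⟨fun i k => by rw [e7], fun _ h => h.elim, fun i k => Or.inl (by rw [e7]), ?_⟩
  rw [nat_flagScan (by decide) (by decide) (by decide) hm
    (β := fun i j => M i j + τ T j i < 0)]
  · refine or_congr_right ⟨?_, ?_⟩
    · rintro ⟨i, j, h⟩
      exact ⟨[], T, ⟨rfl, rfl⟩, i, j, h⟩
    · rintro ⟨l, T', ⟨rfl, rfl⟩, i, j, h⟩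
      exact ⟨i, j, h⟩
  · intro m' i j hs h4 h6
    rw [negSumTest_holds h4 h6, ← hM, ← hT, Memory.mat, Memory.mat, Memory.mat, Memory.mat,
      hs.wt (by simp; omega) (by simp), hs.wt (by simp; omega) (by simp)]

theorem mat_stepCmd {m : Memory} {r T : ℕ} (hm : m.nat 0 0 0 = n) :
    ((stepCmd r T).exec m).mat n (21 + 2 * (r + 1)) =
      minPlus (minPlus (m.mat n (21 + 2 * r)) (m.mat n (20 + 2 * T))) (m.mat n 5) := by
  rw [stepCmd, exec, mat_mulCmd (by rw [exec_nat_of_not_writes (by simp), hm]) (by omega) (by omega),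
    mat_mulCmd hm (by omega) (by omega), mat_exec _ n (by simp) (by simp)]

theorem nodup_cons_subset_iff {L : List ℕ} (hL : L.Nodup) {T : ℕ} {l : List ℕ} :
    ((T :: l).Nodup ∧ ∀ T' ∈ T :: l, T' ∈ L) ↔
      T ∈ L ∧ l.Nodup ∧ ∀ T' ∈ l, T' ∈ L.erase T := by
  simp only [List.nodup_cons, List.mem_cons, hL.mem_erase_iff, forall_eq_or_imp]
  constructor
  · rintro ⟨⟨h1, h2⟩, h3, h4⟩
    exact ⟨h3, h2, fun T' h => ⟨fun e => h1 (e ▸ h), h4 T' h⟩⟩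
  · rintro ⟨h1, h2, h3⟩
    exact ⟨⟨fun h => (h3 T h).1 rfl, h2⟩, h1, fun T' h => (h3 T' h).2⟩

/-- A duplicate-free sequence over `L` is empty or starts with some `T ∈ L` and goes on without
duplicates in `L.erase T`. The claims for the individual `T` combine because every call preserves
the inputs of the next. -/
theorem explored_seqCmd {k r : ℕ} {L : List ℕ} (hL : L.Nodup) (hk : L.length ≤ k) {m : Memory}
    (hm : m.nat 0 0 0 = n) (h5 : m.mat n 5 = d₀) (hτ : ∀ T ∈ L, m.mat n (20 + 2 * T) = τ T)
    (hM : m.mat n (21 + 2 * r) = M) :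
    Explored d₀ τ M (fun l => l.Nodup ∧ ∀ T ∈ l, T ∈ L)
      (fun l T => l.Nodup ∧ (∀ T ∈ l, T ∈ L) ∧ T ∈ L ∧ T ∉ l) m ((seqCmd k r L).exec m) := by
  induction k generalizing r L m M with
  | zero =>
    obtain rfl : L = [] := List.length_eq_zero_iff.1 (by omega)
    refine (explored_relax hm h5 hM).congr (fun l => ?_) (fun l T => by simp)
    constructor
    · intro h
      exact List.eq_nil_iff_forall_not_mem.2 fun T hT => by simpa using h.2 T hT
    · rintro rfl
      simp
  | succ k ih =>
    set f : ℕ → Cmd → Cmd := fun T P =>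
      seq (seq (flagScan 30 (negSumTest (21 + 2 * r) (20 + 2 * T)))
        (seq (stepCmd r T) (seqCmd k (r + 1) (L.erase T)))) P with hf
    have hkeep : ∀ (P : Cmd), (∀ a, P.WritesNat a → a = 4 ∨ a = 6 ∨ a = 8 ∨ a = 15 ∨ a = 17 ∨
        a = 30 ∨ ∃ q, r < q ∧ a = 2 * (21 + 2 * q) + 1) →
        (∀ a, P.WritesReal a → a = 7 ∨ a = 8 ∨ ∃ q, r < q ∧ a = 21 + 2 * q) → ∀ m : Memory,
        m.nat 0 0 0 = n → m.mat n 5 = d₀ → (∀ T ∈ L, m.mat n (20 + 2 * T) = τ T) →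
        m.mat n (21 + 2 * r) = M → (P.exec m).nat 0 0 0 = n ∧ (P.exec m).mat n 5 = d₀ ∧
        (∀ T ∈ L, (P.exec m).mat n (20 + 2 * T) = τ T) ∧ (P.exec m).mat n (21 + 2 * r) = M := by
      intro P hN hR m hm h5 hτ hM
      refine ⟨?_, ?_, fun T hT => ?_, ?_⟩
      · rw [exec_nat_of_not_writes (fun h => ?_), hm]
        rcases hN _ h with h | h | h | h | h | h | ⟨q, h1, h2⟩ <;> omega
      · rw [mat_exec _ n (fun h => ?_) (fun h => ?_), h5]
        · rcases hN _ h with h | h | h | h | h | h | ⟨q, h1, h2⟩ <;> omega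
        · rcases hR _ h with h | h | ⟨q, h1, h2⟩ <;> omega
      · rw [mat_exec _ n (fun h => ?_) (fun h => ?_), hτ T hT]
        · rcases hN _ h with h | h | h | h | h | h | ⟨q, h1, h2⟩ <;> omega
        · rcases hR _ h with h | h | ⟨q, h1, h2⟩ <;> omega
      · rw [mat_exec _ n (fun h => ?_) (fun h => ?_), hM]
        · rcases hN _ h with h | h | h | h | h | h | ⟨q, h1, h2⟩ <;> omega
        · rcases hR _ h with h | h | ⟨q, h1, h2⟩ <;> omega
    have hone : ∀ T ∈ L, ∀ m : Memory, m.nat 0 0 0 = n → m.mat n 5 = d₀ →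
        (∀ T ∈ L, m.mat n (20 + 2 * T) = τ T) → m.mat n (21 + 2 * r) = M →
        Explored d₀ τ M (fun l => ∃ l', l = T :: l' ∧ l'.Nodup ∧ ∀ T' ∈ l', T' ∈ L.erase T)
          (fun l T' => (l = [] ∧ T' = T) ∨ ∃ l', l = T :: l' ∧ l'.Nodup ∧
            (∀ T' ∈ l', T' ∈ L.erase T) ∧ T' ∈ L.erase T ∧ T' ∉ l') m
          ((seqCmd k (r + 1) (L.erase T)).exec ((stepCmd r T).exec
            ((flagScan 30 (negSumTest (21 + 2 * r) (20 + 2 * T))).exec m))) := by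
      intro T hT m hm h5 hτ hM
      have e1 := explored_flagScan (d₀ := d₀) hm (hτ T hT) hM
      obtain ⟨a1, a2, a3, a4⟩ := hkeep (flagScan 30 (negSumTest (21 + 2 * r) (20 + 2 * T)))
        (fun a h => by rw [flagScan_writesNat] at h; tauto)
        (fun a h => (flagScan_writesReal h).elim) m hm h5 hτ hM
      set m₁ := (flagScan 30 (negSumTest (21 + 2 * r) (20 + 2 * T))).exec m with hm₁
      obtain ⟨b1, b2, b3, -⟩ := hkeep (stepCmd r T)
        (fun a h => by
          rw [stepCmd_writesNat] at h
          rcases h with h | h | h | h | h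
          · omega
          · omega
          · omega
          · omega
          · exact Or.inr (Or.inr (Or.inr (Or.inr (Or.inr (Or.inr ⟨r + 1, by omega, h⟩))))))
        (fun a h => by
          rw [stepCmd_writesReal] at h
          rcases h with h | h
          · exact Or.inr (Or.inl h)
          · exact Or.inr (Or.inr ⟨r + 1, by omega, h⟩)) m₁ a1 a2 a3 a4
      have b4 := mat_stepCmd (n := n) (r := r) (T := T) a1
      rw [a2, a3 T hT, a4] at b4
      have e2 : Explored d₀ τ M (fun _ => False) (fun _ _ => False) m₁ ((stepCmd r T).exec m₁) :=
        .of_eq (mat_exec _ n (by simp [stepCmd_writesNat]; omega) (by simp [stepCmd_writesReal]; omega))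
          (exec_nat_of_not_writes (by simp [stepCmd_writesNat]; omega) _)
      set m₂ := (stepCmd r T).exec m₁ with hm₂
      have e3 := (ih (r := r + 1) (hL.erase T) (by
        have h1 := List.length_erase_of_mem hT
        have h2 := List.length_pos_of_mem hT
        omega) b1 b2
        (fun T' hT' => b3 T' (List.mem_of_mem_erase hT')) b4).cons
      refine ((e1.trans e2).trans e3).congr (fun l => ?_) (fun l T' => ?_)
      · simp
      · simp
    have key : ∀ L' : List ℕ, (∀ T ∈ L', T ∈ L) → ∀ m : Memory, m.nat 0 0 0 = n → m.mat n 5 = d₀ →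
        (∀ T ∈ L, m.mat n (20 + 2 * T) = τ T) → m.mat n (21 + 2 * r) = M →
        Explored d₀ τ M (fun l => ∃ T ∈ L', ∃ l', l = T :: l' ∧ l'.Nodup ∧ ∀ T' ∈ l', T' ∈ L.erase T)
          (fun l T' => ∃ T ∈ L', (l = [] ∧ T' = T) ∨ ∃ l', l = T :: l' ∧ l'.Nodup ∧
            (∀ T' ∈ l', T' ∈ L.erase T) ∧ T' ∈ L.erase T ∧ T' ∉ l') m
          ((L'.foldr f skip).exec m) := by
      intro L' hL'
      induction L' with
      | nil =>
        intro m _ _ _ _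
        exact (Explored.of_eq rfl rfl).congr (by simp) (by simp)
      | cons T L' ihL =>
        intro m hm h5 hτ hM
        have e1 := hone T (hL' T (by simp)) m hm h5 hτ hM
        obtain ⟨a1, a2, a3, a4⟩ := hkeep (seq (flagScan 30 (negSumTest (21 + 2 * r) (20 + 2 * T)))
          (seq (stepCmd r T) (seqCmd k (r + 1) (L.erase T))))
          (fun a h => by
            rcases h with h | h | h
            · rw [flagScan_writesNat] at h
              omega
            · rw [stepCmd_writesNat] at h
              rcases h with h | h | h | h | h
              · omega
              · omega
              · omega
              · omega
              · exact Or.inr (Or.inr (Or.inr (Or.inr (Or.inr (Or.inr ⟨r + 1, by omega, h⟩)))))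
            · rcases seqCmd_writesNat h with h | h | h | h | h | h | ⟨q, h1, h2⟩
              · omega
              · omega
              · omega
              · omega
              · omega
              · omega
              · exact Or.inr (Or.inr (Or.inr (Or.inr (Or.inr (Or.inr ⟨q, by omega, h2⟩))))))
          (fun a h => by
            rcases h with h | h | h
            · exact (flagScan_writesReal h).elim
            · rw [stepCmd_writesReal] at h
              rcases h with h | h
              · exact Or.inr (Or.inl h)
              · exact Or.inr (Or.inr ⟨r + 1, by omega, h⟩)
            · rcases seqCmd_writesReal h with h | h | ⟨q, h1, h2⟩
              · exact Or.inl h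
              · exact Or.inr (Or.inl h)
              · exact Or.inr (Or.inr ⟨q, by omega, h2⟩)) m hm h5 hτ hM
        have e2 := ihL (fun T' h => hL' T' (by simp [h])) _ a1 a2 a3 a4
        refine (e1.trans e2).congr (fun l => ?_) (fun l T' => ?_)
        · simp
        · simp
    obtain ⟨a1, a2, a3, a4⟩ := hkeep (relax trueTest 7 (21 + 2 * r) 5)
      (fun a h => by rw [relax_writesNat] at h; omega)
      (fun a h => by rw [relax_writesReal] at h; omega) m hm h5 hτ hM
    refine ((explored_relax (τ := τ) hm h5 hM).trans (key L (fun _ h => h) _ a1 a2 a3 a4)).congr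
      (fun l => ?_) (fun l T' => ?_)
    · cases l with
      | nil => simp
      | cons T l =>
        rw [nodup_cons_subset_iff hL]
        simp
    · cases l with
      | nil => simp
      | cons T l =>
        rw [← and_assoc, nodup_cons_subset_iff hL]
        simp [hL.mem_erase_iff]
        tauto

end Cmd

end

section

open Cmd

variable {n : ℕ} {D : Digraph (Fin n)} {c : Fin n → Fin n → ℝ}

/-! ### All matrices -/

/-- Compute the matrix of reachability, the blocks, and the distances without negative arcs. -/
def blockCmd : Cmd :=
  seq reachCmd (seq sepCmd (seq forestCmd (seq ordCmd (flagScan 30 (negSumTest 5 5)))))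

/-- Compute the matrices of the negative trees. -/
def labelledTreesCmd (γ : ℕ) : Cmd :=
  seq treeCmd (seq rootCmd (seq labelCmd (tausCmd γ)))

theorem blockCmd_spec {m : Memory} (h : HasInput D c m) (hloop : ∀ v, ¬ D.Adj v v)
    (h24 : ∀ u v : Fin n, m.nat 24 u v = 0) (h30 : m.nat 30 0 0 = 0) :
    HasBlocks D c (blockCmd.exec m) ∧
    (∀ s v P, Wk (OrdArc D c) s v P → P.Nodup → (blockCmd.exec m).mat n 5 s v ≤ walkWeight c P) ∧
    (∀ s v, (blockCmd.exec m).mat n 5 s v ≠ ⊤ → ∃ p, Wk (OrdArc D c) s v p ∧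
      (walkWeight c p : WithTop ℝ) ≤ (blockCmd.exec m).mat n 5 s v) ∧
    ((blockCmd.exec m).nat 30 0 0 ≠ 0 ↔ ¬ NegForest D c ∨
      ∃ i j, (blockCmd.exec m).mat n 5 i j + (blockCmd.exec m).mat n 5 j i < 0) := by
  simp only [blockCmd, exec]
  have h1 := hasStrong_reachCmd h
  have e24 : ∀ u v : Fin n, (reachCmd.exec m).nat 24 u v = 0 := by
    intro u v
    rw [exec_nat_of_not_writes (by simp [reachCmd]), h24]
  have e30 : (reachCmd.exec m).nat 30 0 0 = 0 := by
    rw [exec_nat_of_not_writes (by simp [reachCmd]), h30]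
  set m₁ := reachCmd.exec m
  have h2 := hasBlocks_sepCmd h1 e24
  have f30 : (sepCmd.exec m₁).nat 30 0 0 = 0 := by
    rw [exec_nat_of_not_writes (by simp [sepCmd, WritesNat]), e30]
  set m₂ := sepCmd.exec m₁
  have h3 : HasBlocks D c (forestCmd.exec m₂) := h2.sameOff (sameOff_exec _ m₂)
    (by simp [forestCmd, WritesNat]) (by simp [forestCmd, WritesReal])
  have g30 := nat_forestCmd h2.toHasInput hloop
  set m₃ := forestCmd.exec m₂
  have h4 : HasBlocks D c (ordCmd.exec m₃) := h3.sameOff (sameOff_exec _ m₃)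
    (by simp [ordCmd]) (by simp [ordCmd])
  have hord := ordCmd_spec h3.toHasInput hloop
  have i30 : (ordCmd.exec m₃).nat 30 0 0 = m₃.nat 30 0 0 := by
    rw [exec_nat_of_not_writes (by simp [ordCmd])]
  set m₄ := ordCmd.exec m₃
  have h5 : HasBlocks D c ((flagScan 30 (negSumTest 5 5)).exec m₄) := h4.sameOff
    (sameOff_exec _ m₄) (by simp) (by simp)
  have e5 := mat_exec (P := flagScan 30 (negSumTest 5 5)) m₄ n (a := 5) (by simp) (by simp)
  rw [e5]
  refine ⟨h5, hord.1, hord.2, ?_⟩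
  rw [nat_flagScan (by decide) (by decide) (by decide) h4.size
    (β := fun i j => m₄.mat n 5 i j + m₄.mat n 5 j i < 0), i30, g30, f30]
  · simp
  · intro m' i j hs h4 h6
    rw [negSumTest_holds h4 h6, Memory.mat, Memory.mat, hs.wt (by simp) (by simp)]
    rfl

theorem not_tausCmd_writesNat {γ a : ℕ} (h4 : a ≠ 4) (h6 : a ≠ 6) (ha : a < 41 ∨ a % 4 = 3) :
    ¬ (tausCmd γ).WritesNat a := by
  intro hw
  rcases tausCmd_writesNat hw with h | h | ⟨T, h⟩ <;> omega

theorem not_tausCmd_writesReal {γ a : ℕ} (ha : a < 20) : ¬ (tausCmd γ).WritesReal a := by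
  intro hw
  obtain ⟨T, h⟩ := tausCmd_writesReal hw
  omega

theorem labelledTreesCmd_keeps_nat {γ a : ℕ} (ha : a = 0 ∨ a = 1 ∨ a = 2 ∨ a = 3 ∨ a = 5 ∨ a = 11 ∨
    a = 24 ∨ a = 30) : ¬ (labelledTreesCmd γ).WritesNat a := by
  rintro (h | h | h | h)
  · simp only [treeCmd, closure_writesNat] at h
    omega
  · simp only [rootCmd, WritesNat, mark_writesNat, false_or] at h
    omega
  · simp only [labelCmd, isRootCmd, WritesNat, mark_writesNat, false_or] at h
    omega
  · exact not_tausCmd_writesNat (by omega) (by omega) (by omega) h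

theorem labelledTreesCmd_keeps_real {γ a : ℕ} (ha : a < 6) :
    ¬ (labelledTreesCmd γ).WritesReal a := by
  rintro (h | h | h | h)
  · simp only [treeCmd, closure_writesReal] at h
    omega
  · simp [rootCmd, WritesReal] at h
  · simp [labelCmd, isRootCmd, WritesReal] at h
  · exact not_tausCmd_writesReal (by omega) h

open Classical in
theorem labelledTreesCmd_spec {m : Memory} (h : HasBlocks D c m) (hloop : ∀ v, ¬ D.Adj v v) (γ : ℕ)
    (h26 : ∀ u v : Fin n, m.nat 26 u v = 0) (h28 : ∀ u v : Fin n, m.nat 28 u v = 0)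
    (hle : ∀ s v P, Wk (OrdArc D c) s v P → P.Nodup → m.mat n 5 s v ≤ walkWeight c P)
    (hsound : ∀ s v, m.mat n 5 s v ≠ ⊤ → ∃ p, Wk (OrdArc D c) s v p ∧
      (walkWeight c p : WithTop ℝ) ≤ m.mat n 5 s v) :
    ∃ rt ρ lab, MatrixSpec D c γ (m.mat n 5) rt
      (fun T => if T < γ then ((labelledTreesCmd γ).exec m).mat n (20 + 2 * T) else fun _ _ => ⊤)
      ρ lab := by
  simp only [labelledTreesCmd, exec]
  have h1 := hasTrees_treeCmd h hloop
  have hrt := treeCmd_spec h.toHasInput hloop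
  have e26 : ∀ u v : Fin n, (treeCmd.exec m).nat 26 u v = 0 := by
    intro u v
    rw [exec_nat_of_not_writes (by simp [treeCmd]), h26]
  have e28 : ∀ u v : Fin n, (treeCmd.exec m).nat 28 u v = 0 := by
    intro u v
    rw [exec_nat_of_not_writes (by simp [treeCmd]), h28]
  set m₁ := treeCmd.exec m
  obtain ⟨ρ, h2, hρ⟩ := hasRoots_rootCmd h1 e26
  have f28 : ∀ u v : Fin n, (rootCmd.exec m₁).nat 28 u v = 0 := by
    intro u v
    rw [exec_nat_of_not_writes (by simp [rootCmd, WritesNat]), e28]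
  have f6 : (rootCmd.exec m₁).mat n 6 = m₁.mat n 6 :=
    mat_exec _ n (by simp [rootCmd, WritesNat]) (by simp [rootCmd, WritesReal])
  set m₂ := rootCmd.exec m₁
  have hlab := labelCmd_spec h2 f28
  have h3 : HasTrees D c (labelCmd.exec m₂) := h2.toHasTrees.sameOff (sameOff_exec _ m₂)
    (by simp [labelCmd, isRootCmd, WritesNat]) (by simp [labelCmd, isRootCmd, WritesReal])
  have g6 : (labelCmd.exec m₂).mat n 6 = m₂.mat n 6 :=
    mat_exec _ n (by simp [labelCmd, isRootCmd, WritesNat]) (by simp [labelCmd, isRootCmd, WritesReal])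
  set m₃ := labelCmd.exec m₂
  have hτ := tausCmd_spec h3 γ
  refine ⟨m₁.mat n 6, ρ, fun x y => m₃.nat 28 x y, hle, hsound, hrt.1, hrt.2, ?_, ?_, ?_, hρ,
    fun x y _ => hlab x y⟩
  · intro T hT x y r hxy hl hr
    simp only [if_pos hT]
    rw [hτ T hT x y, if_pos ⟨hxy, hl⟩]
    rw [← f6, ← g6, Memory.mat] at hr
    have hne : m₃.wt 6 y x ≠ ⊤ := by
      rw [hr]
      exact WithTop.coe_ne_top
    rw [Memory.wt_of_ne (Memory.wt_ne_top.1 hne)] at hr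
    rw [WithTop.coe_inj.1 hr]
  · intro T hT x y hxy
    simp only [if_pos hT] at hxy
    rw [hτ T hT x y] at hxy
    by_contra hne
    exact hxy (if_neg hne)
  · intro T hT x y
    simp only [if_neg (not_lt.2 hT)]

/-! ### Distances inside the blocks -/

/-- Go through all duplicate-free sequences of labels below `γ`. -/
def exploreCmd (γ : ℕ) : Cmd :=
  seq (clear 7) (seq (copy 21 5) (seqCmd γ 0 (List.range γ)))

theorem exploreCmd_keeps_nat {γ a : ℕ} (ha : a = 0 ∨ a = 1 ∨ a = 2 ∨ a = 3 ∨ a = 5 ∨ a = 24) :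
    ¬ (exploreCmd γ).WritesNat a := by
  rintro (h | h | h)
  · simp only [clear_writesNat] at h
    omega
  · simp only [copy_writesNat] at h
    omega
  · rcases seqCmd_writesNat h with h | h | h | h | h | h | ⟨q, h1, h2⟩ <;> omega

theorem exploreCmd_keeps_real {γ : ℕ} : ¬ (exploreCmd γ).WritesReal 0 := by
  rintro (h | h | h)
  · simp at h
  · simp at h
  · rcases seqCmd_writesReal h with h | h | ⟨q, h1, h2⟩ <;> omega

/-- Test whether the weights are nearly conservative, and compute the distances inside the
blocks. -/
def insideCmd (γ : ℕ) : Cmd := seq blockCmd (seq (labelledTreesCmd γ) (exploreCmd γ))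

theorem blockCmd_keeps_nat {a : ℕ} (ha : a = 0 ∨ a = 2 ∨ a = 3 ∨ a = 26 ∨ a = 28) :
    ¬ blockCmd.WritesNat a := by
  simp only [blockCmd, reachCmd, sepCmd, forestCmd, ordCmd, WritesNat, closure_writesNat,
    mark_writesNat, flagScan_writesNat]
  omega

theorem insideCmd_keeps_nat {γ a : ℕ} (ha : a = 0 ∨ a = 2 ∨ a = 3) :
    ¬ (insideCmd γ).WritesNat a := by
  rintro (h | h | h)
  · exact blockCmd_keeps_nat (by omega) h
  · exact labelledTreesCmd_keeps_nat (by omega) h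
  · exact exploreCmd_keeps_nat (by omega) h

theorem insideCmd_spec (γ : ℕ) (hloop : ∀ v, ¬ D.Adj v v) (hγ : HasFewNegTrees D c γ) {m : Memory}
    (h : HasInput D c m) (hzero : ∀ a, 2 ≤ a → ∀ i j, m.nat a i j = 0) :
    HasBlocks D c ((insideCmd γ).exec m) ∧
    (((insideCmd γ).exec m).nat 30 0 0 = 0 ↔ NonnegLongCycles D.Adj c) ∧
    (NonnegLongCycles D.Adj c → ∀ s t,
      (SameBlock D s t → ∀ P, Wk D.Adj s t P → P.Nodup →
        ((insideCmd γ).exec m).mat n 7 s t ≤ walkWeight c P) ∧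
      (((insideCmd γ).exec m).mat n 7 s t ≠ ⊤ → ∃ p, Wk D.Adj s t p ∧ p.Nodup ∧
        (walkWeight c p : WithTop ℝ) ≤ ((insideCmd γ).exec m).mat n 7 s t)) := by
  simp only [insideCmd, exec]
  obtain ⟨h1, hle, hsound, hflag⟩ := blockCmd_spec h hloop (fun u v => hzero 24 (by decide) u v)
    (hzero 30 (by decide) 0 0)
  have e26 : ∀ u v : Fin n, (blockCmd.exec m).nat 26 u v = 0 := fun u v => by
    rw [exec_nat_of_not_writes (blockCmd_keeps_nat (by decide)), hzero 26 (by decide)]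
  have e28 : ∀ u v : Fin n, (blockCmd.exec m).nat 28 u v = 0 := fun u v => by
    rw [exec_nat_of_not_writes (blockCmd_keeps_nat (by decide)), hzero 28 (by decide)]
  set m₁ := blockCmd.exec m
  obtain ⟨rt, ρ, lab, hM⟩ := labelledTreesCmd_spec h1 hloop γ e26 e28 hle hsound
  have h2 : HasBlocks D c ((labelledTreesCmd γ).exec m₁) := h1.sameOff (sameOff_exec _ m₁)
    (fun a ha => labelledTreesCmd_keeps_nat (by
      simp only [List.mem_cons, List.not_mem_nil, or_false] at ha; omega))
    (labelledTreesCmd_keeps_real (by decide))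
  have f5 : ((labelledTreesCmd γ).exec m₁).mat n 5 = m₁.mat n 5 :=
    mat_exec _ n (labelledTreesCmd_keeps_nat (by decide)) (labelledTreesCmd_keeps_real (by decide))
  have f30 : ((labelledTreesCmd γ).exec m₁).nat 30 = m₁.nat 30 :=
    exec_nat_of_not_writes (labelledTreesCmd_keeps_nat (by decide)) _
  set m₂ := (labelledTreesCmd γ).exec m₁
  have h3 : HasBlocks D c ((exploreCmd γ).exec m₂) := h2.sameOff (sameOff_exec _ m₂)
    (fun a ha => exploreCmd_keeps_nat (by
      simp only [List.mem_cons, List.not_mem_nil, or_false] at ha; omega)) exploreCmd_keeps_real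
  refine ⟨h3, ?_⟩
  simp only [exploreCmd, exec] at h3 ⊢
  have g7 : ∀ i j : Fin n, ((clear 7).exec m₂).mat n 7 i j = ⊤ := mat_clear h2.size
  have g0 : ((clear 7).exec m₂).nat 0 0 0 = n := by
    rw [exec_nat_of_not_writes (by simp), h2.size]
  have gT : ∀ a, a ≠ 7 → ((clear 7).exec m₂).mat n a = m₂.mat n a := fun a ha =>
    mat_exec _ n (by simp; omega) (by simp [ha])
  have g30 : ((clear 7).exec m₂).nat 30 = m₂.nat 30 := exec_nat_of_not_writes (by simp) _
  set m₃ := (clear 7).exec m₂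
  have k21 : ((copy 21 5).exec m₃).mat n 21 = m₃.mat n 5 := mat_copy g0 (by decide)
  have k0 : ((copy 21 5).exec m₃).nat 0 0 0 = n := by
    rw [exec_nat_of_not_writes (by simp), g0]
  have kT : ∀ a, a ≠ 21 → ((copy 21 5).exec m₃).mat n a = m₃.mat n a := fun a ha =>
    mat_exec _ n (by simp; omega) (by simp [ha])
  have k30 : ((copy 21 5).exec m₃).nat 30 = m₃.nat 30 := exec_nat_of_not_writes (by simp) _
  set m₄ := (copy 21 5).exec m₃
  have hE := explored_seqCmd (n := n) (k := γ) (r := 0) (L := List.range γ) List.nodup_range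
    (by simp) k0 (d₀ := m₁.mat n 5) (τ := fun T => if T < γ then m₂.mat n (20 + 2 * T)
      else fun _ _ => ⊤) (M := m₁.mat n 5)
    (by rw [kT 5 (by decide), gT 5 (by decide), f5])
    (fun T hT => by
      simp only [if_pos (List.mem_range.1 hT)]
      rw [kT _ (by omega), gT _ (by omega)])
    (by rw [k21, gT 5 (by decide), f5])
  have m7 : ∀ i j : Fin n, m₄.mat n 7 i j = ⊤ := fun i j => by rw [kT 7 (by decide), g7]
  constructor
  · rw [← not_iff_not, ← Ne, hE.flag, k30, g30, f30, hflag]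
    by_cases hF : NegForest D c
    · rw [hM.tests_iff hloop hF hγ]
      simp only [hF, not_true, false_or, List.mem_range]
      rw [not_and_or]
      push Not
      refine or_congr Iff.rfl ?_
      constructor
      · rintro ⟨l, T, ⟨a1, a2, a3, a4⟩, x, y, a5⟩
        exact ⟨l, T, a1, a2, a3, a4, x, y, a5⟩
      · rintro ⟨l, T, a1, a2, a3, a4, x, y, a5⟩
        exact ⟨l, T, ⟨a1, a2, a3, a4⟩, x, y, a5⟩
    -- If `F` is not a forest, the forest test has already set the flag, and the matrices need have
    -- no meaning.
    · exact iff_of_true (Or.inl (Or.inl hF)) fun hN => hF (negForest_of_nonnegLongCycles hN)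
  · intro hD s t
    constructor
    · intro hst P hP hPn
      obtain ⟨l, a1, a2, a3⟩ := hM.exists_seq_le hloop hγ hD hst hP hPn
      exact (hE.le_seq l ⟨a1, fun T hT => List.mem_range.2 (a2 T hT)⟩ s t).trans a3
    · intro hne
      rcases hE.eq s t with e | ⟨l, ⟨a1, -⟩, e⟩
      · rw [e, m7] at hne
        exact absurd rfl hne
      · rw [e] at hne ⊢
        exact hM.exists_path_le hloop hD a1 hne

end

section

open Cmd

variable {n : ℕ} {D : Digraph (Fin n)} {c : Fin n → Fin n → ℝ}

/-! ### Concatenation of paths -/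

/-- If `x` is finite, then some path from `s` to `t` has length at most `x`. -/
def PathBound (D : Digraph (Fin n)) (c : Fin n → Fin n → ℝ) (s t : Fin n) (x : WithTop ℝ) : Prop :=
  x ≠ ⊤ → ∃ p, Wk D.Adj s t p ∧ p.Nodup ∧ (walkWeight c p : WithTop ℝ) ≤ x

theorem Wk.reflTransGen_of_mem {V : Type*} {E : V → V → Prop} {s t z : V} {p : List V}
    (h : Wk E s t p) (hz : z ∈ p) : Relation.ReflTransGen E s z ∧ Relation.ReflTransGen E z t := by
  obtain ⟨l₁, l₂, rfl⟩ := List.append_of_mem hz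
  obtain ⟨h1, h2⟩ := wk_split.1 h
  exact ⟨reflTransGen_of_wk h1, reflTransGen_of_wk h2⟩

theorem Wk.sameStrong_of_forall {E : Fin n → Fin n → Prop} {s t : Fin n} {p : List (Fin n)}
    (h : Wk E s t p) (hE : ∀ u v, E u v → SameStrong D u v) : SameStrong D s t := by
  have := reflTransGen_of_wk h
  clear h
  induction this with
  | refl => exact .refl _
  | tail _ h ih => exact ih.trans (hE _ _ h)

/-- A second common vertex of the two paths would connect `i` to `k` without `j`. So the
concatenation at a separator is itself a path, and no loop erasure is needed. -/
theorem PathBound.add_of_separated (hloop : ∀ v, ¬ D.Adj v v) {i j k : Fin n} {x y : WithTop ℝ}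
    (hik : SameStrong D i k) (hsep : ¬ ConnWithout D j i k) (hx : PathBound D c i j x)
    (hy : PathBound D c j k y) :
    PathBound D c i k (x + y) := by
  intro hxy
  rw [Ne, WithTop.add_eq_top, not_or] at hxy
  obtain ⟨p, hp, hpn, hpx⟩ := hx hxy.1
  obtain ⟨q, hq, hqn, hqy⟩ := hy hxy.2
  obtain ⟨h1, h2⟩ := hp.append (c := c) hq
  refine ⟨_, h1, ?_, ?_⟩
  · have hpr := reflTransGen_of_wk hp
    have hqr := reflTransGen_of_wk hq
    have hp' := hp.strongAdj hloop (hqr.trans hik.2)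
    have hq' := hq.strongAdj hloop (hik.2.trans hpr)
    obtain ⟨q', rfl⟩ := hq.exists_cons
    rw [List.nodup_cons] at hqn
    rw [List.tail_cons, List.nodup_append]
    refine ⟨hpn, hqn.2, ?_⟩
    rintro z hz _ hz' rfl
    have hzj : z ≠ j := by
      rintro rfl
      exact hqn.1 hz'
    obtain ⟨p₁, p₂, rfl⟩ := List.append_of_mem hz
    obtain ⟨q₁, q₂, rfl⟩ := List.append_of_mem hz'
    have a1 := (wk_split.1 hp').1
    have a2 := (wk_split (l₁ := j :: q₁).1 hq').2
    refine hsep ((a1.connWithout ?_).trans (a2.connWithout ?_))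
    · intro hj
      have hj1 : j ∈ p₁ := by simpa [Ne.symm hzj] using hj
      have hj2 : j ∈ z :: p₂ := (wk_split.1 hp).2.last_mem
      exact (List.nodup_append.1 hpn).2.2 j hj1 j hj2 rfl
    · intro hj
      exact hqn.1 (List.mem_append_right _ hj)
  · rw [h2, WithTop.coe_add]
    exact add_le_add hpx hqy

/-- A common vertex of the two paths would let `l` reach `j` and put both into one strong component.
-/
theorem PathBound.add_of_cross {i j l k : Fin n} {x y : WithTop ℝ} (hjl : D.Adj j l)
    (hns : ¬ SameStrong D j l) (hx : PathBound D c i j x)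
    (hy : PathBound D c l k y) : PathBound D c i k (x + (c j l + y)) := by
  intro hxy
  rw [Ne, WithTop.add_eq_top, WithTop.add_eq_top, not_or, not_or] at hxy
  obtain ⟨p, hp, hpn, hpx⟩ := hx hxy.1
  obtain ⟨q, hq, hqn, hqy⟩ := hy hxy.2.2
  obtain ⟨h1, h2⟩ := hp.append (c := c) (hq.cons (c := c) hjl).1
  rw [(hq.cons (c := c) hjl).2] at h2
  refine ⟨_, h1, ?_, ?_⟩
  · rw [List.tail_cons, List.nodup_append]
    refine ⟨hpn, hqn, ?_⟩
    rintro z hz _ hz' rfl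
    exact hns ⟨.single hjl, (hq.reflTransGen_of_mem hz').1.trans (hp.reflTransGen_of_mem hz).2⟩
  · rw [h2, WithTop.coe_add, WithTop.coe_add]
    exact add_le_add hpx (add_le_add le_rfl hqy)

/-! ### Distances inside the strong components -/

/-- Compute the distances inside the strong components. -/
def componentCmd : Cmd :=
  seq (fill 9 (.and (blockTest rowIdx colIdx) (finiteTest 7 rowIdx colIdx)) (.read 7 rowIdx colIdx))
    -- Relaxing through arbitrary middle vertices would be unsound, since concatenated paths may use
    -- a negative edge in both directions. Only the recorded separator of a pair is admitted.
    (for_ 12 (relax (.natEq (.read 24 rowIdx colIdx) (.add midIdx (.const 1))) 9 9 9))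

theorem componentCmd_writesNat {a : ℕ} : componentCmd.WritesNat a ↔
    a = 4 ∨ a = 6 ∨ a = 8 ∨ a = 12 ∨ a = 19 := by
  simp only [componentCmd, WritesNat, fill_writesNat, relax_writesNat]
  omega

theorem componentCmd_writesReal {a : ℕ} : componentCmd.WritesReal a ↔ a = 9 := by
  simp [componentCmd, WritesReal]

/-- After `r` rounds the entries are at most the lengths of the paths with up to `r + 1` vertices,
and `n` rounds cover all paths. -/
theorem componentCmd_spec (hloop : ∀ v, ¬ D.Adj v v) {m : Memory} (h : HasBlocks D c m)
    (hle : ∀ s t, SameBlock D s t → ∀ P, Wk D.Adj s t P → P.Nodup → m.mat n 7 s t ≤ walkWeight c P)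
    (hsound : ∀ s t, PathBound D c s t (m.mat n 7 s t)) :
    (∀ s t, SameStrong D s t → ∀ P, Wk D.Adj s t P → P.Nodup →
      (componentCmd.exec m).mat n 9 s t ≤ walkWeight c P) ∧
    (∀ s t, PathBound D c s t ((componentCmd.exec m).mat n 9 s t)) := by
  set m₁ := (fill 9 (.and (blockTest rowIdx colIdx) (finiteTest 7 rowIdx colIdx))
    (.read 7 rowIdx colIdx)).exec m with hm₁
  have h1 : HasBlocks D c m₁ := h.sameOff (sameOff_exec _ m) (by simp) (by simp)
  have hfill := mat_fill_read (a := 9) (b := 7)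
    (t := .and (blockTest rowIdx colIdx) (finiteTest 7 rowIdx colIdx)) h.size (by decide)
    (β := fun i j => SameBlock D i j ∧ m.mat n 7 i j ≠ ⊤) (fun i j h => h.2)
    (fun m' i j hs h4 h6 => by
      have h' : HasBlocks D c m' := h.sameOff hs (by simp) (by simp)
      simp only [Test.holds, blockTest_holds h' (i := rowIdx) (j := colIdx) h4 h6, finiteTest_holds,
        NatExpr.val_var, h4, h6, Memory.mat]
      rw [hs.wt (by simp) (by simp)])
  rw [← hm₁] at hfill
  have e1 : ∀ i j, SameBlock D i j → m₁.mat n 9 i j ≤ m.mat n 7 i j := by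
    intro i j hij
    by_cases hne : m.mat n 7 i j = ⊤
    · rw [hne]
      exact le_top
    · exact ((hfill i j).1 ⟨hij, hne⟩).le
  have e2 : ∀ i j, m₁.mat n 9 i j ≠ ⊤ → m₁.mat n 9 i j = m.mat n 7 i j := by
    intro i j hne
    by_cases hβ : SameBlock D i j ∧ m.mat n 7 i j ≠ ⊤
    · exact (hfill i j).1 hβ
    · exact absurd ((hfill i j).2 hβ) hne
  have key := for_inv (v := 12) (P := relax (.natEq (.read 24 rowIdx colIdx)
      (.add midIdx (.const 1))) 9 9 9) (m := m₁)
    (fun r m' => (∀ s t, m'.mat n 9 s t ≤ m₁.mat n 9 s t) ∧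
      (∀ s t, SameStrong D s t → ∀ P, Wk D.Adj s t P → P.Nodup → P.length ≤ r + 1 →
        m'.mat n 9 s t ≤ walkWeight c P) ∧
      ∀ s t, PathBound D c s t (m'.mat n 9 s t))
    (by
      have e0 : (m₁.writeNat 12 0 0 0).mat n 9 = m₁.mat n 9 := by
        funext i j
        rw [Memory.mat, Memory.wt_writeNat _ (by decide)]
        rfl
      rw [e0]
      refine ⟨fun _ _ => le_rfl, ?_, fun s t hne => ?_⟩
      · intro s t _ P hP hPn hlen
        obtain ⟨P', rfl⟩ := hP.exists_cons
        obtain rfl : P' = [] := List.length_eq_zero_iff.1 (by simpa using hlen)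
        obtain ⟨-, rfl⟩ := wk_singleton.1 hP
        exact (e1 _ _ (.refl _)).trans (hle _ _ (.refl _) _ hP hPn)
      · have e3 := e2 s t hne
        rw [e3] at hne ⊢
        exact hsound s t hne)
    (by
      rintro r m' hr hv hs ⟨i1, i2, i3⟩
      have h2 : HasBlocks D c m' := h1.sameOff hs (by simp [WritesNat]) (by simp [WritesReal])
      have hrel := relaxed_relax (dst := 9) (A := 9) (B := 9)
        (b := .natEq (.read 24 rowIdx colIdx) (.add midIdx (.const 1)))
        (β := fun i j k => m'.nat 24 i k = j + 1) h2.size (by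
          intro m'' i j k hs' _ _ _ h4 h8 h6
          simp only [Test.holds, NatExpr.val, h4, h6, h8]
          rw [hs'.1 24 (by simp)])
      set m'' := (relax (.natEq (.read 24 rowIdx colIdx) (.add midIdx (.const 1))) 9 9 9).exec m'
      have e0 : (m''.writeNat 12 0 0 (r + 1)).mat n 9 = m''.mat n 9 := by
        funext i j
        rw [Memory.mat, Memory.wt_writeNat _ (by decide)]
        rfl
      rw [e0]
      refine ⟨fun s t => (hrel.le 9 s t).trans (i1 s t), ?_, fun s t => ?_⟩
      · intro s t hst P hP hPn hlen
        by_cases hb : SameBlock D s t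
        · exact (hrel.le 9 s t).trans ((i1 s t).trans ((e1 s t hb).trans (hle s t hb P hP hPn)))
        -- The recorded separator lies on the path and differs from both ends, so it cuts the path
        -- into two parts with fewer vertices.
        · obtain ⟨w, hw⟩ := Nat.exists_eq_succ_of_ne_zero (mt (h2.sep_zero s t hst).1 hb)
          obtain ⟨z, rfl, hzs, hzt, -, hsep⟩ := h2.sep_succ s t w hw
          have hz : z ∈ P := by
            by_contra hz
            exact hsep ((hP.strongAdj hloop hst.2).connWithout hz)
          obtain ⟨P₁, P₂, rfl⟩ := List.append_of_mem hz
          obtain ⟨a1, a2⟩ := wk_split.1 hP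
          have hsz : SameStrong D s z :=
            ⟨reflTransGen_of_wk a1, (reflTransGen_of_wk a2).trans hst.2⟩
          have b1 : P₁ ≠ [] := by
            rintro rfl
            exact hzs (by simpa [Wk] using a1.1)
          have b2 : P₂ ≠ [] := by
            rintro rfl
            exact hzt (wk_singleton.1 a2).2
          have c1 := List.length_pos_iff.2 b1
          have c2 := List.length_pos_iff.2 b2
          simp only [List.length_append, List.length_cons] at hlen
          rw [walkWeight_split, WithTop.coe_add]
          refine (hrel.done s z t ⟨s.2, z.2, t.2⟩ hw).trans (add_le_add ?_ ?_)
          · refine i2 s z hsz _ a1 (hPn.sublist (by simp)) ?_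
            simp only [List.length_append, List.length_cons, List.length_nil]
            omega
          · refine i2 z t (hsz.symm.trans hst) _ a2 (hPn.sublist (List.sublist_append_right _ _)) ?_
            simp only [List.length_cons]
            omega
      · have hsd := hrel.sound (fun a x y w => a = 9 → ∀ (hx : x < n) (hy : y < n),
          PathBound D c ⟨x, hx⟩ ⟨y, hy⟩ w) ?_ ?_ 9 s t s.2 t.2
          rfl s.2 t.2
        · exact hsd
        · intro i j k _ hj _ hβ x y hx hy _ hi hk
          obtain ⟨z, hz, -, -, hik, hsep⟩ := h2.sep_succ ⟨i, hi⟩ ⟨k, hk⟩ j hβ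
          obtain rfl : z = ⟨j, hj⟩ := Fin.ext hz
          exact PathBound.add_of_separated hloop hik hsep (hx rfl hi hj) (hy rfl hj hk)
        · rintro a x y _ _ rfl hx hy
          exact i3 ⟨x, hx⟩ ⟨y, hy⟩)
  rw [h1.size] at key
  obtain ⟨-, k2, k3⟩ := key
  exact ⟨fun s t hst P hP hPn => k2 s t hst P hP hPn (by
    have := hPn.length_le_card
    rw [Fintype.card_fin] at this
    omega), k3⟩

/-! ### Distances -/

/-- Compute the distances from the distances inside the strong components. -/
def crossCmd : Cmd :=
  seq (fill 10 (.and (adjTest rowIdx colIdx) (.not (strongTest rowIdx colIdx)))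
      (.read 0 rowIdx colIdx))
    -- Matrix `11` holds an arc between two components followed by a path bounded in matrix `9`;
    -- matrix `12` is extended by such pieces at its end.
    (seq (mulCmd 11 10 9) (seq (copy 12 9) (for_ 12 (relax trueTest 12 12 11))))

theorem crossCmd_writesNat {a : ℕ} : crossCmd.WritesNat a ↔
    a = 4 ∨ a = 6 ∨ a = 8 ∨ a = 12 ∨ a = 21 ∨ a = 23 ∨ a = 25 := by
  simp only [crossCmd, WritesNat, fill_writesNat, relax_writesNat, mulCmd_writesNat, copy_writesNat]
  omega

theorem crossCmd_spec {m : Memory} (h : HasStrong D c m)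
    (hle : ∀ s t, SameStrong D s t → ∀ P, Wk D.Adj s t P → P.Nodup →
      m.mat n 9 s t ≤ walkWeight c P)
    (hsound : ∀ s t, PathBound D c s t (m.mat n 9 s t)) :
    (∀ s t P, Wk D.Adj s t P → P.Nodup → (crossCmd.exec m).mat n 12 s t ≤ walkWeight c P) ∧
    (∀ s t, PathBound D c s t ((crossCmd.exec m).mat n 12 s t)) := by
  classical
  simp only [crossCmd, exec]
  have e10 := mat_fill (dst := 10)
    (b := .and (adjTest rowIdx colIdx) (.not (strongTest rowIdx colIdx)))
    (e := .read 0 rowIdx colIdx) h.size (β := fun i j => D.Adj i j ∧ ¬ SameStrong D i j) (ε := c)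
    (fun m' i j hs h4 h6 => by
      have h' : HasStrong D c m' := h.sameOff hs (by simp) (by simp)
      refine ⟨?_, fun hij => ?_⟩
      · simp only [Test.holds, adjTest_holds h'.toHasInput (i := rowIdx) (j := colIdx) h4 h6,
          strongTest_holds h' (i := rowIdx) (j := colIdx) h4 h6]
      · simp only [RealExpr.val, NatExpr.val_var, h4, h6]
        exact h'.weight i j hij.1)
  have f0 : ((fill 10 (.and (adjTest rowIdx colIdx) (.not (strongTest rowIdx colIdx)))
      (.read 0 rowIdx colIdx)).exec m).nat 0 0 0 = n := by
    rw [exec_nat_of_not_writes (by simp), h.size]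
  have f9 : ((fill 10 (.and (adjTest rowIdx colIdx) (.not (strongTest rowIdx colIdx)))
      (.read 0 rowIdx colIdx)).exec m).mat n 9 = m.mat n 9 := mat_exec _ n (by simp) (by simp)
  set m₁ := (fill 10 (.and (adjTest rowIdx colIdx) (.not (strongTest rowIdx colIdx)))
      (.read 0 rowIdx colIdx)).exec m
  have g11 := mat_mulCmd (dst := 11) (A := 10) (B := 9) f0 (by decide) (by decide)
  have g0 : ((mulCmd 11 10 9).exec m₁).nat 0 0 0 = n := by
    rw [exec_nat_of_not_writes (by simp), f0]
  have g9 : ((mulCmd 11 10 9).exec m₁).mat n 9 = m₁.mat n 9 := mat_exec _ n (by simp) (by simp)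
  set m₂ := (mulCmd 11 10 9).exec m₁
  have k12 : ((copy 12 9).exec m₂).mat n 12 = m₂.mat n 9 := mat_copy g0 (by decide)
  have k0 : ((copy 12 9).exec m₂).nat 0 0 0 = n := by
    rw [exec_nat_of_not_writes (by simp), g0]
  have k11 : ((copy 12 9).exec m₂).mat n 11 = m₂.mat n 11 := mat_exec _ n (by simp) (by simp)
  set m₃ := (copy 12 9).exec m₂
  rw [g9, f9] at k12
  rw [g11, f9] at k11
  have hX : ∀ j l k, D.Adj j l → ¬ SameStrong D j l → m₃.mat n 11 j k ≤ c j l + m.mat n 9 l k := by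
    intro j l k hjl hns
    rw [k11]
    refine (minPlus_le _ _ j l k).trans (add_le_add (le_of_eq ?_) le_rfl)
    rw [e10, if_pos ⟨hjl, hns⟩]
  have hX' : ∀ j k, m₃.mat n 11 j k ≠ ⊤ → ∃ l, D.Adj j l ∧ ¬ SameStrong D j l ∧
      m₃.mat n 11 j k = c j l + m.mat n 9 l k := by
    intro j k hne
    obtain ⟨l, hl⟩ := exists_minPlus_eq (m₁.mat n 10) (m.mat n 9) j k
    rw [k11, hl] at hne ⊢
    rw [e10] at hne ⊢
    rw [Ne, WithTop.add_eq_top, not_or] at hne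
    by_cases hβ : D.Adj j l ∧ ¬ SameStrong D j l
    · exact ⟨l, hβ.1, hβ.2, by rw [if_pos hβ]⟩
    · exact absurd (if_neg hβ) hne.1
  have key := for_inv (v := 12) (P := relax trueTest 12 12 11) (m := m₃)
    (fun r m' => (∀ s t, m'.mat n 12 s t ≤ m.mat n 9 s t) ∧
      (∀ s t P, Wk D.Adj s t P → P.Nodup → P.length ≤ r + 1 →
        m'.mat n 12 s t ≤ walkWeight c P) ∧ ∀ s t, PathBound D c s t (m'.mat n 12 s t))
    (by
      have e0 : (m₃.writeNat 12 0 0 0).mat n 12 = m₃.mat n 12 := by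
        funext i j
        rw [Memory.mat, Memory.wt_writeNat _ (by decide)]
        rfl
      rw [e0, k12]
      refine ⟨fun _ _ => le_rfl, ?_, hsound⟩
      intro s t P hP hPn hlen
      obtain ⟨P', rfl⟩ := hP.exists_cons
      obtain rfl : P' = [] := List.length_eq_zero_iff.1 (by simpa using hlen)
      obtain ⟨-, rfl⟩ := wk_singleton.1 hP
      exact hle _ _ (.refl _) _ hP hPn)
    (by
      rintro r m' hr hv hs ⟨i1, i2, i3⟩
      have hsz : m'.nat 0 0 0 = n := by rw [hs.1 0 (by simp [WritesNat]), k0]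
      have e11 : m'.mat n 11 = m₃.mat n 11 := by
        funext i j
        rw [Memory.mat, hs.wt (by simp [WritesNat]) (by simp [WritesReal]), Memory.mat]
      have hrel := relaxed_true (dst := 12) (A := 12) (B := 11) hsz
      set m'' := (relax trueTest 12 12 11).exec m'
      have e0 : (m''.writeNat 12 0 0 (r + 1)).mat n 12 = m''.mat n 12 := by
        funext i j
        rw [Memory.mat, Memory.wt_writeNat _ (by decide)]
        rfl
      rw [e0]
      refine ⟨fun s t => (hrel.le 12 s t).trans (i1 s t), ?_, fun s t => ?_⟩
      · intro s t P hP hPn hlen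
        -- Cut at the last arc between components: what follows stays in one component, and what
        -- precedes has fewer vertices and is covered by the previous round.
        rcases exists_last_arc (fun u v => ¬ SameStrong D u v) hP with
          hin | ⟨l₁, p, q, l₂, rfl, hpq, hq⟩
        · have hst : SameStrong D s t := hin.sameStrong_of_forall fun u v h => not_not.1 h.2
          exact (hrel.le 12 s t).trans ((i1 s t).trans (hle s t hst P hP hPn))
        · have hqt : SameStrong D q t := hq.sameStrong_of_forall fun u v h => not_not.1 h.2
          obtain ⟨a1, a2⟩ := wk_split.1 hP
          obtain ⟨-, hadj, a3⟩ := wk_cons_cons.1 a2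
          have hn2 := hPn.sublist (List.sublist_append_right l₁ (p :: q :: l₂))
          rw [walkWeight_split, WithTop.coe_add]
          refine (hrel.done s p t ⟨s.2, p.2, t.2⟩ trivial).trans (add_le_add ?_ ?_)
          · refine i2 s p _ a1 (hPn.sublist (by simp)) ?_
            simp only [List.length_append, List.length_cons, List.length_nil] at hlen ⊢
            omega
          · change m'.mat n 11 p t ≤ _
            rw [e11]
            refine (hX p q t hadj hpq).trans ?_
            rw [walkWeight, WithTop.coe_add]
            exact add_le_add le_rfl (hle q t hqt _ a3 (List.nodup_cons.1 hn2).2)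
      · have hsd := hrel.sound (fun a x y w => ∀ (hx : x < n) (hy : y < n),
          (a = 12 → PathBound D c ⟨x, hx⟩ ⟨y, hy⟩ w) ∧
          (a = 11 → w ≠ ⊤ → ∃ l, D.Adj ⟨x, hx⟩ l ∧ ¬ SameStrong D ⟨x, hx⟩ l ∧
            w = c ⟨x, hx⟩ l + m.mat n 9 l ⟨y, hy⟩)) ?_ ?_ 12 s t s.2 t.2
          s.2 t.2
        · exact hsd.1 rfl
        · intro i j k _ hj _ _ x y hx hy hi hk
          refine ⟨fun _ hne => ?_, fun h => absurd h (by decide)⟩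
          have hne' := hne
          rw [Ne, WithTop.add_eq_top, not_or] at hne'
          obtain ⟨l, b1, b2, b4⟩ := (hy hj hk).2 rfl hne'.2
          rw [b4] at hne ⊢
          exact PathBound.add_of_cross b1 b2 ((hx hi hj).1 rfl) (hsound l _) hne
        · intro a x y _ _ hx hy
          refine ⟨?_, ?_⟩
          · rintro rfl
            exact i3 ⟨x, hx⟩ ⟨y, hy⟩
          · rintro rfl
            have := hX' ⟨x, hx⟩ ⟨y, hy⟩
            rw [← e11] at this
            exact this)
  rw [k0] at key
  obtain ⟨-, k2, k3⟩ := key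
  exact ⟨fun s t P hP hPn => k2 s t P hP hPn (by
    have := hPn.length_le_card
    rw [Fintype.card_fin] at this
    omega), k3⟩

/-- Write the answer. -/
def outputCmd : Cmd :=
  -- Copying fills array `3` with flags that the matrix specification knows only as zero or nonzero;
  -- the marks ensure the value `1`.
  seq (copy 1 12) (seq (mark 3 (finiteTest 12 rowIdx colIdx) (.const 1))
    (setNat 2 (.const 0) (.const 0) (.const 1)))

theorem outputCmd_spec {m : Memory} (hm : m.nat 0 0 0 = n) (s t : Fin n) :
    (m.mat n 12 s t = ⊤ ∧ (outputCmd.exec m).nat 3 s t = 0) ∨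
    (m.mat n 12 s t = (outputCmd.exec m).real 1 s t ∧ (outputCmd.exec m).nat 3 s t = 1) := by
  simp only [outputCmd, exec]
  have e1 : ((copy 1 12).exec m).mat n 1 = m.mat n 12 := mat_copy hm (by decide)
  have e12 : ((copy 1 12).exec m).mat n 12 = m.mat n 12 := mat_exec _ n (by simp) (by simp)
  have e0 : ((copy 1 12).exec m).nat 0 0 0 = n := by rw [exec_nat_of_not_writes (by simp), hm]
  set m₁ := (copy 1 12).exec m
  have e3 := nat_mark (a := 3) (by decide) (by decide) (by decide)
    (b := finiteTest 12 rowIdx colIdx) (e := .const 1) e0 (β := fun i j => m₁.mat n 12 i j ≠ ⊤)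
    (ε := fun _ _ => 1) (fun m' i j hs h4 h6 _ => by
      refine ⟨?_, fun _ => rfl⟩
      rw [finiteTest_holds, NatExpr.val_var, NatExpr.val_var, h4, h6, hs.wt (by simp) (by simp),
        Memory.mat]) s t
  have er : ((mark 3 (finiteTest 12 rowIdx colIdx) (.const 1)).exec m₁).real 1 = m₁.real 1 :=
    exec_real_of_not_writes (by simp) _
  set m₂ := (mark 3 (finiteTest 12 rowIdx colIdx) (.const 1)).exec m₁
  have f3 : ∀ x, (m₂.writeNat 2 0 0 x).nat 3 = m₂.nat 3 := by
    intro x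
    funext i j
    simp [Memory.writeNat]
  have fr : ∀ x, (m₂.writeNat 2 0 0 x).real = m₂.real := fun x => rfl
  simp only [NatExpr.val, f3, fr, er]
  rw [e3, e12]
  by_cases hne : m.mat n 12 s t = ⊤
  · refine Or.inl ⟨hne, ?_⟩
    rw [if_neg (not_not.2 hne)]
    rw [← e1, Memory.mat] at hne
    by_contra h3
    exact Memory.wt_ne_top.2 h3 hne
  · refine Or.inr ⟨?_, if_pos hne⟩
    rw [← e1, Memory.mat] at hne ⊢
    exact Memory.wt_of_ne (Memory.wt_ne_top.1 hne)

/-! ### The algorithm -/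

/-- The algorithm for all pairs shortest paths. -/
def apspCmd (γ : ℕ) : Cmd :=
  seq (insideCmd γ) (ite (.natEq (.var 30) (.const 0))
    (seq componentCmd (seq crossCmd outputCmd)) skip)

theorem apspCmd_correct (γ : ℕ) (hloop : ∀ v, ¬ D.Adj v v) (hγ : HasFewNegTrees D c γ) :
    IsAPSPSolution D c ((apspCmd γ).exec (inputMemory D c)) := by
  have hin := hasInput_inputMemory D c
  obtain ⟨h1, hflag, hdist⟩ := insideCmd_spec γ hloop hγ hin (by
    intro a ha i j
    have h0 : a ≠ 0 := by omega
    have h1 : a ≠ 1 := by omega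
    simp [inputMemory, h0, h1])
  have e2 : ((insideCmd γ).exec (inputMemory D c)).nat 2 0 0 = 0 := by
    rw [exec_nat_of_not_writes (insideCmd_keeps_nat (by decide))]
    simp [inputMemory]
  simp only [apspCmd, exec]
  set m₁ := (insideCmd γ).exec (inputMemory D c)
  have htest : (Test.natEq (.var 30) (.const 0)).holds m₁ ↔ IsNearlyConservative D c := by
    rw [← nonnegLongCycles_iff, ← hflag]
    rfl
  by_cases hD : IsNearlyConservative D c
  · rw [if_pos (htest.2 hD)]
    have hD' := nonnegLongCycles_iff.2 hD
    obtain ⟨a1, a2⟩ := componentCmd_spec hloop h1 (fun s t hst => (hdist hD' s t).1 hst)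
      (fun s t => (hdist hD' s t).2)
    have h2 : HasBlocks D c (componentCmd.exec m₁) := h1.sameOff (sameOff_exec _ m₁)
      (by simp [componentCmd_writesNat]) (by simp [componentCmd_writesReal])
    set m₂ := componentCmd.exec m₁
    obtain ⟨b1, b2⟩ := crossCmd_spec h2.toHasStrong a1 a2
    have hsz : (crossCmd.exec m₂).nat 0 0 0 = n := by
      rw [exec_nat_of_not_writes (by simp [crossCmd_writesNat]), h2.size]
    set m₃ := crossCmd.exec m₂
    refine Or.inl ⟨hD, ?_, fun s t => ?_⟩
    · simp [outputCmd, exec, Memory.writeNat, NatExpr.val]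
    · rcases outputCmd_spec hsz s t with ⟨c1, c2⟩ | ⟨c1, c2⟩
      · refine Or.inr ⟨?_, c2⟩
        rintro ⟨P, hP, hPn⟩
        have := b1 s t P hP hPn
        rw [c1] at this
        exact absurd (top_le_iff.1 this) WithTop.coe_ne_top
      · obtain ⟨p, hp, hpn, hpw⟩ := b2 s t (by rw [c1]; exact WithTop.coe_ne_top)
        have hpw' := b1 s t p hp hpn
        rw [c1] at hpw hpw'
        refine Or.inl ⟨⟨p, hp, hpn⟩, c2, ⟨p, ⟨hp, hpn⟩, ?_⟩, ?_⟩
        · exact le_antisymm (WithTop.coe_le_coe.1 hpw') (WithTop.coe_le_coe.1 hpw)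
        · rintro x ⟨q, ⟨hq, hqn⟩, rfl⟩
          have := b1 s t q hq hqn
          rw [c1] at this
          exact WithTop.coe_le_coe.1 this
  · rw [if_neg (mt htest.1 hD)]
    exact Or.inr ⟨hD, e2⟩

end

section

namespace Cmd

/-! ### The running time -/

/-- The command is well formed, has loops of depth at most `4`, and does not change the number of
vertices. -/
structure Fast (P : Cmd) : Prop where
  wf : P.Wf
  depth : P.depth ≤ 4
  keeps : ¬ P.WritesNat 0

theorem Fast.seq {P Q : Cmd} (hP : P.Fast) (hQ : Q.Fast) : (seq P Q).Fast :=
  ⟨⟨hP.wf, hQ.wf⟩, max_le hP.depth hQ.depth, fun h => h.elim hP.keeps hQ.keeps⟩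

theorem Fast.ite {P Q : Cmd} {b : Test} (hP : P.Fast) (hQ : Q.Fast) : (ite b P Q).Fast :=
  ⟨⟨hP.wf, hQ.wf⟩, max_le hP.depth hQ.depth, fun h => h.elim hP.keeps hQ.keeps⟩

theorem fast_skip : Fast skip := ⟨trivial, Nat.zero_le _, id⟩

theorem fast_setNat {a : ℕ} (ha : 0 ≠ a) (i j e : NatExpr) : Fast (setNat a i j e) :=
  ⟨trivial, Nat.zero_le _, ha⟩

theorem fill_wf (a : ℕ) (b : Test) (e : RealExpr) : (fill a b e).Wf := by
  simp [fill, Wf, WritesNat]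
  omega

theorem fill_depth (a : ℕ) (b : Test) (e : RealExpr) : (fill a b e).depth = 2 := rfl

theorem relax_wf (b : Test) (dst A B : ℕ) : (relax b dst A B).Wf := by
  simp [relax, relaxRow, relaxBody, Wf, WritesNat]
  omega

theorem relax_depth (b : Test) (dst A B : ℕ) : (relax b dst A B).depth = 3 := rfl

theorem mark_wf {a : ℕ} (h4 : 4 ≠ a) (h6 : 6 ≠ a) (b : Test) (e : NatExpr) : (mark a b e).Wf := by
  simp [mark, Wf, WritesNat, h4, h6]

theorem mark_depth (a : ℕ) (b : Test) (e : NatExpr) : (mark a b e).depth = 2 := rfl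

theorem flagScan_wf {a : ℕ} (h4 : 4 ≠ a) (h6 : 6 ≠ a) (b : Test) : (flagScan a b).Wf := by
  simp [flagScan, Wf, WritesNat, h4, h6]

theorem flagScan_depth (a : ℕ) (b : Test) : (flagScan a b).depth = 2 := rfl

theorem closure_depth (a : ℕ) (b : Test) (e : RealExpr) : (closure a b e).depth = 3 := rfl

theorem fast_fill (a : ℕ) (b : Test) (e : RealExpr) : Fast (fill a b e) :=
  ⟨fill_wf _ _ _, by rw [fill_depth]; decide, by simp⟩

theorem fast_relax (b : Test) (dst A B : ℕ) : Fast (relax b dst A B) :=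
  ⟨relax_wf _ _ _ _, by rw [relax_depth]; decide, by simp⟩

theorem fast_closure (a : ℕ) (b : Test) (e : RealExpr) : Fast (closure a b e) :=
  (fast_fill _ _ _).seq (fast_relax _ _ _ _)

theorem fast_mark {a : ℕ} (h4 : 4 ≠ a) (h6 : 6 ≠ a) (h0 : 0 ≠ a) (b : Test) (e : NatExpr) :
    Fast (mark a b e) :=
  ⟨mark_wf h4 h6 b e, by rw [mark_depth]; decide, by simp [h0]⟩

theorem fast_flagScan {a : ℕ} (h4 : 4 ≠ a) (h6 : 6 ≠ a) (h0 : 0 ≠ a) (b : Test) :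
    Fast (flagScan a b) :=
  ⟨flagScan_wf h4 h6 b, by rw [flagScan_depth]; decide, by simp [h0]⟩

theorem Fast.for_ {v : ℕ} {P : Cmd} (hP : P.Fast) (hd : P.depth ≤ 3) (hv : ¬ P.WritesNat v)
    (h0 : 0 ≠ v) : (for_ v P).Fast :=
  ⟨⟨hv, hP.wf⟩, Nat.succ_le_succ hd, fun h => h.elim h0 hP.keeps⟩

theorem fast_mulCmd (dst A B : ℕ) : Fast (mulCmd dst A B) :=
  (fast_fill _ _ _).seq (fast_relax _ _ _ _)

/-- The recursion only concatenates commands, so neither `k` nor the number of sequences adds to the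
nesting depth. -/
theorem fast_seqCmd (k r : ℕ) (L : List ℕ) : Fast (seqCmd k r L) := by
  induction k generalizing r L with
  | zero => exact fast_relax _ _ _ _
  | succ k ih =>
    refine (fast_relax _ _ _ _).seq ?_
    have key : ∀ L' : List ℕ, Fast (L'.foldr (fun T P =>
        Cmd.seq (Cmd.seq (flagScan 30 (negSumTest (21 + 2 * r) (20 + 2 * T)))
          (Cmd.seq (stepCmd r T) (seqCmd k (r + 1) (L.erase T)))) P) skip) := by
      intro L'
      induction L' with
      | nil => exact fast_skip
      | cons T L' ihL =>
        exact ((fast_flagScan (by decide) (by decide) (by decide) _).seq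
          (((fast_mulCmd _ _ _).seq (fast_mulCmd _ _ _)).seq (ih _ _))).seq ihL
    exact key L

end Cmd

open Cmd

theorem fast_tausCmd (γ : ℕ) : Fast (tausCmd γ) := by
  induction γ with
  | zero => exact fast_skip
  | succ γ ih => exact ih.seq (fast_fill _ _ _)

theorem fast_isRootCmd : Fast isRootCmd :=
  (fast_mark (by decide) (by decide) (by decide) _ _).seq
    ((fast_skip.seq (fast_mark (by decide) (by decide) (by decide) _ _)).for_
      (by simp [depth, mark_depth]) (by simp [WritesNat]) (by decide))

/-- Depth four arises where a loop over all vertices surrounds a closure or relaxation of depth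
three (separators, forest test, the final rounds), and in the labels, where it surrounds the root
test of depth three. Everything else is shallower. -/
theorem fast_apspCmd (γ : ℕ) : Fast (apspCmd γ) := by
  refine Fast.seq (Fast.seq (Fast.seq ?_ (Fast.seq ?_ (Fast.seq ?_ (Fast.seq ?_ ?_))))
    (Fast.seq (Fast.seq ?_ (Fast.seq ?_ (Fast.seq ?_ (fast_tausCmd γ)))) (Fast.seq ?_
      (Fast.seq ?_ (fast_seqCmd _ _ _))))) (Fast.ite (Fast.seq (Fast.seq ?_ ?_) (Fast.seq
      (Fast.seq ?_ (Fast.seq ?_ (Fast.seq ?_ ?_))) (Fast.seq ?_ (Fast.seq ?_ ?_)))) fast_skip)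
  · exact fast_closure _ _ _
  · exact ((fast_closure _ _ _).seq (fast_mark (by decide) (by decide) (by decide) _ _)).for_
      (by simp [depth, mark_depth, closure_depth]) (by simp [WritesNat]) (by decide)
  · exact ((fast_closure _ _ _).seq (fast_flagScan (by decide) (by decide) (by decide) _)).for_
      (by simp [depth, flagScan_depth, closure_depth]) (by simp [WritesNat]) (by decide)
  · exact fast_closure _ _ _
  · exact fast_flagScan (by decide) (by decide) (by decide) _
  · exact fast_closure _ _ _
  · exact (fast_skip.seq (fast_mark (by decide) (by decide) (by decide) _ _)).for_
      (by simp [depth, mark_depth]) (by simp [WritesNat]) (by decide)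
  · exact (fast_isRootCmd.seq (fast_mark (by decide) (by decide) (by decide) _ _)).for_
      (by simp [depth, mark_depth, isRootCmd]) (by simp [WritesNat, isRootCmd]) (by decide)
  · exact fast_fill _ _ _
  · exact fast_fill _ _ _
  · exact fast_fill _ _ _
  · exact (fast_relax _ _ _ _).for_ (by rw [relax_depth]) (by simp) (by decide)
  · exact fast_fill _ _ _
  · exact fast_mulCmd _ _ _
  · exact fast_fill _ _ _
  · exact (fast_relax _ _ _ _).for_ (by rw [relax_depth]) (by simp) (by decide)
  · exact fast_fill _ _ _
  · exact fast_mark (by decide) (by decide) (by decide) _ _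
  · exact fast_setNat (by decide) _ _ _

end

end NearlyConservative

end

theorem mainTheorem6 (γ : ℕ) :
    ∃ (P : NearlyConservative.Program) (C : ℕ),
      ∀ (n : ℕ), 0 < n →
      ∀ (D : Digraph (Fin n)) (c : Fin n → Fin n → ℝ),
        (∀ v, ¬ D.Adj v v) →
        NearlyConservative.HasFewNegTrees D c γ →
        ∃ (m : NearlyConservative.Memory) (τ : ℕ),
          NearlyConservative.Runs P (NearlyConservative.inputMemory D c) m τ ∧
          τ ≤ C * n ^ 4 ∧
          NearlyConservative.IsAPSPSolution D c m := by
  refine ⟨(NearlyConservative.apspCmd γ).prog, (NearlyConservative.apspCmd γ).size, ?_⟩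
  intro n hn D c hloop hγ
  have hfast := NearlyConservative.fast_apspCmd γ
  obtain ⟨τ, hτ, hruns⟩ := NearlyConservative.Cmd.runs hfast.wf hfast.keeps hn
    (NearlyConservative.inputMemory D c) (NearlyConservative.hasInput_inputMemory D c).size
  exact ⟨_, τ, hruns, hτ.trans (Nat.mul_le_mul_left _ (Nat.pow_le_pow_right hn hfast.depth)),
    NearlyConservative.apspCmd_correct γ hloop hγ⟩
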